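/- **Model.** For each input size, an MPC algorithm consists of machines with a local space of $S$ words each, where a word has $O(\log n)$ bits. The input records (edges of a graph, or triples of two points and their distance) are initially distributed over the machines in an arbitrary way that respects the local space. The computation proceeds in synchronous rounds. In each round every machine performs an arbitrary computation on its local data and on a random seed, and then sends messages to other machines, which are delivered at the beginning of the next round; the machines share the random seed. At all times each machine stores at most $S$ words, and in each round it sends at most $S$ words and receives at most $S$ words. In the last round the machines write their outputs (at most $S$ words each), so an algorithm has at least one round. An algorithm solves a problem on inputs of size $n$ if, on each such input and for each initial distribution, the machines can hold the input, the resource bounds are obeyed, and the output is correct with probability at least $1-1/n$. For the MST problem the edges of the tree may be written by different machines. "Space $n^{1-\Omega(1)}$ per machine and total space $\mathrm{poly}(n)$" means: at most $n^{\delta}$ words per machine and at most $n^{C}$ words in total, for some constants $\delta<1$ and $C$. **1-vs-2-cycle conjecture.** No MPC algorithm with $n^{1-\Omega(1)}$ local space and $\mathrm{poly}(n)$ machines distinguishes, for all sufficiently large $n$, a cycle on $2n$ vertices from two disjoint cycles on $n$ vertices each in $o(\log n)$ rounds. (In its $\Omega$-form: for all constants $\delta<1$ and $C$ there is $c>0$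 such that for all sufficiently large $n$ each such algorithm needs at least $c\log n$ rounds.) **Theorem.** Let $\delta<1$ and $C$ be constants. Under the 1-vs-2-cycle conjecture, any MPC algorithm with at most $n^{\delta}$ words of space per machine and at most $n^{C}$ words of total space requires $\Omega(\log\frac1\epsilon)$ rounds to compute a $(1+\epsilon)$-approximate minimum spanning tree of an $n$-point metric, for any $1/n\le\epsilon\le1$, even if only $(1,2)$-metrics (all distances between distinct points are $1$ or $2$) are allowed as inputs. Precisely: 1. Assume the conjecture. If $\epsilon=\epsilon(n)$ satisfies $1/n\le\epsilon(n)\le1$ for all large $n$, then no family of such algorithms computes, for all large $n$, a $(1+\epsilon(n))$-approximate MST of every $(1,2)$-metric on $n$ points in $o(\log\frac1{\epsilon(n)})$ rounds. 2. Assume the conjecture in its $\Omega$-form. Then there is a constant $c>0$, depending only on $\delta$ and $C$, such that for all sufficiently large $n$ and all $1/n\le\epsilon\le1$, each such algorithm that computes a $(1+\epsilon)$-approximate MST of every $(1,2)$-metric on $n$ points uses at least $c\log\frac1\epsilon$ rounds. -/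

import Mathlib

open Filter Asymptotics
open scoped ENNReal

/-- A (randomized, non-uniform) algorithm of the Massively Parallel Computation model for one
input size. There are `machines` machines; each has a local memory of `space` words, a word being
a natural number below `wordBound`. Computation goes in synchronous rounds: in a round every
machine, by an arbitrary function of its local data (infinite computing power), computes its new
memory and the messages that it sends (`step`); messages are delivered at the beginning of the
next round. In the last round the machines write their outputs (`output`) instead of sending
messages, so an algorithm with `exchanges` communication phases has `exchanges + 1` rounds.
All machines see the same random seed, drawn from an arbitrary finite probability space. -/
structure MPCAlgorithm where
  /-- number of machines -/
  machines : ℕ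
  /-- local space, in words -/
  space : ℕ
  /-- every word is less than this number -/
  wordBound : ℕ
  /-- number of communication phases -/
  exchanges : ℕ
  /-- the sample space of the random seed -/
  Seed : Type
  /-- the sample space is finite -/
  seedFintype : Fintype Seed
  /-- the distribution of the random seed -/
  law : PMF Seed
  /-- `step ω t i mem inbox` is the new memory of machine `i` after the processing phase of
  round `t`, and the message it sends to each machine; `inbox j` is what it received from `j` -/
  step : Seed → ℕ → Fin machines → List ℕ → (Fin machines → List ℕ) →
    List ℕ × (Fin machines → List ℕ)
  /-- what a machine writes in the last round, given its memory and its inbox -/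
  output : Seed → Fin machines → List ℕ → (Fin machines → List ℕ) → List ℕ

/-- The contents of all memories and inboxes of `M` machines at the beginning of a round;
`inbox i j` is the message that machine `i` received from machine `j`. -/
structure MPCConfig (M : ℕ) where
  /-- the local memories -/
  mem : Fin M → List ℕ
  /-- the received messages -/
  inbox : Fin M → Fin M → List ℕ

namespace MPCAlgorithm

/-- The number of rounds. -/
def rounds (A : MPCAlgorithm) : ℕ := A.exchanges + 1

/-- The configuration after `t` communication phases, from given initial memories. -/
def config (A : MPCAlgorithm) (ω : A.Seed) (init : Fin A.machines → List ℕ) :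
    ℕ → MPCConfig A.machines
  | 0 => ⟨init, fun _ _ => []⟩
  | t + 1 =>
    let c := A.config ω init t
    ⟨fun i => (A.step ω t i (c.mem i) (c.inbox i)).1,
      fun j i => (A.step ω t i (c.mem i) (c.inbox i)).2 j⟩

/-- The words that the machines write in the last round. -/
def result (A : MPCAlgorithm) (ω : A.Seed) (init : Fin A.machines → List ℕ)
    (i : Fin A.machines) : List ℕ :=
  A.output ω i ((A.config ω init A.exchanges).mem i) ((A.config ω init A.exchanges).inbox i)

/-- The run obeys the resource bounds: at all times, each machine stores at most `space` words,
the total size of the messages that it receives in a round is at most `space`, the total size of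
the messages that it sends in a round is at most `space`, its output has at most `space` words,
and all these words are below `wordBound`. -/
def ObeysBounds (A : MPCAlgorithm) (ω : A.Seed) (init : Fin A.machines → List ℕ) : Prop :=
  (∀ t ≤ A.exchanges, ∀ i : Fin A.machines,
    ((A.config ω init t).mem i).length ≤ A.space ∧
    (∀ x ∈ (A.config ω init t).mem i, x < A.wordBound) ∧
    ∑ j, ((A.config ω init t).inbox i j).length ≤ A.space ∧
    ∑ j, ((A.config ω init t).inbox j i).length ≤ A.space ∧
    ∀ j, ∀ x ∈ (A.config ω init t).inbox i j, x < A.wordBound) ∧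
  ∀ i : Fin A.machines, (A.result ω init i).length ≤ A.space ∧
    ∀ x ∈ A.result ω init i, x < A.wordBound

/-- `D` distributes the records of the input (each written as the words `enc a`) over the
machines, in some order on each machine, and every machine has room for its share. -/
def IsPlacement (A : MPCAlgorithm) {α : Type} (input : Multiset α) (enc : α → List ℕ)
    (D : Fin A.machines → List α) : Prop :=
  ∑ i, (D i : Multiset α) = input ∧ ∀ i, ((D i).flatMap enc).length ≤ A.space

/-- On the given input, the machines have enough space to hold the input and, however the input
is initially distributed over the machines, the resource bounds are always obeyed and the outputs
satisfy `good` with probability at least `1 - 1 / n`. -/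
def SucceedsWHP (A : MPCAlgorithm) (n : ℕ) {α : Type} (input : Multiset α) (enc : α → List ℕ)
    (good : (Fin A.machines → List ℕ) → Prop) : Prop :=
  (∃ D, A.IsPlacement input enc D) ∧
  ∀ D, A.IsPlacement input enc D →
    (∀ ω, A.ObeysBounds ω fun i => (D i).flatMap enc) ∧
    1 - 1 / (n : ℝ≥0∞) ≤ A.law.toOuterMeasure
      {ω | good (A.result ω fun i => (D i).flatMap enc)}

/-- The resources allowed for size `n`: at most `n ^ δ` words of space per machine and at most
`n ^ C` words of space in total, where a word has at most `C * log n` bits. -/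
def HasResources (A : MPCAlgorithm) (δ : ℝ) (C n : ℕ) : Prop :=
  (A.space : ℝ) ≤ (n : ℝ) ^ δ ∧ A.machines * A.space ≤ n ^ C ∧ A.wordBound ≤ n ^ C

end MPCAlgorithm

/-- The pairs `u < v` of vertices. -/
def vertexPairs (N : ℕ) : Finset (Fin N × Fin N) := Finset.univ.filter fun e => e.1 < e.2

open scoped Classical in
/-- The edge list of a graph, each edge listed once. -/
noncomputable def edgeRecords {N : ℕ} (G : SimpleGraph (Fin N)) : Finset (Fin N × Fin N) :=
  (vertexPairs N).filter fun e => G.Adj e.1 e.2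

/-- A pair of vertices, written as two words. -/
def pairWords {N : ℕ} (e : Fin N × Fin N) : List ℕ := [(e.1 : ℕ), (e.2 : ℕ)]

/-- A cycle on `2 * n` vertices. -/
def IsOneCycle (n : ℕ) (G : SimpleGraph (Fin (2 * n))) : Prop :=
  Nonempty (G ≃g SimpleGraph.cycleGraph (2 * n))

/-- Two disjoint cycles on `n` vertices each. -/
def IsTwoCycles (n : ℕ) (G : SimpleGraph (Fin (2 * n))) : Prop :=
  Nonempty (G ≃g SimpleGraph.cycleGraph n ⊕g SimpleGraph.cycleGraph n)

/-- The algorithm distinguishes, with high probability, a cycle on `2 * n` vertices from two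
cycles on `n` vertices each: machine `0` writes `1` in the first case, `0` in the second. -/
def MPCAlgorithm.SolvesOneVsTwoCycle (A : MPCAlgorithm) (n : ℕ) : Prop :=
  ∀ G : SimpleGraph (Fin (2 * n)),
    (IsOneCycle n G →
      A.SucceedsWHP n (edgeRecords G).val pairWords
        fun out => ∃ i, i.val = 0 ∧ out i = [1]) ∧
    (IsTwoCycles n G →
      A.SucceedsWHP n (edgeRecords G).val pairWords
        fun out => ∃ i, i.val = 0 ∧ out i = [0])

/-- `w` is a metric (with integer distances). -/
structure IsIntMetric {V : Type} (w : V → V → ℕ) : Prop where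
  eq_zero_iff : ∀ u v, w u v = 0 ↔ u = v
  symm : ∀ u v, w u v = w v u
  triangle : ∀ u v x, w u x ≤ w u v + w v x

/-- `w` is a `(1, 2)`-metric: all distances between distinct points are `1` or `2`. -/
def IsOneTwoMetric {V : Type} (w : V → V → ℕ) : Prop :=
  IsIntMetric w ∧ ∀ u v, u ≠ v → w u v = 1 ∨ w u v = 2

/-- The total weight of the edges of a graph. -/
noncomputable def graphWeight {n : ℕ} (w : Fin n → Fin n → ℕ) (T : SimpleGraph (Fin n)) : ℕ :=
  ∑ e ∈ edgeRecords T, w e.1 e.2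

/-- `T` is a spanning tree of weight at most `1 + ε` times the minimum. -/
def IsApproxMST {n : ℕ} (w : Fin n → Fin n → ℕ) (ε : ℝ) (T : SimpleGraph (Fin n)) : Prop :=
  T.IsTree ∧ ∀ T' : SimpleGraph (Fin n), T'.IsTree →
    (graphWeight w T : ℝ) ≤ (1 + ε) * graphWeight w T'

/-- The weight of a pair of points, written as three words. -/
def weightWords {n : ℕ} (w : Fin n → Fin n → ℕ) (e : Fin n × Fin n) : List ℕ :=
  [(e.1 : ℕ), (e.2 : ℕ), w e.1 e.2]

/-- The algorithm computes, with high probability, a `(1 + ε)`-approximate minimum spanning tree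
of every `(1, 2)`-metric on `n` points. The input consists of all distances; in the end the
machines together have written the list of the edges of the tree. -/
def MPCAlgorithm.SolvesMST (A : MPCAlgorithm) (n : ℕ) (ε : ℝ) : Prop :=
  ∀ w : Fin n → Fin n → ℕ, IsOneTwoMetric w →
    A.SucceedsWHP n (vertexPairs n).val (weightWords w)
      fun out => ∃ E : Fin A.machines → List (Fin n × Fin n),
        (∀ i, out i = (E i).flatMap pairWords) ∧
        IsApproxMST w ε (SimpleGraph.fromRel fun u v => ∃ i, (u, v) ∈ E i)

/-- The 1-vs-2-cycle conjecture: no MPC algorithm with `n ^ (1 - Ω(1))` local space and `poly(n)`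
machines distinguishes a cycle on `2 n` vertices from two cycles on `n` vertices in `o(log n)`
rounds. -/
def OneVsTwoCycleConjecture : Prop :=
  ∀ (δ : ℝ) (C : ℕ), δ < 1 → ¬ ∃ A : ℕ → MPCAlgorithm,
    (∀ᶠ n in atTop, (A n).HasResources δ C n ∧ (A n).SolvesOneVsTwoCycle n) ∧
    (fun n => ((A n).rounds : ℝ)) =o[atTop] fun n : ℕ => Real.log n

/-- The 1-vs-2-cycle conjecture with `Ω`: every MPC algorithm with `n ^ (1 - Ω(1))` local space
and `poly(n)` machines that distinguishes a cycle on `2 n` vertices from two cycles on `n`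
vertices needs `Ω(log n)` rounds, i.e. at least `c * log n` rounds for every large `n`. -/
def OneVsTwoCycleConjectureOmega : Prop :=
  ∀ (δ : ℝ) (C : ℕ), δ < 1 → ∃ c : ℝ, 0 < c ∧ ∀ᶠ n : ℕ in atTop, ∀ A : MPCAlgorithm,
    A.HasResources δ C n → A.SolvesOneVsTwoCycle n → c * Real.log n ≤ A.rounds

/-! Let `π` be the next-dart permutation of a 2-regular graph on `2N` vertices: it moves each of the
`4N` darts (a vertex with a direction) one step ahead. On a cycle of length `m`, `π ^ t` fixes a
dart iff `m ∣ t`. Hence `π ^ N` is the identity for two `N`-cycles and moves every dart of a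
`2N`-cycle, and a single entry of its matrix decides the problem. With `N` written in base `k`,
Horner's scheme `σ ↦ π ^ i * σ ^ k` reaches `π ^ N` in about `log N / log k` steps. An MST algorithm
with `R` rounds performs such a step in `O(R)` rounds with `k` a fixed power of `1/ε`. The total is
`O(R * log N / log (1/ε))`, so the conjecture forces `R` to be of order `log (1/ε)`.

One step has to test whether `π ^ i * σ ^ k` maps `x` to `y`. The factors of the product join
consecutive layers `0, ..., 2k`; two mirror copies of this layered graph are glued along layer `0`.
The result is a family of disjoint paths (strands) with `m = 4k + 2` vertices, and joining the two
points `y` of the outermost layer closes exactly one of them to a cycle: the strand through `x` in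
the middle iff the product maps `x` to `y`. Adjacent points get distance 1, all others distance 2.
The points are renamed at random. A spanning tree misses an edge of the cycle, each equally likely
by rotation, so the middle edge of a closed strand is missing with probability at least `1/(2m)`
(`weightOf_missing_cycle`). An approximate tree misses at most `2εn + 1` middle edges of the other
strands (`card_missing_le`), and symmetry spreads these over all of about `n/m` strands
(`weightOf_missing_path`). The two cases are far apart once `m² ε` is small, which allows `k` to be
a small power of `1/ε`.

By a Chernoff and a union bound, one fixed table of polynomially many renamings and seeds separates
the two cases for all `i, σ, π, x, y` simultaneously (`exists_table`). The model is non-uniform, so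
the table is built into a deterministic algorithm. That algorithm runs all copies in parallel
(`trace_sim`). Each distance depends on one entry of `σ` and of `π` (`layeredAdj_congr`), so the
machines that store this entry can supply it (`trace_scatter`), and the missing edges are counted by
an all-reduce in constantly many rounds (`trace_allReduce`). Taking `N` to be `n` to a power
slightly below 1 leaves room for the layers and keeps the local space `N ^ δ'` with `δ' < 1`
(`exists_reduction`). -/

/-! ### Programs on networks with an arbitrary index type -/

/-- Memories and inboxes of a network of machines indexed by `U`. -/
structure NetConfig (U : Type) where
  mem : U → List ℕ
  inbox : U → U → List ℕ

/-- What the machines of a network do in one round. -/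
abbrev NetStep (U : Type) := U → List ℕ → (U → List ℕ) → List ℕ × (U → List ℕ)

namespace NetConfig

variable {U : Type}

/-- The configuration with the given memories, in which no message is pending. -/
def quiet (m : U → List ℕ) : NetConfig U := ⟨m, fun _ _ => []⟩

/-- The configuration after one more round. -/
def next (f : NetStep U) (c : NetConfig U) : NetConfig U :=
  ⟨fun u => (f u (c.mem u) (c.inbox u)).1, fun v u => (f u (c.mem u) (c.inbox u)).2 v⟩

/-- The configuration after running a program. -/
def run : List (NetStep U) → NetConfig U → NetConfig U
  | [], c => c
  | f :: p, c => run p (c.next f)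

/-- The space and communication bounds of one configuration. -/
structure Bounded [Fintype U] (S W : ℕ) (c : NetConfig U) : Prop where
  mem_len : ∀ u, (c.mem u).length ≤ S
  mem_lt : ∀ u, ∀ x ∈ c.mem u, x < W
  recv : ∀ u, ∑ v, (c.inbox u v).length ≤ S
  sent : ∀ u, ∑ v, (c.inbox v u).length ≤ S
  inbox_lt : ∀ u v, ∀ x ∈ c.inbox u v, x < W

/-- The program leads from `c` to `c'`, and the bounds hold after each of its rounds. -/
def Trace [Fintype U] (S W : ℕ) : List (NetStep U) → NetConfig U → NetConfig U → Prop
  | [], c, c' => c = c'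
  | f :: p, c, c' => (c.next f).Bounded S W ∧ Trace S W p (c.next f) c'

variable [Fintype U] {S W : ℕ}

theorem Trace.append {p q : List (NetStep U)} {c c₁ c₂ : NetConfig U}
    (h₁ : Trace S W p c c₁) (h₂ : Trace S W q c₁ c₂) : Trace S W (p ++ q) c c₂ := by
  induction p generalizing c with
  | nil => cases h₁; exact h₂
  | cons f p ih => exact ⟨h₁.1, ih h₁.2⟩

theorem Trace.run_eq {p : List (NetStep U)} {c c' : NetConfig U} (h : Trace S W p c c') :
    run p c = c' := by
  induction p generalizing c with
  | nil => exact h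
  | cons f p ih => exact ih h.2

theorem Trace.bounded_take {p : List (NetStep U)} {c c' : NetConfig U} (h : Trace S W p c c')
    (hc : c.Bounded S W) (t : ℕ) : (run (p.take t) c).Bounded S W := by
  induction p generalizing c t with
  | nil => simpa [run] using hc
  | cons f p ih =>
    cases t with
    | zero => simpa [run] using hc
    | succ t => exact ih h.2 h.1 t

theorem bounded_quiet {m : U → List ℕ} (h₁ : ∀ u, (m u).length ≤ S)
    (h₂ : ∀ u, ∀ x ∈ m u, x < W) : (quiet m).Bounded S W :=
  ⟨h₁, h₂, by simp [quiet], by simp [quiet], by simp [quiet]⟩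

end NetConfig

open NetConfig

/-! ### From network programs to MPC algorithms -/

/-- The deterministic algorithm that runs a program on a network and then writes `out`. -/
noncomputable def compileNet {U : Type} {m : ℕ} (e : U ≃ Fin m) (S W : ℕ) (prog : List (NetStep U))
    (out : U → List ℕ → List ℕ) : MPCAlgorithm where
  machines := m
  space := S
  wordBound := W
  exchanges := prog.length
  Seed := Unit
  seedFintype := inferInstance
  law := PMF.pure ()
  step _ t i mem inbox :=
    let r := (prog.getD t fun _ m _ => (m, fun _ => [])) (e.symm i) mem fun v => inbox (e v)
    (r.1, fun j => r.2 (e.symm j))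
  output _ i mem _ := out (e.symm i) mem

section compile

variable {U : Type} {m : ℕ} (e : U ≃ Fin m) (S W : ℕ) (prog : List (NetStep U))
  (out : U → List ℕ → List ℕ)

theorem compileNet_config (ω : Unit) (init : Fin m → List ℕ) (t : ℕ) (ht : t ≤ prog.length) :
    ((compileNet e S W prog out).config ω init t).mem =
        (fun i => (run (prog.take t) (quiet fun u => init (e u))).mem (e.symm i)) ∧
      ((compileNet e S W prog out).config ω init t).inbox =
        fun i j => (run (prog.take t) (quiet fun u => init (e u))).inbox (e.symm i) (e.symm j) := by
  induction t with
  | zero =>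
    refine ⟨funext fun i => ?_, rfl⟩
    exact congrArg init (e.apply_symm_apply i).symm
  | succ t ih =>
    obtain ⟨ih₁, ih₂⟩ := ih (by omega)
    have hlt : t < prog.length := ht
    have htake : prog.take (t + 1) = prog.take t ++ [prog[t]] := by
      rw [List.take_append_getElem]
    -- The default of `getD` plays no role: only rounds below `prog.length` are followed by an
    -- exchange.
    have hget : prog.getD t (fun _ m _ => (m, fun _ => [])) = prog[t] := by
      simp [List.getD_eq_getElem?_getD, List.getElem?_eq_getElem hlt]
    rw [htake]
    have hrun : ∀ c : NetConfig U, run (prog.take t ++ [prog[t]]) c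
        = (run (prog.take t) c).next prog[t] := by
      intro c
      generalize prog.take t = l
      induction l generalizing c with
      | nil => rfl
      | cons f l ih => exact ih _
    rw [hrun]
    constructor
    · funext i
      have h₁ := congrFun ih₁ i
      have h₂ := congrFun ih₂ i
      simp only [MPCAlgorithm.config, NetConfig.next]
      rw [h₁, h₂]
      simp only [compileNet]
      rw [hget]
      simp
    · funext j i
      have h₁ := congrFun ih₁ i
      have h₂ := congrFun ih₂ i
      simp only [MPCAlgorithm.config, NetConfig.next]
      rw [h₁, h₂]
      simp only [compileNet]
      rw [hget]
      simp

/-- The seed is trivial, so a program that is right for every placement succeeds with probability 1.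
The bounds at intermediate times are those recorded in the trace. -/
theorem compileNet_succeeds [Fintype U] (n : ℕ) {α : Type} (input : Multiset α)
    (enc : α → List ℕ) (u₀ : U) (h₀ : (e u₀).val = 0) (ans : List ℕ)
    (hplace : ∃ D : U → List α, ∑ u, (D u : Multiset α) = input ∧
      ∀ u, ((D u).flatMap enc).length ≤ S)
    (henc : ∀ a ∈ input, ∀ x ∈ enc a, x < W)
    (hrun : ∀ D : U → List α, ∑ u, (D u : Multiset α) = input →
      (∀ u, ((D u).flatMap enc).length ≤ S) →
      ∃ mem, Trace S W prog (quiet fun u => (D u).flatMap enc) (quiet mem) ∧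
        (∀ u, (out u (mem u)).length ≤ S ∧ ∀ x ∈ out u (mem u), x < W) ∧
        out u₀ (mem u₀) = ans) :
    (compileNet e S W prog out).SucceedsWHP n input enc fun o => ∃ i, i.val = 0 ∧ o i = ans := by
  constructor
  · obtain ⟨D, hD, hS⟩ := hplace
    refine ⟨fun i => D (e.symm i), ?_, fun i => hS _⟩
    rw [← hD]
    exact Equiv.sum_comp e.symm fun u => (D u : Multiset α)
  · rintro (D : Fin m → List α) ⟨hD, hS⟩
    have hD' : ∑ i : Fin m, (D i : Multiset α) = input := hD
    obtain ⟨mem, htr, hout, hans⟩ := hrun (fun u => D (e u))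
      (by rw [← hD']; exact Equiv.sum_comp e fun i => (D i : Multiset α)) (fun u => hS _)
    have hmemin : ∀ u, ∀ a ∈ D (e u), a ∈ input := by
      intro u a ha
      rw [← hD', Multiset.mem_sum]
      exact ⟨e u, Finset.mem_univ _, by simpa using ha⟩
    have hb : (quiet fun u => (D (e u)).flatMap enc).Bounded S W := by
      refine bounded_quiet (fun u => hS _) fun u x hx => ?_
      obtain ⟨a, ha, hxa⟩ := List.mem_flatMap.1 hx
      exact henc a (hmemin u a ha) x hxa
    have hfin : ∀ ω, (compileNet e S W prog out).result ω (fun i => (D i).flatMap enc) =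
        fun i => out (e.symm i) (mem (e.symm i)) := by
      intro ω
      funext i
      have h := compileNet_config e S W prog out ω (fun i => (D i).flatMap enc) prog.length le_rfl
      rw [List.take_length, htr.run_eq] at h
      exact congrArg (out (e.symm i)) (congrFun h.1 i)
    constructor
    · intro ω
      constructor
      · intro t ht i
        have h := compileNet_config e S W prog out ω (fun i => (D i).flatMap enc) t ht
        have hbt := htr.bounded_take hb t
        have hmem := congrFun h.1 i
        have hin := fun j => congrFun (congrFun h.2 i) j
        have hin' := fun j => congrFun (congrFun h.2 j) i
        refine ⟨(congrArg List.length hmem).trans_le (hbt.mem_len _),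
          fun x hx => hbt.mem_lt _ x (hmem ▸ hx), ?_, ?_,
          fun j x hx => hbt.inbox_lt _ _ x (hin j ▸ hx)⟩
        · refine le_trans (le_of_eq ?_) (hbt.recv (e.symm i))
          refine (Finset.sum_congr rfl fun j _ => congrArg List.length (hin j)).trans ?_
          exact Equiv.sum_comp e.symm fun u => ((run (prog.take t) _).inbox (e.symm i) u).length
        · refine le_trans (le_of_eq ?_) (hbt.sent (e.symm i))
          refine (Finset.sum_congr rfl fun j _ => congrArg List.length (hin' j)).trans ?_
          exact Equiv.sum_comp e.symm fun u => ((run (prog.take t) _).inbox u (e.symm i)).length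
      · rw [hfin]
        exact fun i => hout _
    · have : {ω | (fun o : Fin m → List ℕ => ∃ i, i.val = 0 ∧ o i = ans)
          ((compileNet e S W prog out).result ω fun i => (D i).flatMap enc)} = Set.univ := by
        ext ω
        simp only [Set.mem_ofPred_eq, Set.mem_univ, iff_true]
        refine ⟨e u₀, h₀, ?_⟩
        rw [hfin]
        simpa using hans
      rw [show (compileNet e S W prog out).law.toOuterMeasure _ = 1 from
        ((compileNet e S W prog out).law.toOuterMeasure_apply_eq_one_iff _).2
          (by erw [this]; exact Set.subset_univ _)]
      exact tsub_le_self

end compile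

/-! ### Exchanges, local steps and all-reduce -/

section primitives

variable {U : Type} [Fintype U] {S W : ℕ}

/-- Send messages, then update the memories from what was received. -/
def exchangeProg (send : U → List ℕ → U → List ℕ)
    (recv : U → List ℕ → (U → List ℕ) → List ℕ) : List (NetStep U) :=
  [fun u m _ => (m, send u m), fun u m inb => (recv u m inb, fun _ => [])]

theorem trace_exchange {send : U → List ℕ → U → List ℕ}
    {recv : U → List ℕ → (U → List ℕ) → List ℕ} {m m' : U → List ℕ}
    (hm : (quiet m).Bounded S W)
    (hrecv : ∀ u, ∑ v, (send v (m v) u).length ≤ S)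
    (hsent : ∀ u, ∑ v, (send u (m u) v).length ≤ S)
    (hlt : ∀ u v, ∀ x ∈ send u (m u) v, x < W)
    (hm' : (quiet m').Bounded S W)
    (heq : ∀ u, recv u (m u) (fun v => send v (m v) u) = m' u) :
    Trace S W (exchangeProg send recv) (quiet m) (quiet m') := by
  have h : ((quiet m).next fun u m _ => (m, send u m)).next
      (fun u m inb => (recv u m inb, fun _ => [])) = quiet m' := by
    simp only [NetConfig.next, quiet, NetConfig.mk.injEq, and_true]
    exact funext heq
  refine ⟨⟨hm.mem_len, hm.mem_lt, hrecv, hsent, fun u v => hlt v u⟩, ?_, ?_⟩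
  · rw [h]; exact hm'
  · exact h

/-- Update the memories without communication. -/
def localProg (g : U → List ℕ → List ℕ) : List (NetStep U) :=
  [fun u m _ => (g u m, fun _ => [])]

theorem trace_local {g : U → List ℕ → List ℕ} {m m' : U → List ℕ}
    (hm' : (quiet m').Bounded S W) (heq : ∀ u, g u (m u) = m' u) :
    Trace S W (localProg g) (quiet m) (quiet m') := by
  have h : (quiet m).next (fun u m _ => (g u m, fun _ => [])) = quiet m' := by
    simp only [NetConfig.next, quiet, NetConfig.mk.injEq, and_true]
    exact funext heq
  exact ⟨by rw [h]; exact hm', h⟩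

/-- The memories that consist of two words. -/
def twoWords (p v : U → ℕ) : U → List ℕ := fun u => [p u, v u]

theorem bounded_twoWords {p v : U → ℕ} (hS : 2 ≤ S) (hp : ∀ u, p u < W) (hv : ∀ u, v u < W) :
    (quiet (twoWords p v)).Bounded S W := by
  refine bounded_quiet (fun u => hS) fun u x hx => ?_
  simp only [twoWords, List.mem_cons, List.not_mem_nil, or_false] at hx
  rcases hx with rfl | rfl
  exacts [hp u, hv u]

variable {Y : Type} {b d : ℕ} (φ : U ≃ Y × (Fin d → Fin b))

/-- Two machines agree in all coordinates except possibly the `t`-th one. -/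
def SameLine (t : ℕ) (u v : U) : Prop :=
  (φ u).1 = (φ v).1 ∧ ∀ i : Fin d, i.val ≠ t → (φ u).2 i = (φ v).2 i

open scoped Classical in
/-- The second words of the memories are added along each line in direction `t`. -/
noncomputable def lineSumProg (t : ℕ) : List (NetStep U) :=
  exchangeProg (fun u m v => if SameLine φ t u v then [m.getD 1 0] else [])
    fun _ m inb => [m.getD 0 0, ∑ v, (inb v).sum]

/-- The second words of the memories are added over all machines with the same `Y`-part. -/
noncomputable def allReduceProg : ℕ → List (NetStep U)
  | 0 => []
  | t + 1 => allReduceProg t ++ lineSumProg φ t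

theorem allReduceProg_length (t : ℕ) : (allReduceProg φ t).length = 2 * t := by
  induction t with
  | zero => rfl
  | succ t ih => rw [allReduceProg, List.length_append, ih]; rfl

open scoped Classical in
-- A line in direction `t` is parametrised by its `t`-th coordinate. For `x = 1` this says that a
-- line has `b` machines, which bounds the traffic of `lineSumProg`.
theorem sum_sameLine (t : Fin d) (u : U) (x : U → ℕ) :
    ∑ v, (if SameLine φ t v u then x v else 0)
      = ∑ a, x (φ.symm ((φ u).1, Function.update (φ u).2 t a)) := by
  rw [← Finset.sum_filter]
  symm
  refine Finset.sum_bij (fun a _ => φ.symm ((φ u).1, Function.update (φ u).2 t a)) ?_ ?_ ?_ ?_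
  · intro a _
    refine Finset.mem_filter.2 ⟨Finset.mem_univ _, ?_⟩
    simp only [SameLine, Equiv.apply_symm_apply, true_and]
    exact fun i hi => Function.update_of_ne (fun h => hi (by rw [h])) _ _
  · intro a _ a' _ h
    have := congrFun (congrArg Prod.snd (φ.symm.injective h)) t
    simpa using this
  · intro v hv
    replace hv : SameLine φ t v u := (Finset.mem_filter.1 hv).2
    refine ⟨(φ v).2 t, Finset.mem_univ _, ?_⟩
    rw [Equiv.symm_apply_eq]
    refine Prod.ext hv.1.symm (funext fun i => ?_)
    by_cases hi : i = t
    · subst hi; simp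
    · simp only [Function.update_of_ne hi]
      exact (hv.2 i fun h => hi (Fin.ext h)).symm
  · intro a _; rfl

open scoped Classical in
/-- The partial sums in the course of the all-reduce operation. -/
noncomputable def partialReduce (v : U → ℕ) (t : ℕ) (u : U) : ℕ :=
  ∑ c : Fin d → Fin b, if ∀ i : Fin d, t ≤ i.val → c i = (φ u).2 i
    then v (φ.symm ((φ u).1, c)) else 0

omit [Fintype U] in
theorem partialReduce_zero (v : U → ℕ) : partialReduce φ v 0 = v := by
  classical
  funext u
  have : ∀ c : Fin d → Fin b, (∀ i : Fin d, 0 ≤ i.val → c i = (φ u).2 i) ↔ c = (φ u).2 :=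
    fun c => ⟨fun h => funext fun i => h i (Nat.zero_le _), fun h i _ => by rw [h]⟩
  simp only [partialReduce, this, Finset.sum_ite_eq', Finset.mem_univ, if_true, Prod.mk.eta,
    Equiv.symm_apply_apply]

omit [Fintype U] in
theorem partialReduce_top (v : U → ℕ) :
    partialReduce φ v d = fun u => ∑ c, v (φ.symm ((φ u).1, c)) := by
  funext u
  refine Finset.sum_congr rfl fun c _ => if_pos fun i hi => ?_
  exact absurd i.isLt (by omega)

omit [Fintype U] in
theorem partialReduce_le (v : U → ℕ) (t : ℕ) (u : U) :
    partialReduce φ v t u ≤ ∑ c, v (φ.symm ((φ u).1, c)) :=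
  Finset.sum_le_sum fun c _ => by split_ifs <;> simp

omit [Fintype U] in
-- Summing over the `t`-th coordinate of the receiver removes the constraint on the `t`-th
-- coordinate of the summation index.
theorem partialReduce_succ (v : U → ℕ) (t : Fin d) (u : U) :
    ∑ a, partialReduce φ v t (φ.symm ((φ u).1, Function.update (φ u).2 t a))
      = partialReduce φ v (t + 1) u := by
  classical
  unfold partialReduce
  rw [Finset.sum_comm]
  refine Finset.sum_congr rfl fun c _ => ?_
  simp only [Equiv.apply_symm_apply]
  have : ∀ a, (∀ i : Fin d, t.val ≤ i.val → c i = Function.update (φ u).2 t a i) ↔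
      (c t = a ∧ ∀ i : Fin d, t.val + 1 ≤ i.val → c i = (φ u).2 i) := by
    intro a
    constructor
    · intro h
      refine ⟨by simpa using h t le_rfl, fun i hi => ?_⟩
      have := h i (by omega)
      rwa [Function.update_of_ne (by rintro rfl; omega)] at this
    · rintro ⟨h₁, h₂⟩ i hi
      by_cases hit : i = t
      · subst hit; simpa using h₁
      · rw [Function.update_of_ne hit]
        exact h₂ i (by have : i.val ≠ t.val := fun h => hit (Fin.ext h); omega)
  simp only [this, ite_and, Finset.sum_ite_eq, Finset.mem_univ, if_true]

/-- `partialReduce` is the loop invariant: after `t` directions the coordinates below `t` are summed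
out. It never exceeds the full sum, so all words stay below `W`. -/
theorem trace_allReduce_aux {p v : U → ℕ} (hS : 2 ≤ S) (hb : b ≤ S) (hp : ∀ u, p u < W)
    (hv : ∀ u, ∑ c, v (φ.symm ((φ u).1, c)) < W) (t : ℕ) (ht : t ≤ d) :
    Trace S W (allReduceProg φ t) (quiet (twoWords p v))
      (quiet (twoWords p (partialReduce φ v t))) := by
  classical
  have hW : ∀ t, (quiet (twoWords p (partialReduce φ v t))).Bounded S W := fun t =>
    bounded_twoWords hS hp fun u => (partialReduce_le φ v t u).trans_lt (hv u)
  have hsymm : ∀ t u v, SameLine φ t u v ↔ SameLine φ t v u := fun t u v =>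
    ⟨fun h => ⟨h.1.symm, fun i hi => (h.2 i hi).symm⟩,
      fun h => ⟨h.1.symm, fun i hi => (h.2 i hi).symm⟩⟩
  induction t with
  | zero => rw [partialReduce_zero]; exact rfl
  | succ t ih =>
    refine (ih (by omega)).append (trace_exchange (hW _) ?_ ?_ ?_ (hW _) ?_)
    · intro u
      have := sum_sameLine φ ⟨t, ht⟩ u fun _ => 1
      simp only [apply_ite List.length, List.length_singleton, List.length_nil]
      simp only [Finset.sum_const, Finset.card_univ, Fintype.card_fin, smul_eq_mul, mul_one] at this
      exact this.trans_le hb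
    · intro u
      have := sum_sameLine φ ⟨t, ht⟩ u fun _ => 1
      simp only [apply_ite List.length, List.length_singleton, List.length_nil]
      simp only [Finset.sum_const, Finset.card_univ, Fintype.card_fin, smul_eq_mul, mul_one] at this
      simp only [hsymm t u]
      exact this.trans_le hb
    · intro u w x hx
      split_ifs at hx
      · simp only [List.mem_singleton] at hx
        subst hx
        exact (partialReduce_le φ v t u).trans_lt (hv u)
      · simp at hx
    · intro u
      simp only [twoWords, List.getD_cons_zero, List.getD_cons_succ, apply_ite List.sum,
        List.sum_singleton, List.sum_nil]
      congr 2
      rw [← partialReduce_succ φ v ⟨t, ht⟩ u]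
      exact sum_sameLine φ ⟨t, ht⟩ u (partialReduce φ v t)

/-- All-reduce: afterwards every machine knows the sum over all machines with its `Y`-part. -/
theorem trace_allReduce {p v : U → ℕ} (hS : 2 ≤ S) (hb : b ≤ S) (hp : ∀ u, p u < W)
    (hv : ∀ u, ∑ c, v (φ.symm ((φ u).1, c)) < W) :
    Trace S W (allReduceProg φ d) (quiet (twoWords p v))
      (quiet (twoWords p fun u => ∑ c, v (φ.symm ((φ u).1, c)))) := by
  rw [← partialReduce_top φ v]
  exact trace_allReduce_aux φ hS hb hp hv d le_rfl

end primitives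

/-! ### Counting records and inverting injections -/

theorem sum_length_filter_le {V E : Type} [Fintype V] (P : V → E → Prop)
    [∀ v, DecidablePred (P v)] (huniq : ∀ e v v', P v e → P v' e → v = v') (l : List E) :
    ∑ v, (l.filter fun e => P v e).length ≤ l.length := by
  classical
  induction l with
  | nil => simp
  | cons e l ih =>
    have h : ∀ v, ((e :: l).filter fun e => P v e).length
        = (l.filter fun e => P v e).length + if P v e then 1 else 0 := by
      intro v
      by_cases hv : P v e <;> simp [hv]
    simp only [h, Finset.sum_add_distrib, List.length_cons]
    refine Nat.add_le_add ih ?_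
    rw [← Finset.sum_filter, ← Finset.card_eq_sum_ones]
    refine Finset.card_le_one.2 fun v hv v' hv' => ?_
    exact huniq e v v' (Finset.mem_filter.1 hv).2 (Finset.mem_filter.1 hv').2

theorem sum_le_one_of_unique {V : Type} [Fintype V] (f : V → ℕ) (h₁ : ∀ v, f v ≤ 1)
    (h₂ : ∀ v v', f v ≠ 0 → f v' ≠ 0 → v = v') : ∑ v, f v ≤ 1 := by
  classical
  by_cases h : ∃ v, f v ≠ 0
  · obtain ⟨v, hv⟩ := h
    rw [Finset.sum_eq_single v (fun w _ hw => by by_contra h0; exact hw (h₂ w v h0 hv))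
      (fun h => absurd (Finset.mem_univ _) h)]
    exact h₁ v
  · push Not at h
    simp [h]

section partition

variable {I E : Type} [Fintype I] {D : I → List E} {s : Multiset E}

theorem nodup_of_sum_eq (h : ∑ i, (D i : Multiset E) = s) (hs : s.Nodup) (i : I) :
    (D i).Nodup := by
  refine Multiset.coe_nodup.1 (Multiset.nodup_of_le ?_ hs)
  rw [← h]
  exact Finset.single_le_sum (f := fun i => (D i : Multiset E)) (fun _ _ => zero_le)
    (Finset.mem_univ i)

theorem unique_of_sum_eq (h : ∑ i, (D i : Multiset E) = s) (hs : s.Nodup) {i j : I} {e : E}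
    (hi : e ∈ D i) (hj : e ∈ D j) : i = j := by
  classical
  by_contra hij
  have hle : (D i : Multiset E) + D j ≤ s := by
    rw [← h, ← Finset.sum_pair hij (f := fun i => (D i : Multiset E))]
    exact Finset.sum_le_sum_of_subset (Finset.subset_univ _)
  have := Multiset.nodup_add.1 (Multiset.nodup_of_le hle hs)
  exact Multiset.disjoint_left.1 this.2.2 (Multiset.mem_coe.2 hi) (Multiset.mem_coe.2 hj)

end partition

open scoped Classical in
/-- The unique preimage, if there is one. -/
noncomputable def preimage? {α β : Type} (f : α → β) (y : β) : Option α :=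
  if h : ∃ x, f x = y then some h.choose else none

theorem preimage?_apply {α β : Type} {f : α → β} (hf : Function.Injective f) (x : α) :
    preimage? f (f x) = some x := by
  have h : ∃ x', f x' = f x := ⟨x, rfl⟩
  rw [preimage?, dif_pos h]
  exact congrArg some (hf h.choose_spec)

theorem eq_of_preimage? {α β : Type} {f : α → β} {x : α} {y : β} (h : preimage? f y = some x) :
    f x = y := by
  unfold preimage? at h
  split_ifs at h with h'
  · rw [← Option.some.inj h]; exact h'.choose_spec

/-! ### Parallel simulation of copies of an algorithm -/

section simulation

variable {H C : Type} (A : MPCAlgorithm) (place : Fin A.machines → C) (seed : C → A.Seed)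

/-- The configuration of a network that runs one copy of `A` for every `h` and `r`. The first
word of each memory is not touched by the simulation. -/
noncomputable def simConfig (p : H → ℕ) (init : H → C → Fin A.machines → List ℕ) (t : ℕ) :
    NetConfig (H × C × C) where
  mem u := match preimage? place u.2.1 with
    | none => [p u.1, 0]
    | some i => p u.1 :: (A.config (seed u.2.2) (init u.1 u.2.2) t).mem i
  inbox u v := open scoped Classical in
    if v.1 = u.1 ∧ v.2.2 = u.2.2 then
      match preimage? place u.2.1 with
      | none => []
      | some i => match preimage? place v.2.1 with
        | none => []
        | some j => (A.config (seed u.2.2) (init u.1 u.2.2) t).inbox i j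
    else []

/-- One round of all copies of `A`. -/
noncomputable def simStep (t : ℕ) : NetStep (H × C × C) := fun u m inb =>
  match preimage? place u.2.1 with
  | none => (m, fun _ => [])
  | some i =>
    let r := A.step (seed u.2.2) t i m.tail fun j => inb (u.1, place j, u.2.2)
    (m.getD 0 0 :: r.1, fun v => open scoped Classical in
      if u.1 = v.1 ∧ u.2.2 = v.2.2 then
        match preimage? place v.2.1 with
        | none => []
        | some j => r.2 j
      else [])

/-- The last round of all copies of `A`, in which every machine replaces its output by the one
word `obs`. -/
noncomputable def simLast (obs : H → C → List ℕ → ℕ) : NetStep (H × C × C) := fun u m inb =>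
  match preimage? place u.2.1 with
  | none => ([m.getD 0 0, 0], fun _ => [])
  | some i =>
    ([m.getD 0 0, obs u.1 u.2.2 (A.output (seed u.2.2) i m.tail fun j => inb (u.1, place j, u.2.2))],
      fun _ => [])

/-- Run all copies of `A`. -/
noncomputable def simProg (obs : H → C → List ℕ → ℕ) : List (NetStep (H × C × C)) :=
  (List.range A.exchanges).map (simStep A place seed) ++ [simLast A place seed obs]

theorem simProg_length (obs : H → C → List ℕ → ℕ) :
    (simProg A place seed obs).length = A.rounds := by
  simp [simProg, MPCAlgorithm.rounds]

variable {A place seed}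

/-- Messages pass only between machines with the same `h` and `r`, so the copies do not interact;
machines outside the range of `place` idle. -/
theorem simConfig_next (hplace : Function.Injective place) (p : H → ℕ)
    (init : H → C → Fin A.machines → List ℕ) (t : ℕ) :
    (simConfig A place seed p init t).next (simStep A place seed t)
      = simConfig A place seed p init (t + 1) := by
  classical
  have hin : ∀ (h : H) (r : C) (i j : Fin A.machines),
      (simConfig A place seed p init t).inbox (h, place i, r) (h, place j, r)
        = (A.config (seed r) (init h r) t).inbox i j := by
    intro h r i j
    simp only [simConfig, preimage?_apply hplace, and_self, if_true]
  have hmem : ∀ (h : H) (r : C) (i : Fin A.machines),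
      (simConfig A place seed p init t).mem (h, place i, r)
        = p h :: (A.config (seed r) (init h r) t).mem i := by
    intro h r i
    simp only [simConfig, preimage?_apply hplace]
  have hstep : ∀ (h : H) (r : C) (i : Fin A.machines),
      simStep A place seed t (h, place i, r) ((simConfig A place seed p init t).mem (h, place i, r))
        ((simConfig A place seed p init t).inbox (h, place i, r)) =
      (p h :: (A.config (seed r) (init h r) (t + 1)).mem i, fun v : H × C × C =>
        (if h = v.1 ∧ r = v.2.2 then
          (match preimage? place v.2.1 with
          | none => ([] : List ℕ)
          | some j => (A.config (seed r) (init h r) (t + 1)).inbox j i)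
        else [] : List ℕ)) := by
    intro h r i
    simp only [simStep, preimage?_apply hplace, hin, hmem]
    rfl
  have hstep₀ : ∀ u : H × C × C, preimage? place u.2.1 = none →
      simStep A place seed t u ((simConfig A place seed p init t).mem u)
        ((simConfig A place seed p init t).inbox u) = ([p u.1, 0], fun _ => []) := by
    intro u hu
    simp only [simStep, simConfig, hu]
  have hcases : ∀ c, preimage? place c = none ∨ ∃ i, c = place i := by
    intro c
    rcases hc : preimage? place c with _ | i
    · exact Or.inl rfl
    · exact Or.inr ⟨i, (eq_of_preimage? hc).symm⟩
  have : ∀ c c' : NetConfig (H × C × C), c.mem = c'.mem → c.inbox = c'.inbox → c = c' := by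
    rintro ⟨_, _⟩ ⟨_, _⟩ rfl rfl; rfl
  apply this
  · funext ⟨h, c, r⟩
    rcases hcases c with hc | ⟨i, rfl⟩
    · simp only [NetConfig.next, hstep₀ (h, c, r) hc]
      simp only [simConfig, hc]
    · simp only [NetConfig.next, hstep]
      simp only [simConfig, preimage?_apply hplace]
  · funext ⟨h, c, r⟩ ⟨h', c', r'⟩
    rcases hcases c' with hc | ⟨i, rfl⟩
    · simp only [NetConfig.next, hstep₀ (h', c', r') hc]
      simp only [simConfig, hc]
      split_ifs
      · cases preimage? place c <;> rfl
      · rfl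
    · simp only [NetConfig.next, hstep]
      simp only [simConfig, preimage?_apply hplace]
      split_ifs with h1
      · obtain ⟨rfl, rfl⟩ := h1
        cases preimage? place c <;> rfl
      · rfl

variable [Fintype H] [Fintype C]

open scoped Classical in
-- The traffic of a machine stays within its copy, so sums over the network reduce to sums over the
-- simulated machines.
theorem sum_copy (hplace : Function.Injective place) (h : H) (r : C) (f : Fin A.machines → ℕ) :
    ∑ v : H × C × C, (if v.1 = h ∧ v.2.2 = r then
      (match preimage? place v.2.1 with | none => 0 | some j => f j) else 0) = ∑ j, f j := by
  simp only [Fintype.sum_prod_type, ite_and]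
  rw [Finset.sum_eq_single h (fun x _ hx => by simp [hx]) (by simp)]
  simp only [if_true, Finset.sum_ite_eq', Finset.mem_univ]
  symm
  refine Fintype.sum_of_injective place hplace _ _ (fun c hc => ?_) fun i => ?_
  · rcases hc' : preimage? place c with _ | i
    · rfl
    · exact absurd ⟨i, eq_of_preimage? hc'⟩ hc
  · rw [preimage?_apply hplace]

/-- The extra word in `hS` pays for the untouched first word, and `hS₂` for the two words of an idle
machine. -/
theorem bounded_simConfig {S W : ℕ} (hplace : Function.Injective place) {p : H → ℕ}
    {init : H → C → Fin A.machines → List ℕ} (hS : A.space + 1 ≤ S) (hS₂ : 2 ≤ S)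
    (hW : A.wordBound ≤ W) (hp : ∀ h, p h < W)
    (hA : ∀ h r, A.ObeysBounds (seed r) (init h r)) {t : ℕ} (ht : t ≤ A.exchanges) :
    (simConfig A place seed p init t).Bounded S W := by
  classical
  have hlen : ∀ (o : Option (Fin A.machines)) (g : Fin A.machines → List ℕ),
      (match o with | none => [] | some j => g j).length =
        match o with | none => 0 | some j => (g j).length := by
    intro o g; cases o <;> rfl
  refine ⟨?_, ?_, ?_, ?_, ?_⟩
  · rintro ⟨h, c, r⟩
    simp only [simConfig]
    cases preimage? place c with
    | none => simpa using hS₂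
    | some i =>
      have := ((hA h r).1 t ht i).1
      simp only [List.length_cons]
      omega
  · rintro ⟨h, c, r⟩ x hx
    simp only [simConfig] at hx
    cases hc : preimage? place c with
    | none =>
      simp only [hc, List.mem_cons, List.not_mem_nil, or_false] at hx
      rcases hx with rfl | rfl
      · exact hp h
      · exact Nat.zero_lt_of_lt (hp h)
    | some i =>
      simp only [hc, List.mem_cons] at hx
      rcases hx with rfl | hx
      · exact hp h
      · exact (((hA h r).1 t ht i).2.1 x hx).trans_le hW
  · rintro ⟨h, c, r⟩
    simp only [simConfig]
    cases hc : preimage? place c with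
    | none => simp
    | some i =>
      simp only [apply_ite List.length, List.length_nil, hlen]
      rw [sum_copy hplace h r]
      exact ((hA h r).1 t ht i).2.2.1.trans (by omega)
  · rintro ⟨h, c, r⟩
    simp only [simConfig]
    cases hc : preimage? place c with
    | none =>
      refine (Finset.sum_eq_zero fun v _ => ?_).trans_le (Nat.zero_le _)
      split_ifs
      · cases preimage? place v.2.1 <;> rfl
      · rfl
    | some i =>
      have h₁ : ∀ v : H × C × C, (if h = v.1 ∧ r = v.2.2 then
          (match preimage? place v.2.1 with
            | none => []
            | some j => (A.config (seed v.2.2) (init v.1 v.2.2) t).inbox j i) else []).length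
          = if v.1 = h ∧ v.2.2 = r then (match preimage? place v.2.1 with
            | none => 0
            | some j => ((A.config (seed r) (init h r) t).inbox j i).length) else 0 := by
        rintro ⟨h', c', r'⟩
        simp only
        by_cases hh : h = h' ∧ r = r'
        · obtain ⟨rfl, rfl⟩ := hh
          simp only [and_self, if_true]
          cases preimage? place c' <;> rfl
        · rw [if_neg hh, if_neg (fun h => hh ⟨h.1.symm, h.2.symm⟩)]; rfl
      simp only [h₁]
      rw [sum_copy hplace h r]
      exact ((hA h r).1 t ht i).2.2.2.1.trans (by omega)
  · rintro ⟨h, c, r⟩ ⟨h', c', r'⟩ x hx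
    simp only [simConfig] at hx
    split_ifs at hx with hh
    · obtain ⟨rfl, rfl⟩ := hh
      cases hc : preimage? place c with
      | none => simp [hc] at hx
      | some i =>
        cases hc' : preimage? place c' with
        | none => simp [hc, hc'] at hx
        | some j =>
          simp only [hc, hc'] at hx
          exact (((hA h' r').1 t ht i).2.2.2.2 j x hx).trans_le hW
    · simp at hx

/-- The memories before the simulation of copies of `A` with initial memories `init`. -/
noncomputable def simInit {H C : Type} {m : ℕ} (place : Fin m → C) (p : H → ℕ)
    (init : H → C → Fin m → List ℕ) : H × C × C → List ℕ := fun u =>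
  match preimage? place u.2.1 with
  | none => [p u.1, 0]
  | some i => p u.1 :: init u.1 u.2.2 i

theorem trace_sim {S W : ℕ} (hplace : Function.Injective place) {p : H → ℕ}
    {init : H → C → Fin A.machines → List ℕ} (hS : A.space + 1 ≤ S) (hS₂ : 2 ≤ S)
    (hW : A.wordBound ≤ W) (hp : ∀ h, p h < W)
    (hA : ∀ h r, A.ObeysBounds (seed r) (init h r)) (obs : H → C → List ℕ → ℕ)
    (hobs : ∀ h r l, obs h r l < W) :
    Trace S W (simProg A place seed obs) (quiet (simInit place p init))
      (quiet (twoWords (fun u => p u.1) fun u => (preimage? place u.2.1).elim 0 fun i =>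
        obs u.1 u.2.2 (A.result (seed u.2.2) (init u.1 u.2.2) i))) := by
  classical
  have h₀ : quiet (simInit place p init) = simConfig A place seed p init 0 := by
    simp only [quiet, simConfig, NetConfig.mk.injEq]
    refine ⟨funext fun u => ?_, ?_⟩
    · simp only [simInit]
      cases preimage? place u.2.1 <;> rfl
    funext u v
    split_ifs
    · cases preimage? place u.2.1
      · rfl
      · cases preimage? place v.2.1 <;> rfl
    · rfl
  have h₁ : ∀ t ≤ A.exchanges, Trace S W ((List.range t).map (simStep A place seed))
      (simConfig A place seed p init 0) (simConfig A place seed p init t) := by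
    intro t
    induction t with
    | zero => intro _; exact rfl
    | succ t ih =>
      intro ht
      rw [List.range_succ, List.map_append]
      refine (ih (by omega)).append ⟨?_, ?_⟩
      · rw [simConfig_next hplace]
        exact bounded_simConfig hplace hS hS₂ hW hp hA ht
      · rw [simConfig_next hplace]
        exact rfl
  rw [h₀]
  refine (h₁ _ le_rfl).append ?_
  have h₂ : (simConfig A place seed p init A.exchanges).next (simLast A place seed obs)
      = quiet (twoWords (fun u => p u.1) fun u => (preimage? place u.2.1).elim 0 fun i =>
        obs u.1 u.2.2 (A.result (seed u.2.2) (init u.1 u.2.2) i)) := by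
    simp only [NetConfig.next, quiet, NetConfig.mk.injEq]
    constructor
    · funext ⟨h, c, r⟩
      rcases hc : preimage? place c with _ | i
      · simp [simLast, simConfig, twoWords, hc]
      · obtain rfl := eq_of_preimage? hc
        simp only [simLast, simConfig, twoWords, preimage?_apply hplace, List.getD_cons_zero,
          List.tail_cons, and_self, if_true]
        rfl
    · funext v u
      simp only [simLast]
      cases preimage? place u.2.1 <;> rfl
  refine ⟨?_, h₂⟩
  rw [h₂]
  refine bounded_twoWords hS₂ (fun u => hp _) fun u => ?_
  cases preimage? place u.2.1 with
  | none => exact Nat.zero_lt_of_lt (hp u.1)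
  | some i => exact hobs _ _ _

end simulation

/-! ### Supplying the copies with weights -/

section scatter

variable {H C : Type} {m n : ℕ} (place : Fin m → C) (D : Fin m → List (Fin n × Fin n))
  (slot : H × (Fin n × Fin n) → C) (dep : C → Fin n × Fin n → H)
  (val : H → C → Fin n × Fin n → ℕ → ℕ → ℕ)

open scoped Classical in
/-- Every record of every copy gets its weight from the machine that is responsible for it. -/
noncomputable def scatterProg : List (NetStep (H × C × C)) :=
  exchangeProg
    (fun u mem v => if v.2.2 = u.2.2 then
      (match preimage? place v.2.1 with
      | none => []
      | some i => ((D i).filter fun e => slot (v.1, e) = u.2.1 ∧ dep u.2.2 e = u.1).map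
          fun e => val v.1 u.2.2 e (mem.getD 0 0) (mem.getD 1 0)) else [])
    (fun u mem inb => match preimage? place u.2.1 with
      | none => [mem.getD 0 0, 0]
      | some i => mem.getD 0 0 :: (D i).flatMap fun e =>
          [(e.1 : ℕ), (e.2 : ℕ), (inb (dep u.2.2 e, slot (u.1, e), u.2.2)).headD 0])

variable {place D slot dep val}

/-- The weights that the copies get when the holders have the words `p` and `s`. -/
def copyWeight (dep : C → Fin n × Fin n → H) (val : H → C → Fin n × Fin n → ℕ → ℕ → ℕ)
    (p s : H → ℕ) (h : H) (r : C) (a b : Fin n) : ℕ :=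
  val h r (a, b) (p (dep r (a, b))) (s (dep r (a, b)))

variable [Fintype H] [Fintype C]

/-- The weight of the record `e` in copy `(h, r)` comes from the machine `(dep r e, slot (h, e),
r)`, which stores the relevant entry. A receiver gets one word per record that it holds. Since
`slot` is injective and each record has one holder, a sender serves at most one record of one copy,
so an entry needed by many copies causes no congestion. -/
theorem trace_scatter {S W : ℕ}
    (hD : ∑ i, (D i : Multiset (Fin n × Fin n)) = (vertexPairs n).val)
    (hslot : Function.Injective slot) (hDS : ∀ i, 3 * (D i).length + 1 ≤ S) (hS : 2 ≤ S)
    (hn : n ≤ W) {p s : H → ℕ} (hp : ∀ h, p h < W) (hs : ∀ h, s h < W)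
    (hval : ∀ h r e x y, val h r e x y < W) :
    Trace S W (scatterProg place D slot dep val)
      (quiet (twoWords (fun u => p u.1) fun u => s u.1))
      (quiet (simInit place p fun h r i =>
        (D i).flatMap (weightWords (copyWeight dep val p s h r)))) := by
  classical
  have hnd := nodup_of_sum_eq hD (vertexPairs n).nodup
  refine trace_exchange (bounded_twoWords hS (fun u => hp _) fun u => hs _) ?_ ?_ ?_ ?_ ?_
  · rintro ⟨h, c, r⟩
    cases hc : preimage? place c with
    | none => simp
    | some i =>
      have h₁ : ∀ v : H × C × C, (if (h, c, r).2.2 = v.2.2 then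
          (match preimage? place (h, c, r).2.1 with
          | none => []
          | some i => ((D i).filter fun e => slot ((h, c, r).1, e) = v.2.1 ∧
              dep v.2.2 e = v.1).map fun e => val (h, c, r).1 v.2.2 e
                ((twoWords (fun u => p u.1) (fun u => s u.1) v).getD 0 0)
                ((twoWords (fun u => p u.1) (fun u => s u.1) v).getD 1 0)) else []).length
          = ((D i).filter fun e => slot (h, e) = v.2.1 ∧ dep r e = v.1 ∧ r = v.2.2).length := by
        rintro ⟨h', c', r'⟩
        simp only [hc]
        by_cases hr : r = r'
        · subst hr
          simp
        · simp [hr]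
      rw [← hc]
      refine (Finset.sum_congr rfl fun v _ => h₁ v).trans_le ?_
      refine (sum_length_filter_le _ ?_ _).trans (by have := hDS i; omega)
      rintro e ⟨h', c', r'⟩ ⟨h'', c'', r''⟩ ⟨h1, h2, h3⟩ ⟨h4, h5, h6⟩
      simp only at *
      subst h1 h2 h3 h4 h5 h6
      rfl
  · rintro ⟨h, c, r⟩
    refine (sum_le_one_of_unique _ ?_ ?_).trans (by omega)
    · rintro ⟨h', c', r'⟩
      simp only
      split_ifs
      · cases preimage? place c' with
        | none => simp
        | some i =>
          simp only [List.length_map]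
          rw [← List.toFinset_card_of_nodup ((hnd i).filter _)]
          refine Finset.card_le_one.2 fun e he e' he' => ?_
          simp only [List.mem_toFinset, List.mem_filter, decide_eq_true_eq] at he he'
          exact congrArg Prod.snd (hslot (he.2.1.trans he'.2.1.symm))
      · simp
    · have key : ∀ v : H × C × C, (if v.2.2 = r then
          (match preimage? place v.2.1 with
          | none => []
          | some i => ((D i).filter fun e => slot (v.1, e) = c ∧ dep r e = h).map
              fun e => val v.1 r e
                ((twoWords (fun u => p u.1) (fun u => s u.1) (h, c, r)).getD 0 0)
                ((twoWords (fun u => p u.1) (fun u => s u.1) (h, c, r)).getD 1 0))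
            else []).length ≠ 0 →
          ∃ i e, v = (v.1, place i, r) ∧ e ∈ D i ∧ slot (v.1, e) = c := by
        rintro ⟨h', c', r'⟩ hne
        simp only at hne
        split_ifs at hne with hr
        · subst hr
          rcases hc : preimage? place c' with _ | i
          · simp [hc] at hne
          · simp only [hc, List.length_map] at hne
            obtain ⟨e, he⟩ := List.exists_mem_of_length_pos (Nat.pos_of_ne_zero hne)
            simp only [List.mem_filter, decide_eq_true_eq] at he
            exact ⟨i, e, by rw [eq_of_preimage? hc], he.1, he.2.1⟩
        · simp at hne
      intro v v' hv hv'
      obtain ⟨i, e, h1, h2, h3⟩ := key v hv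
      obtain ⟨i', e', h4, h5, h6⟩ := key v' hv'
      have h7 := hslot (h3.trans h6.symm)
      obtain rfl : e = e' := congrArg Prod.snd h7
      obtain rfl := unique_of_sum_eq hD (vertexPairs n).nodup h2 h5
      have h8 : v.1 = v'.1 := (Prod.mk.inj h7).1
      rw [h1, h4, h8]
  · rintro ⟨h, c, r⟩ ⟨h', c', r'⟩ x hx
    simp only at hx
    split_ifs at hx
    · rcases hc : preimage? place c' with _ | i
      · simp [hc] at hx
      · simp only [hc, List.mem_map] at hx
        obtain ⟨e, _, rfl⟩ := hx
        exact hval _ _ _ _ _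
    · simp at hx
  · refine bounded_quiet ?_ ?_
    · rintro ⟨h, c, r⟩
      simp only [simInit]
      cases preimage? place c with
      | none => simpa using hS
      | some i =>
        simp only [List.length_cons, List.length_flatMap, weightWords, List.length_nil]
        have := hDS i
        simp only [List.map_const', List.sum_replicate, smul_eq_mul]
        omega
    · rintro ⟨h, c, r⟩ x hx
      simp only [simInit] at hx
      rcases hc : preimage? place c with _ | i
      · simp only [hc, List.mem_cons, List.not_mem_nil, or_false] at hx
        rcases hx with rfl | rfl
        exacts [hp h, Nat.zero_lt_of_lt (hp h)]
      · simp only [hc, List.mem_cons, List.mem_flatMap, weightWords, List.not_mem_nil,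
          or_false] at hx
        rcases hx with rfl | ⟨e, _, rfl | rfl | rfl⟩
        exacts [hp h, e.1.isLt.trans_le hn, e.2.isLt.trans_le hn, hval _ _ _ _ _]
  · rintro ⟨h, c, r⟩
    simp only [simInit]
    rcases hc : preimage? place c with _ | i
    · rfl
    · simp only [if_true]
      refine congrArg₂ _ rfl ?_
      refine List.flatMap_congr fun e he => ?_
      -- The message from the machine responsible for `e` consists of the weight of `e` alone, so
      -- `headD` reads the right word.
      have hf : ((D i).filter fun e' => slot (h, e') = slot (h, e) ∧ dep r e' = dep r e) = [e] := by
        have : ((D i).filter fun e' => slot (h, e') = slot (h, e) ∧ dep r e' = dep r e)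
            = (D i).filter fun e' => e' = e := by
          refine List.filter_congr fun e' _ => ?_
          simp only [decide_eq_decide]
          constructor
          · rintro ⟨h1, _⟩
            exact congrArg Prod.snd (hslot h1)
          · rintro rfl
            exact ⟨rfl, rfl⟩
        rw [this, List.filter_eq, List.count_eq_one_of_mem (hnd i) he]
        rfl
      simp only [weightWords]
      erw [hf]
      rfl

end scatter

/-! ### One phase: run all copies and count the missing edges -/

section phase

variable {H : Type} [Fintype H] {b d n : ℕ} (A : MPCAlgorithm)
  (place : Fin A.machines → Fin d → Fin b) (seed : (Fin d → Fin b) → A.Seed)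
  (D : Fin A.machines → List (Fin n × Fin n))
  (slot : H × (Fin n × Fin n) → Fin d → Fin b) (dep : (Fin d → Fin b) → Fin n × Fin n → H)
  (val : H → (Fin d → Fin b) → Fin n × Fin n → ℕ → ℕ → ℕ)
  (obs : H → (Fin d → Fin b) → List ℕ → ℕ) (θ : ℝ)

/-- Machines grouped by everything but the second coordinate. -/
def splitMiddle (H C : Type) : H × C × C ≃ (H × C) × C where
  toFun u := ((u.1, u.2.2), u.2.1)
  invFun v := (v.1.1, v.2, v.1.2)
  left_inv _ := rfl
  right_inv _ := rfl

/-- Machines grouped by everything but the last coordinate. -/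
def splitLast (H C : Type) : H × C × C ≃ (H × C) × C where
  toFun u := ((u.1, u.2.1), u.2.2)
  invFun v := (v.1.1, v.1.2, v.2)
  left_inv _ := rfl
  right_inv _ := rfl

open scoped Classical in
/-- Run all copies of `A` on the weights determined by the stored words; the new word of `h` tells
whether `obs` is zero throughout in at least `θ` of the copies that belong to `h`. -/
noncomputable def phaseProg : List (NetStep (H × (Fin d → Fin b) × (Fin d → Fin b))) :=
  scatterProg place D slot dep val ++ (simProg A place seed obs ++
    (allReduceProg (splitMiddle H (Fin d → Fin b)) d ++
    (localProg (fun _ m => [m.getD 0 0, if m.getD 1 0 = 0 then 1 else 0]) ++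
    (allReduceProg (splitLast H (Fin d → Fin b)) d ++
    localProg fun _ m => [m.getD 0 0, if θ ≤ (m.getD 1 0 : ℕ) then 1 else 0]))))

theorem phaseProg_length :
    (phaseProg A place seed D slot dep val obs θ).length = A.rounds + 4 * d + 4 := by
  simp only [phaseProg, List.length_append, simProg_length, allReduceProg_length, scatterProg,
    exchangeProg, localProg, List.length_cons, List.length_nil]
  ring

variable {A place seed D slot dep val obs θ}

open scoped Classical in
-- The first all-reduce adds the observations within a copy; the sum vanishes iff no machine of the
-- copy reports the edge. The second one counts such copies over all `r`. All summands are at most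
-- 1, so the sums are at most `b ^ d < W`.
theorem trace_phase {S W : ℕ} (hplace : Function.Injective place)
    (hD : ∑ i, (D i : Multiset (Fin n × Fin n)) = (vertexPairs n).val)
    (hslot : Function.Injective slot) (hDS : ∀ i, 3 * (D i).length + 1 ≤ S) (hS : 2 ≤ S)
    (hn : n ≤ W) (hAS : A.space + 1 ≤ S) (hAW : A.wordBound ≤ W) (hb : b ≤ S) (hbW : b ^ d < W)
    (hW₂ : 2 ≤ W) {p s : H → ℕ} (hp : ∀ h, p h < W) (hs : ∀ h, s h < W)
    (hval : ∀ h r e x y, val h r e x y < W) (hobs : ∀ h r l, obs h r l ≤ 1)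
    (hA : ∀ h r, A.ObeysBounds (seed r)
      fun i => (D i).flatMap (weightWords (copyWeight dep val p s h r))) :
    Trace S W (phaseProg A place seed D slot dep val obs θ)
      (quiet (twoWords (fun u => p u.1) fun u => s u.1))
      (quiet (twoWords (fun u => p u.1) fun u =>
        if θ ≤ ((Finset.univ.filter fun r => ∀ i, obs u.1 r (A.result (seed r)
          (fun i => (D i).flatMap (weightWords (copyWeight dep val p s u.1 r))) i) = 0).card : ℕ)
        then 1 else 0)) := by
  have hcard : ∀ f : (Fin d → Fin b) → ℕ, (∀ c, f c ≤ 1) → ∑ c, f c < W := by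
    intro f hf
    refine lt_of_le_of_lt (Finset.sum_le_card_nsmul _ _ 1 fun c _ => hf c) ?_
    simpa using hbW
  refine (trace_scatter hD hslot hDS hS hn hp hs hval).append ?_
  refine (trace_sim hplace hAS hS hAW hp hA obs
    fun h r l => (hobs h r l).trans_lt (by omega)).append ?_
  have hobs' : ∀ u : H × (Fin d → Fin b) × (Fin d → Fin b),
      ((preimage? place u.2.1).elim 0 fun i =>
        obs u.1 u.2.2 (A.result (seed u.2.2) (fun i =>
          (D i).flatMap (weightWords (copyWeight dep val p s u.1 u.2.2))) i)) ≤ 1 := by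
    intro u
    cases preimage? place u.2.1 with
    | none => simp
    | some i => exact hobs _ _ _
  refine (trace_allReduce (splitMiddle H (Fin d → Fin b)) hS hb (fun u => hp _)
    fun u => hcard _ fun c => hobs' _).append ?_
  have hsum : ∀ u : H × (Fin d → Fin b) × (Fin d → Fin b),
      (∑ c, ((preimage? place ((splitMiddle H (Fin d → Fin b)).symm
          ((splitMiddle H (Fin d → Fin b) u).1, c)).2.1).elim 0 fun i => obs ((splitMiddle H (Fin d → Fin b)).symm
            ((splitMiddle H (Fin d → Fin b) u).1, c)).1 ((splitMiddle H (Fin d → Fin b)).symm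
            ((splitMiddle H (Fin d → Fin b) u).1, c)).2.2
          (A.result (seed ((splitMiddle H (Fin d → Fin b)).symm
            ((splitMiddle H (Fin d → Fin b) u).1, c)).2.2) (fun i =>
          (D i).flatMap (weightWords (copyWeight dep val p s
            ((splitMiddle H (Fin d → Fin b)).symm ((splitMiddle H (Fin d → Fin b) u).1, c)).1
            ((splitMiddle H (Fin d → Fin b)).symm
              ((splitMiddle H (Fin d → Fin b) u).1, c)).2.2))) i)) = 0) ↔
      ∀ i, obs u.1 u.2.2 (A.result (seed u.2.2) (fun i =>
          (D i).flatMap (weightWords (copyWeight dep val p s u.1 u.2.2))) i) = 0 := by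
    intro u
    simp only [Finset.sum_eq_zero_iff, Finset.mem_univ, true_implies]
    constructor
    · intro h i
      have := h (place i)
      simpa only [splitMiddle, Equiv.coe_fn_mk, Equiv.coe_fn_symm_mk,
        preimage?_apply hplace, Option.elim_some] using this
    · intro h c
      simp only [splitMiddle, Equiv.coe_fn_mk, Equiv.coe_fn_symm_mk]
      cases preimage? place c with
      | none => rfl
      | some i => exact h i
  refine (trace_local (m' := twoWords (fun u => p u.1) fun u =>
      if ∀ i, obs u.1 u.2.2 (A.result (seed u.2.2) (fun i =>
          (D i).flatMap (weightWords (copyWeight dep val p s u.1 u.2.2))) i) = 0 then 1 else 0)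
    (bounded_twoWords hS (fun u => hp _) fun u => ?_) fun u => ?_).append ?_
  · split_ifs <;> omega
  · simp only [twoWords, List.getD_cons_zero, List.getD_cons_succ]
    exact congrArg (fun x => [p u.1, x]) (if_congr (hsum u) rfl rfl)
  refine (trace_allReduce (splitLast H (Fin d → Fin b)) hS hb (fun u => hp _)
    fun u => hcard _ fun c => ?_).append ?_
  · split_ifs <;> omega
  refine trace_local (bounded_twoWords hS (fun u => hp _) fun u => ?_) fun u => ?_
  · split_ifs <;> omega
  · simp only [twoWords, List.getD_cons_zero, List.getD_cons_succ, splitLast, Equiv.coe_fn_mk,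
      Equiv.coe_fn_symm_mk]
    rw [Finset.card_filter]
    congr!

end phase

/-! ### Trees and (1,2)-metrics -/

theorem mem_edgeRecords {N : ℕ} {G : SimpleGraph (Fin N)} {e : Fin N × Fin N} :
    e ∈ edgeRecords G ↔ e.1 < e.2 ∧ G.Adj e.1 e.2 := by
  simp [edgeRecords, vertexPairs]

theorem card_edgeRecords_of_isTree {N : ℕ} {T : SimpleGraph (Fin N)} (hT : T.IsTree) :
    (edgeRecords T).card + 1 = N := by
  classical
  have h := hT.card_edgeFinset
  rw [Fintype.card_fin] at h
  suffices (edgeRecords T).card = T.edgeFinset.card by omega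
  refine Finset.card_bij (fun e _ => s(e.1, e.2)) ?_ ?_ ?_
  · intro e he
    simpa using (mem_edgeRecords.1 he).2
  · rintro ⟨a, b⟩ h₁ ⟨a', b'⟩ h₂ h
    have h₁ := (mem_edgeRecords.1 h₁).1
    have h₂ := (mem_edgeRecords.1 h₂).1
    simp only [Sym2.eq_iff] at h
    rcases h with ⟨rfl, rfl⟩ | ⟨rfl, rfl⟩
    · rfl
    · exact absurd h₁ (not_lt.2 h₂.le)
  · intro s
    induction s using Sym2.ind with
    | _ a b =>
      intro hs
      have hab : T.Adj a b := by simpa using hs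
      rcases lt_or_gt_of_ne hab.ne with h | h
      · exact ⟨(a, b), mem_edgeRecords.2 ⟨h, hab⟩, rfl⟩
      · exact ⟨(b, a), mem_edgeRecords.2 ⟨h, hab.symm⟩, Sym2.eq_swap⟩

section weights

variable {V : Type} {n : ℕ}

open scoped Classical in
/-- The distances of the `(1, 2)`-metric in which the related points have distance `1`. -/
noncomputable def relWeight (R : V → V → Prop) (a b : V) : ℕ :=
  if a = b then 0 else if R a b then 1 else 2

/-- The distances after a renaming of the points. -/
def relabel (e : V ≃ Fin n) (w : V → V → ℕ) (a b : Fin n) : ℕ := w (e.symm a) (e.symm b)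

theorem relWeight_le (R : V → V → Prop) (a b : V) : relWeight R a b ≤ 2 := by
  unfold relWeight; split_ifs <;> simp

theorem relWeight_congr {V' : Type} {R : V → V → Prop} {R' : V' → V' → Prop} {a b : V} {a' b' : V'}
    (h : a = b ↔ a' = b') (hR : R a b ↔ R' a' b') : relWeight R a b = relWeight R' a' b' := by
  by_cases h1 : a = b
  · rw [relWeight, relWeight, if_pos h1, if_pos (h.1 h1)]
  · rw [relWeight, relWeight, if_neg h1, if_neg (mt h.2 h1)]
    by_cases h2 : R a b
    · rw [if_pos h2, if_pos (hR.1 h2)]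
    · rw [if_neg h2, if_neg (mt hR.2 h2)]

/-- The triangle inequality is automatic for distances 1 and 2, because `2 ≤ 1 + 1`. -/
theorem isOneTwoMetric_relabel (e : V ≃ Fin n) {R : V → V → Prop} (hR : ∀ a b, R a b → R b a) :
    IsOneTwoMetric (relabel e (relWeight R)) := by
  classical
  have h : ∀ a b, relabel e (relWeight R) a b = if a = b then 0 else
      if R (e.symm a) (e.symm b) then 1 else 2 := by
    intro a b
    simp [relabel, relWeight]
  refine ⟨⟨fun u v => ?_, fun u v => ?_, fun u v x => ?_⟩, fun u v huv => ?_⟩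
  · rw [h]
    split_ifs with h1 h2 <;> simp [h1]
  · rw [h, h]
    by_cases huv : u = v
    · simp [huv]
    · have : R (e.symm u) (e.symm v) ↔ R (e.symm v) (e.symm u) := ⟨hR _ _, hR _ _⟩
      simp [huv, Ne.symm huv, this]
  · rw [h, h, h]
    split_ifs <;> simp_all
  · rw [h, if_neg huv]
    split_ifs <;> simp

end weights

/-- The only edge of the cycle that is not an edge of the path wraps around. -/
theorem cycleGraph_adj_ends {m : ℕ} {i j : Fin m} (h : (SimpleGraph.cycleGraph m).Adj i j)
    (h₁ : i.val + 1 ≠ j.val) (h₂ : j.val + 1 ≠ i.val) :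
    (i.val = 0 ∧ j.val = m - 1) ∨ (j.val = 0 ∧ i.val = m - 1) := by
  rw [SimpleGraph.cycleGraph_adj'] at h
  have key : ∀ i i' : Fin m, (i - i').val = 1 →
      i'.val + 1 = i.val ∨ (i'.val = m - 1 ∧ i.val = 0) := by
    intro i i' h
    rw [Fin.sub_def] at h
    simp only at h
    by_cases hii : i'.val ≤ i.val
    · rw [show m - i'.val + i.val = (i.val - i'.val) + m by omega, Nat.add_mod_right,
        Nat.mod_eq_of_lt (by omega)] at h
      left; omega
    · rw [Nat.mod_eq_of_lt (by omega)] at h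
      right; omega
  rcases h with h | h <;> have := key _ _ h <;> omega

/-! ### Spanning trees of a family of paths, one of them closed -/

section strands

variable {Z E : Type} {m n : ℕ}

/-- Disjoint paths with `m` vertices, one for each `z`, of which the `y`-th one is closed up to a
cycle, and isolated vertices `E`. -/
def strandAdj (m : ℕ) (y : Z) : (Z × Fin m) ⊕ E → (Z × Fin m) ⊕ E → Prop
  | .inl p, .inl q => p.1 = q.1 ∧ (p.2.val + 1 = q.2.val ∨ q.2.val + 1 = p.2.val ∨
      (p.1 = y ∧ (SimpleGraph.cycleGraph m).Adj p.2 q.2))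
  | _, _ => False

theorem strandAdj_symm (y : Z) (a b : (Z × Fin m) ⊕ E) (h : strandAdj m y a b) :
    strandAdj m y b a := by
  rcases a with ⟨z, j⟩ | a <;> rcases b with ⟨z', j'⟩ | b <;> simp only [strandAdj] at h ⊢
  obtain ⟨rfl, h | h | h⟩ := h
  exacts [⟨rfl, Or.inr (Or.inl h)⟩, ⟨rfl, Or.inl h⟩, ⟨rfl, Or.inr (Or.inr ⟨h.1, h.2.symm⟩)⟩]

/-- Every tree misses an edge of the cycle. -/
theorem exists_not_adj_of_isAcyclic {N : ℕ} [NeZero m] (hm : 3 ≤ m) {T : SimpleGraph (Fin N)}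
    (hT : T.IsAcyclic) {f : Fin m → Fin N} (hf : Function.Injective f) :
    ∃ j : Fin m, ¬ T.Adj (f j) (f (j + 1)) := by
  by_contra! h
  refine SimpleGraph.isAcyclic_iff_free_cycleGraph.1 hT m hm ⟨⟨⟨f, ?_⟩, hf⟩⟩
  intro a b hab
  rw [SimpleGraph.cycleGraph_adj'] at hab
  have key : ∀ a b : Fin m, (a - b).val = 1 → T.Adj (f b) (f a) := by
    intro a b hab
    have h1 : a - b = 1 := by
      apply Fin.ext
      rw [hab, Fin.val_one', Nat.mod_eq_of_lt (by omega)]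
    have := h b
    rwa [← h1, add_sub_cancel] at this
  rcases hab with h | h
  exacts [(key _ _ h).symm, key _ _ h]

variable [Fintype Z] [Fintype E] (e : (Z × Fin m) ⊕ E ≃ Fin n) (y : Z)

/-- There is a spanning tree that contains all the paths. -/
theorem exists_strand_tree [NeZero m] :
    ∃ T : SimpleGraph (Fin n), T.IsTree ∧
      graphWeight (relabel e (relWeight (strandAdj m y))) T + Fintype.card Z * (m - 1)
        ≤ 2 * (n - 1) := by
  classical
  -- Every vertex points to its predecessor on the strand; first vertices and isolated vertices
  -- point to the root. Connectedness of this graph is enough: the edges of any spanning tree in it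
  -- are parent edges, and the sum over all parent edges bounds its weight.
  let root : (Z × Fin m) ⊕ E := .inl (y, 0)
  let par : (Z × Fin m) ⊕ E → (Z × Fin m) ⊕ E := fun a => match a with
    | .inl p => if p.2 = 0 then root else .inl (p.1, ⟨p.2.val - 1, by omega⟩)
    | .inr _ => root
  let G : SimpleGraph (Fin n) :=
    SimpleGraph.fromRel fun a b => par (e.symm a) = e.symm b
  have hG : ∀ a, G.Reachable (e a) (e (par a)) := by
    intro a
    by_cases h : a = par a
    · rw [← h]
    · refine SimpleGraph.Adj.reachable ?_
      rw [SimpleGraph.fromRel_adj]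
      exact ⟨fun h' => h (e.injective h'), Or.inl (by simp)⟩
  have hroot : ∀ a, G.Reachable (e a) (e root) := by
    have h₁ : ∀ (k : ℕ) (z : Z) (hk : k < m), G.Reachable (e (.inl (z, ⟨k, hk⟩))) (e root) := by
      intro k
      induction k with
      | zero =>
        intro z hk
        have := hG (.inl (z, ⟨0, hk⟩))
        have h0 : (⟨0, hk⟩ : Fin m) = 0 := rfl
        simpa [par, h0] using this
      | succ k ih =>
        intro z hk
        have := hG (.inl (z, ⟨k + 1, hk⟩))
        have h0 : (⟨k + 1, hk⟩ : Fin m) ≠ 0 := by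
          intro h; have := congrArg Fin.val h; simp at this
        simp only [par, h0, if_false, Nat.add_sub_cancel] at this
        exact this.trans (ih z _)
    rintro (⟨z, j⟩ | x)
    · exact h₁ j.val z j.isLt
    · exact hG (.inr x)
  have hconn : G.Connected := by
    have : Nonempty (Fin n) := ⟨e root⟩
    refine SimpleGraph.Connected.mk fun a b => ?_
    have ha := hroot (e.symm a)
    have hb := hroot (e.symm b)
    rw [Equiv.apply_symm_apply] at ha hb
    exact ha.trans hb.symm
  obtain ⟨T, hTG, hT⟩ := hconn.exists_isTree_le
  refine ⟨T, hT, ?_⟩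
  set w := relWeight (strandAdj (E := E) m y) with hw
  let rec' : (Z × Fin m) ⊕ E → Fin n × Fin n := fun a =>
    (min (e a) (e (par a)), max (e a) (e (par a)))
  have hwsymm : ∀ a b, w a b = w b a := by
    intro a b
    have h1 : strandAdj m y a b ↔ strandAdj m y b a :=
      ⟨strandAdj_symm y a b, strandAdj_symm y b a⟩
    simp only [hw, relWeight, h1, eq_comm]
  have hwrec : ∀ a, relabel e w (rec' a).1 (rec' a).2 = w a (par a) := by
    intro a
    simp only [rec', relabel]
    rcases le_total (e a) (e (par a)) with h | h
    · simp [h]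
    · simp [h, hwsymm]
  have hsub : edgeRecords T ⊆ (Finset.univ.erase root).image rec' := by
    rintro ⟨a, b⟩ hab
    obtain ⟨hlt, hadj⟩ := mem_edgeRecords.1 hab
    have := hTG hadj
    rw [SimpleGraph.fromRel_adj] at this
    simp only at hlt
    have hpr : par root = root := by simp [par, root]
    rw [Finset.mem_image]
    rcases this.2 with h | h
    · refine ⟨e.symm a, Finset.mem_erase.2 ⟨fun h0 => ?_, Finset.mem_univ _⟩, ?_⟩
      · rw [h0, hpr, ← h0] at h
        exact this.1 (e.symm.injective h)
      · simp [rec', h, hlt.le]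
    · refine ⟨e.symm b, Finset.mem_erase.2 ⟨fun h0 => ?_, Finset.mem_univ _⟩, ?_⟩
      · rw [h0, hpr, ← h0] at h
        exact this.1 (e.symm.injective h).symm
      · simp [rec', h, hlt.le]
  have h₁ : graphWeight (relabel e w) T ≤ ∑ a ∈ Finset.univ.erase root, w a (par a) := by
    refine (Finset.sum_le_sum_of_subset hsub).trans ?_
    refine (Finset.sum_image_le_of_nonneg (fun _ _ => Nat.zero_le _)).trans_eq ?_
    exact Finset.sum_congr rfl fun a _ => hwrec a
  -- Each non-root vertex pays at most 2 for its parent edge, and the `m - 1` later vertices of each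
  -- strand pay at most 1.
  have h₂ : ∑ a ∈ Finset.univ.erase root, w a (par a) + Fintype.card Z * (m - 1)
      ≤ ∑ a ∈ Finset.univ.erase root, 2 := by
    have hcard : Fintype.card Z * (m - 1) = ∑ a ∈ Finset.univ.erase root,
        (match a with | .inl p => if p.2 = 0 then 0 else 1 | .inr _ => 0 : ℕ) := by
      rw [Finset.sum_erase _ (by simp [root])]
      simp only [Fintype.sum_sum_type, Finset.sum_const_zero, add_zero, Fintype.sum_prod_type]
      have : ∑ j : Fin m, (if j = 0 then 0 else 1) = m - 1 := by
        rw [Finset.sum_ite, Finset.sum_const_zero, zero_add, Finset.sum_const, smul_eq_mul, mul_one,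
          Finset.filter_ne' , Finset.card_erase_of_mem (Finset.mem_univ _), Finset.card_univ,
          Fintype.card_fin]
      simp [this]
    rw [hcard, ← Finset.sum_add_distrib]
    refine Finset.sum_le_sum fun a _ => ?_
    rcases a with ⟨z, j⟩ | a
    · by_cases hj : j = 0
      · simp only [hj, if_true]; exact relWeight_le _ _ _
      · simp only [hj, if_false, par]
        have hj' : j.val ≠ 0 := fun h => hj (Fin.ext (by simpa using h))
        have : w (Sum.inl (z, j)) (Sum.inl (z, ⟨j.val - 1, by omega⟩)) ≤ 1 := by
          simp only [hw, relWeight]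
          rw [if_pos (show strandAdj m y (Sum.inl (z, j)) (Sum.inl (z, ⟨j.val - 1, _⟩)) from
            ⟨rfl, Or.inr (Or.inl (by simp only; omega))⟩)]
          split_ifs <;> simp
        omega
    · exact relWeight_le _ _ _
  rw [Finset.sum_const, Finset.card_erase_of_mem (Finset.mem_univ _), Finset.card_univ,
    Fintype.card_congr e, Fintype.card_fin, smul_eq_mul] at h₂
  omega

open scoped Classical in
/-- An approximate minimum spanning tree contains a given edge of all but a few of the paths. -/
theorem card_missing_le {ε : ℝ} (hε : 0 ≤ ε) {T : SimpleGraph (Fin n)}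
    (hT : IsApproxMST (relabel e (relWeight (strandAdj m y))) ε T) (j₀ : Fin m)
    (hj₀ : j₀.val + 1 < m) :
    ((Finset.univ.filter fun z => z ≠ y ∧
      ¬ T.Adj (e (.inl (z, j₀))) (e (.inl (z, ⟨j₀.val + 1, hj₀⟩)))).card : ℝ) ≤ 2 * ε * n + 1 := by
  set miss := Finset.univ.filter fun z => z ≠ y ∧
      ¬ T.Adj (e (.inl (z, j₀))) (e (.inl (z, ⟨j₀.val + 1, hj₀⟩))) with hmiss
  have : NeZero m := ⟨by omega⟩
  set R := strandAdj (E := E) m y with hR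
  set w := relabel e (relWeight R) with hw
  obtain ⟨T', hT', hwT'⟩ : ∃ T', T'.IsTree ∧
      graphWeight w T' + Fintype.card Z * (m - 1) ≤ 2 * (n - 1) := exists_strand_tree e y
  have hle := hT.2 T' hT'
  have hcardT := card_edgeRecords_of_isTree hT.1
  -- These are all pairs at distance 1: the edges of the paths, and the closing edge as `none`.
  let ends : Option (Z × Fin (m - 1)) → Fin n × Fin n := fun o => match o with
    | none => (e (.inl (y, ⟨m - 1, by omega⟩)), e (.inl (y, 0)))
    | some p => (e (.inl (p.1, ⟨p.2.val, by omega⟩)), e (.inl (p.1, ⟨p.2.val + 1, by omega⟩)))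
  let rec' : Option (Z × Fin (m - 1)) → Fin n × Fin n := fun o =>
    (min (ends o).1 (ends o).2, max (ends o).1 (ends o).2)
  let bad : Finset (Option (Z × Fin (m - 1))) :=
    miss.image fun z => some (z, ⟨j₀.val, by omega⟩)
  have hbad : bad.card = miss.card := Finset.card_image_of_injective _ fun z z' h => by
    simpa using h
  let cheap := (edgeRecords T).filter fun r => R (e.symm r.1) (e.symm r.2)
  have hcheap : cheap ⊆ (Finset.univ \ bad).image rec' := by
    rintro ⟨a, b⟩ hab
    obtain ⟨hab, hRab⟩ := Finset.mem_filter.1 hab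
    obtain ⟨hlt, hadj⟩ := mem_edgeRecords.1 hab
    simp only at hlt hadj hRab
    have key : ∃ o, ((ends o) = (a, b) ∨ (ends o) = (b, a)) := by
      rcases ha : e.symm a with ⟨z, j⟩ | x <;> rcases hb : e.symm b with ⟨z', j'⟩ | x' <;>
        rw [ha, hb] at hRab <;> simp only [hR, strandAdj] at hRab
      rw [Equiv.symm_apply_eq] at ha hb
      subst ha hb
      obtain ⟨rfl, h | h | ⟨rfl, h⟩⟩ := hRab
      · refine ⟨some (z, ⟨j.val, by omega⟩), Or.inl ?_⟩
        simp only [ends, h]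
      · refine ⟨some (z, ⟨j'.val, by omega⟩), Or.inr ?_⟩
        simp only [ends, h]
      · by_cases h1 : j.val + 1 = j'.val
        · refine ⟨some (z, ⟨j.val, by omega⟩), Or.inl ?_⟩
          simp only [ends, h1]
        by_cases h2 : j'.val + 1 = j.val
        · refine ⟨some (z, ⟨j'.val, by omega⟩), Or.inr ?_⟩
          simp only [ends, h2]
        rcases cycleGraph_adj_ends h h1 h2 with h | h
        · refine ⟨none, Or.inr ?_⟩
          simp only [ends, Prod.mk.injEq, EmbeddingLike.apply_eq_iff_eq, Sum.inl.injEq, true_and]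
          exact ⟨Fin.ext h.2.symm, Fin.ext (by simp [h.1])⟩
        · refine ⟨none, Or.inl ?_⟩
          simp only [ends, Prod.mk.injEq, EmbeddingLike.apply_eq_iff_eq, Sum.inl.injEq, true_and]
          exact ⟨Fin.ext h.2.symm, Fin.ext (by simp [h.1])⟩
    obtain ⟨o, ho⟩ := key
    refine Finset.mem_image.2 ⟨o, Finset.mem_sdiff.2 ⟨Finset.mem_univ _, fun hob => ?_⟩, ?_⟩
    · obtain ⟨z, hz, rfl⟩ := Finset.mem_image.1 hob
      have hz := (Finset.mem_filter.1 hz).2.2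
      simp only [ends, Prod.mk.injEq] at ho
      rcases ho with ⟨rfl, rfl⟩ | ⟨rfl, rfl⟩
      · exact hz hadj
      · exact hz hadj.symm
    · rcases ho with ho | ho
      · simp [rec', ho, hlt.le]
      · simp [rec', ho, hlt.le]
  -- The missing edges are cheap pairs outside `T`; the summand 1 is the closing edge.
  have hcc : cheap.card + miss.card ≤ Fintype.card Z * (m - 1) + 1 := by
    have h1 := (Finset.card_le_card hcheap).trans Finset.card_image_le
    rw [Finset.card_sdiff_of_subset (Finset.subset_univ _), hbad, Finset.card_univ] at h1
    have h2 : miss.card ≤ Fintype.card (Option (Z × Fin (m - 1))) := by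
      rw [← hbad]; exact Finset.card_le_univ _
    simp only [Fintype.card_option, Fintype.card_prod, Fintype.card_fin] at h1 h2
    omega
  have hwT : 2 * (n - 1) ≤ graphWeight w T + cheap.card := by
    have : ∑ r ∈ edgeRecords T, 2 ≤ ∑ r ∈ edgeRecords T,
        (w r.1 r.2 + if R (e.symm r.1) (e.symm r.2) then 1 else 0) := by
      refine Finset.sum_le_sum fun r hr => ?_
      have hne : e.symm r.1 ≠ e.symm r.2 := fun h =>
        (mem_edgeRecords.1 hr).1.ne (e.symm.injective h)
      simp only [hw, relabel, relWeight, hne, if_false]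
      split_ifs <;> simp
    rw [Finset.sum_const, smul_eq_mul, Finset.sum_add_distrib, ← Finset.card_filter] at this
    have h3 : (edgeRecords T).card = n - 1 := by omega
    rw [h3] at this
    calc 2 * (n - 1) = (n - 1) * 2 := Nat.mul_comm _ _
      _ ≤ _ := this
  have hn : 1 ≤ n := by omega
  -- `T` weighs at least `2 * (n - 1)` minus its number of cheap edges, while `T'` saves a full
  -- `Fintype.card Z * (m - 1)`. Up to the closing edge, every missing edge thus costs `T` one unit,
  -- and the slack `ε * (2 * n)` limits their number.
  have h5 : (graphWeight w T' : ℝ) + miss.card ≤ graphWeight w T + 1 := by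
    have : graphWeight w T' + miss.card ≤ graphWeight w T + 1 := by omega
    exact_mod_cast this
  have h6 : (graphWeight w T' : ℝ) ≤ 2 * n := by
    have : graphWeight w T' ≤ 2 * n := by omega
    exact_mod_cast this
  have h7 : ε * graphWeight w T' ≤ ε * (2 * n) := mul_le_mul_of_nonneg_left h6 hε
  linarith

end strands

/-! ### A Chernoff bound and a union bound -/

section sampling

variable {Ω : Type} [Fintype Ω] (μ : Ω → ℝ)

open scoped Classical in
/-- The total weight of a set. -/
noncomputable def weightOf (f : Ω → Prop) : ℝ := ∑ x, if f x then μ x else 0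

open scoped Classical in
theorem sum_weightOf {I : Type} (s : Finset I) (f : I → Ω → Prop) :
    ∑ i ∈ s, weightOf μ (f i) = ∑ x, μ x * (s.filter fun i => f i x).card := by
  simp only [weightOf]
  rw [Finset.sum_comm]
  refine Finset.sum_congr rfl fun x _ => ?_
  rw [← Finset.sum_filter, Finset.sum_const, nsmul_eq_mul, mul_comm]

theorem sum_prod_pow {κ : Type} [Fintype κ] [DecidableEq κ] (g : Ω → ℝ) :
    ∑ x : κ → Ω, ∏ r, g (x r) = (∑ ω, g ω) ^ Fintype.card κ := by
  have := Finset.prod_univ_sum (fun _ : κ => (Finset.univ : Finset Ω)) fun _ => g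
  rw [Fintype.piFinset_univ] at this
  rw [← this, Finset.prod_const, Finset.card_univ]

variable {μ}

open scoped Classical in
-- The moment generating function of a binomial count: independence turns the sum into a power of `1
-- + (exp t - 1) * weightOf μ f`, and `1 + z ≤ exp z`.
theorem weight_exp_count {κ : Type} [Fintype κ] (hμ : ∀ x, 0 ≤ μ x) (hμ₁ : ∑ x, μ x = 1)
    (f : Ω → Prop) (t : ℝ) :
    ∑ x : κ → Ω, (∏ r, μ (x r)) * Real.exp (t * (Finset.univ.filter fun r => f (x r)).card)
      ≤ Real.exp ((Real.exp t - 1) * weightOf μ f * Fintype.card κ) := by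
  have h₁ : ∀ x : κ → Ω, (∏ r, μ (x r)) *
      Real.exp (t * (Finset.univ.filter fun r => f (x r)).card)
      = ∏ r, (μ (x r) * if f (x r) then Real.exp t else 1) := by
    intro x
    rw [Finset.prod_mul_distrib, Finset.prod_ite, Finset.prod_const_one, mul_one,
      Finset.prod_const, ← Real.exp_nat_mul, mul_comm t]
  rw [Finset.sum_congr rfl fun x _ => h₁ x, sum_prod_pow (κ := κ) fun ω => μ ω * if f ω then Real.exp t else 1]
  have h₂ : ∑ ω, μ ω * (if f ω then Real.exp t else 1) = 1 + (Real.exp t - 1) * weightOf μ f := by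
    have h₃ : ∑ ω, μ ω * (if f ω then Real.exp t else 1)
        = ∑ ω, μ ω + (Real.exp t - 1) * weightOf μ f := by
      rw [weightOf, Finset.mul_sum, ← Finset.sum_add_distrib]
      refine Finset.sum_congr rfl fun ω _ => ?_
      split_ifs <;> ring
    rw [h₃, hμ₁]
  rw [h₂, mul_comm _ (Fintype.card κ : ℝ), Real.exp_nat_mul]
  refine pow_le_pow_left₀ ?_ ?_ _
  · rw [← h₂]
    refine Finset.sum_nonneg fun ω _ => mul_nonneg (hμ ω) ?_
    split_ifs
    exacts [(Real.exp_pos t).le, zero_le_one]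
  · rw [add_comm]
    exact Real.add_one_le_exp _

open scoped Classical in
/-- Some sample separates frequent events from rare ones. -/
theorem exists_separating_sample {κ J : Type} [Fintype κ] [Fintype J] (hμ : ∀ x, 0 ≤ μ x)
    (hμ₁ : ∑ x, μ x = 1) (f : J → Ω → Prop) (Y : J → Prop) {s : ℝ}
    (hY : ∀ j, Y j → 4 * s ≤ weightOf μ (f j)) (hN : ∀ j, ¬ Y j → weightOf μ (f j) ≤ s / 4)
    (hJ : (Fintype.card J : ℝ) < Real.exp (s * Fintype.card κ / 2)) :
    ∃ x : κ → Ω, ∀ j, s * Fintype.card κ ≤ (Finset.univ.filter fun r => f j (x r)).card ↔ Y j := by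
  by_contra! hcon
  set R : ℝ := ((Fintype.card κ : ℕ) : ℝ) with hR
  have hR0 : 0 ≤ R := Nat.cast_nonneg _
  have hbad : ∀ x : κ → Ω, ∃ j, ¬ (s * R ≤ (Finset.univ.filter fun r => f j (x r)).card ↔ Y j) := by
    intro x
    obtain ⟨j, hj⟩ := hcon x
    refine ⟨j, fun h => ?_⟩
    rcases hj with hj | hj
    exacts [hj.2 (h.1 hj.1), absurd (h.2 hj.2) (not_le.2 hj.1)]
  have hprod : ∀ x : κ → Ω, 0 ≤ ∏ r, μ (x r) := fun x => Finset.prod_nonneg fun r _ => hμ _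
  have htot : ∑ x : κ → Ω, ∏ r, μ (x r) = 1 := by
    rw [sum_prod_pow, hμ₁, one_pow]
  have key : ∀ j, ∑ x : κ → Ω, (∏ r, μ (x r)) *
      (if (s * R ≤ (Finset.univ.filter fun r => f j (x r)).card ↔ Y j) then 0 else 1)
        ≤ Real.exp (-(s * R / 2)) := by
    intro j
    by_cases hj : Y j
    -- Lower tail, with `t = -1`: as `exp (-1) - 1 ≤ -1/2` and the weight is at least `4s`, the
    -- exponent is at most `sR - 2sR` when `s ≥ 0`.
    · have h₁ := weight_exp_count (κ := κ) hμ hμ₁ (f j) (-1)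
      have h₂ : ∑ x : κ → Ω, (∏ r, μ (x r)) *
          (if (s * R ≤ (Finset.univ.filter fun r => f j (x r)).card ↔ Y j) then 0 else 1)
          ≤ Real.exp (s * R) * ∑ x : κ → Ω, (∏ r, μ (x r)) *
            Real.exp (-1 * (Finset.univ.filter fun r => f j (x r)).card) := by
        rw [Finset.mul_sum]
        refine Finset.sum_le_sum fun x _ => ?_
        rw [mul_left_comm, ← Real.exp_add]
        refine mul_le_mul_of_nonneg_left ?_ (hprod x)
        split_ifs with h
        · exact (Real.exp_pos _).le
        · refine Real.one_le_exp ?_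
          have : ¬ s * R ≤ (Finset.univ.filter fun r => f j (x r)).card := fun h' =>
            h ⟨fun _ => hj, fun _ => h'⟩
          push Not at this
          linarith
      refine h₂.trans ((mul_le_mul_of_nonneg_left h₁ (Real.exp_pos _).le).trans ?_)
      rw [← Real.exp_add]
      refine Real.exp_le_exp.2 ?_
      have he : Real.exp (-1) ≤ 1 / 2 := by
        rw [Real.exp_neg, ← one_div]
        exact one_div_le_one_div_of_le (by norm_num) (by linarith [Real.exp_one_gt_d9])
      have hs := hY j hj
      have hw : 0 ≤ weightOf μ (f j) := Finset.sum_nonneg fun ω _ => by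
        split_ifs
        exacts [hμ ω, le_rfl]
      have h₃ : (Real.exp (-1) - 1) * weightOf μ (f j) ≤ -(2 * s) := by nlinarith
      have h₄ := mul_le_mul_of_nonneg_right h₃ hR0
      rcases le_total 0 s with h0 | h0
      · have := mul_nonneg h0 hR0
        linarith
      · have h5 : s * R ≤ 0 := mul_nonpos_of_nonpos_of_nonneg h0 hR0
        have h6 : (Real.exp (-1) - 1) * weightOf μ (f j) * R ≤ 0 :=
          mul_nonpos_of_nonpos_of_nonneg
            (mul_nonpos_of_nonpos_of_nonneg (by linarith) hw) hR0
        linarith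
    -- Upper tail, with `t = 1`: as `exp 1 - 1 ≤ 2` and the weight is at most `s/4`, the exponent is
    -- at most `-sR + sR/2`.
    · have h₁ := weight_exp_count (κ := κ) hμ hμ₁ (f j) 1
      have h₂ : ∑ x : κ → Ω, (∏ r, μ (x r)) *
          (if (s * R ≤ (Finset.univ.filter fun r => f j (x r)).card ↔ Y j) then 0 else 1)
          ≤ Real.exp (-(s * R)) * ∑ x : κ → Ω, (∏ r, μ (x r)) *
            Real.exp (1 * (Finset.univ.filter fun r => f j (x r)).card) := by
        rw [Finset.mul_sum]
        refine Finset.sum_le_sum fun x _ => ?_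
        rw [mul_left_comm, ← Real.exp_add]
        refine mul_le_mul_of_nonneg_left ?_ (hprod x)
        split_ifs with h
        · exact (Real.exp_pos _).le
        · refine Real.one_le_exp ?_
          have : s * R ≤ (Finset.univ.filter fun r => f j (x r)).card := by
            by_contra h'
            exact h ⟨fun h'' => absurd h'' h', fun h'' => absurd h'' hj⟩
          linarith
      refine h₂.trans ((mul_le_mul_of_nonneg_left h₁ (Real.exp_pos _).le).trans ?_)
      rw [← Real.exp_add]
      refine Real.exp_le_exp.2 ?_
      have he : Real.exp 1 ≤ 3 := by linarith [Real.exp_one_lt_d9]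
      have hs := hN j hj
      have hw : 0 ≤ weightOf μ (f j) := Finset.sum_nonneg fun ω _ => by
        split_ifs
        exacts [hμ ω, le_rfl]
      have h₃ : (Real.exp 1 - 1) * weightOf μ (f j) ≤ s / 2 := by nlinarith
      have h₄ := mul_le_mul_of_nonneg_right h₃ hR0
      linarith
  -- Union bound: if every sample erred for some `j`, the error probabilities would add up to at
  -- least 1.
  have hone : (1 : ℝ) ≤ ∑ j : J, Real.exp (-(s * R / 2)) := by
    refine le_trans ?_ (Finset.sum_le_sum fun j _ => key j)
    refine le_trans htot.ge ?_
    rw [Finset.sum_comm]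
    refine Finset.sum_le_sum fun x _ => ?_
    rw [← Finset.mul_sum]
    refine le_mul_of_one_le_right (hprod x) ?_
    obtain ⟨j, hj⟩ := hbad x
    refine le_trans ?_ (Finset.single_le_sum (fun i _ => ?_) (Finset.mem_univ j))
    · rw [if_neg hj]
    · split_ifs <;> norm_num
  rw [Finset.sum_const, Finset.card_univ, nsmul_eq_mul, Real.exp_neg] at hone
  have hpos := Real.exp_pos (s * R / 2)
  rw [← div_eq_mul_inv, le_div_iff₀ hpos, one_mul] at hone
  exact absurd hJ (not_lt.2 hone)

end sampling

-- Approximate trees of randomly renamed metrics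

attribute [instance] MPCAlgorithm.seedFintype

/-- Words determine the list of edges, so `edgeObs` and the decoding in `gatherProg` are
unambiguous. -/
theorem flatMap_pairWords_injective {n : ℕ} :
    Function.Injective fun E : List (Fin n × Fin n) => E.flatMap pairWords := by
  intro E
  induction E with
  | nil =>
    intro E' h
    cases E' with
    | nil => rfl
    | cons e E' => simp [pairWords] at h
  | cons e E ih =>
    intro E' h
    cases E' with
    | nil => simp [pairWords] at h
    | cons e' E' =>
      simp only [List.flatMap_cons, pairWords, List.cons_append, List.nil_append,
        List.cons.injEq] at h
      rw [Prod.ext (Fin.ext h.1) (Fin.ext h.2.1), ih h.2.2]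

open scoped Classical in
/-- Tells whether a list of edges, written as words, contains the edge `u v`. -/
noncomputable def edgeObs {n : ℕ} (u v : Fin n) (l : List ℕ) : ℕ :=
  if ∃ E : List (Fin n × Fin n), l = E.flatMap pairWords ∧ ((u, v) ∈ E ∨ (v, u) ∈ E) then 1 else 0

section probability

variable {V : Type} {n : ℕ} (A : MPCAlgorithm) (D : Fin A.machines → List (Fin n × Fin n))

/-- On the metric `w`, with the points renamed and the seed fixed, no machine writes the edge
between `a` and `b`. -/
def Missing (w : V → V → ℕ) (a b : V) (x : (V ≃ Fin n) × A.Seed) : Prop :=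
  ∀ i, edgeObs (x.1 a) (x.1 b)
    (A.result x.2 (fun i => (D i).flatMap (weightWords (relabel x.1 w))) i) = 0

/-- On the metric `w`, with the points renamed and the seed fixed, the output is correct. -/
def OutputGood (w : V → V → ℕ) (ε : ℝ) (x : (V ≃ Fin n) × A.Seed) : Prop :=
  ∃ E : Fin A.machines → List (Fin n × Fin n),
    (∀ i, A.result x.2 (fun i => (D i).flatMap (weightWords (relabel x.1 w))) i
      = (E i).flatMap pairWords) ∧
    IsApproxMST (relabel x.1 w) ε (SimpleGraph.fromRel fun u v => ∃ i, (u, v) ∈ E i)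

variable {A D}

theorem OutputGood.exists_tree {w : V → V → ℕ} {ε : ℝ} {x : (V ≃ Fin n) × A.Seed}
    (h : OutputGood A D w ε x) : ∃ T : SimpleGraph (Fin n), IsApproxMST (relabel x.1 w) ε T ∧
      ∀ a b, a ≠ b → (Missing A D w a b x ↔ ¬ T.Adj (x.1 a) (x.1 b)) := by
  obtain ⟨E, hE, hT⟩ := h
  refine ⟨_, hT, fun a b hab => ?_⟩
  have hne : x.1 a ≠ x.1 b := fun h => hab (x.1.injective h)
  rw [SimpleGraph.fromRel_adj]
  have hobs : ∀ i, edgeObs (x.1 a) (x.1 b) ((E i).flatMap pairWords) = 0 ↔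
      ¬ ((x.1 a, x.1 b) ∈ E i ∨ (x.1 b, x.1 a) ∈ E i) := by
    intro i
    rw [← not_iff_not, not_not]
    unfold edgeObs
    constructor
    · intro h
      by_contra h'
      refine h (if_neg ?_)
      rintro ⟨E', hE', hmem⟩
      rw [← flatMap_pairWords_injective hE'] at hmem
      exact h' hmem
    · intro h
      rw [if_pos ⟨E i, rfl, h⟩]
      exact one_ne_zero
  simp only [Missing, hE, hobs]
  constructor
  · rintro h ⟨_, ⟨i, hi⟩ | ⟨i, hi⟩⟩
    exacts [h i (Or.inl hi), h i (Or.inr hi)]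
  · rintro h i (hi | hi)
    exacts [h ⟨hne, Or.inl ⟨i, hi⟩⟩, h ⟨hne, Or.inr ⟨i, hi⟩⟩]

variable [Fintype V] [DecidableEq V]

variable (A) in
/-- The distribution of a uniformly random renaming of the points and an independent seed. -/
noncomputable def sampleWeight (x : (V ≃ Fin n) × A.Seed) : ℝ :=
  (A.law x.2).toReal / Fintype.card (V ≃ Fin n)

theorem sampleWeight_nonneg (x : (V ≃ Fin n) × A.Seed) : 0 ≤ sampleWeight A x := by
  unfold sampleWeight; positivity

theorem sum_law : ∑ ω, (A.law ω).toReal = 1 := by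
  have h := A.law.tsum_coe
  rw [tsum_fintype] at h
  rw [← ENNReal.toReal_sum fun ω _ => A.law.apply_ne_top ω, h]
  rfl

theorem sum_sampleWeight (e₀ : V ≃ Fin n) :
    ∑ x : (V ≃ Fin n) × A.Seed, sampleWeight A x = 1 := by
  have : Nonempty (V ≃ Fin n) := ⟨e₀⟩
  have hc : (Fintype.card (V ≃ Fin n) : ℝ) ≠ 0 := by
    exact_mod_cast Fintype.card_ne_zero
  rw [Fintype.sum_prod_type]
  simp only [sampleWeight, ← Finset.sum_div, sum_law]
  rw [Finset.sum_const, Finset.card_univ, nsmul_eq_mul]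
  field_simp

/-- The guarantee holds for each renamed metric, hence on average over the renamings. -/
theorem le_weightOf_outputGood {ε : ℝ} (hn : 0 < n) (hA : A.SolvesMST n ε)
    (hD : ∑ i, (D i : Multiset (Fin n × Fin n)) = (vertexPairs n).val)
    (hDS : ∀ i, 3 * (D i).length ≤ A.space) (e₀ : V ≃ Fin n) {R : V → V → Prop}
    (hR : ∀ a b, R a b → R b a) :
    1 - 1 / (n : ℝ) ≤ weightOf (sampleWeight A) (OutputGood A D (relWeight R) ε) := by
  classical
  have : Nonempty (V ≃ Fin n) := ⟨e₀⟩
  have hc : (0 : ℝ) < Fintype.card (V ≃ Fin n) := by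
    exact_mod_cast Fintype.card_pos
  have key : ∀ e : V ≃ Fin n, 1 - 1 / (n : ℝ) ≤
      ∑ ω, if OutputGood A D (relWeight R) ε (e, ω) then (A.law ω).toReal else 0 := by
    intro e
    have h := ((hA _ (isOneTwoMetric_relabel e hR)).2 D ⟨hD, fun i => by
      simpa [List.length_flatMap, weightWords, mul_comm] using hDS i⟩).2
    rw [PMF.toOuterMeasure_apply, tsum_fintype] at h
    have hn1 : (1 : ℝ≥0∞) / n ≤ 1 := by
      rw [ENNReal.div_le_iff (by exact_mod_cast hn.ne') (by simp), one_mul]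
      exact_mod_cast hn
    have hne : ∀ ω : A.Seed, ({ω | (fun out => ∃ E : Fin A.machines → List (Fin n × Fin n),
        (∀ i, out i = (E i).flatMap pairWords) ∧ IsApproxMST (relabel e (relWeight R)) ε
          (SimpleGraph.fromRel fun u v => ∃ i, (u, v) ∈ E i)) (A.result ω fun i =>
          (D i).flatMap (weightWords (relabel e (relWeight R))))} : Set A.Seed).indicator
            A.law ω ≠ ⊤ := by
      intro ω
      rw [Set.indicator_apply]
      split_ifs
      exacts [A.law.apply_ne_top ω, ENNReal.zero_ne_top]
    have h2 := ENNReal.toReal_mono (ENNReal.sum_ne_top.2 fun ω _ => hne ω) h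
    rw [ENNReal.toReal_sub_of_le hn1 ENNReal.one_ne_top,
      ENNReal.toReal_sum fun ω _ => hne ω] at h2
    simp only [ENNReal.toReal_one, ENNReal.toReal_div, ENNReal.toReal_natCast] at h2
    refine h2.trans (Finset.sum_le_sum fun ω _ => le_of_eq ?_)
    rw [Set.indicator_apply, apply_ite ENNReal.toReal]
    exact if_congr Iff.rfl rfl rfl
  have h₁ : weightOf (sampleWeight A) (OutputGood A D (relWeight R) ε)
      = (∑ e : V ≃ Fin n, ∑ ω, if OutputGood A D (relWeight R) ε (e, ω)
        then (A.law ω).toReal else 0) / Fintype.card (V ≃ Fin n) := by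
    rw [weightOf, Fintype.sum_prod_type, Finset.sum_div]
    refine Finset.sum_congr rfl fun e _ => ?_
    rw [Finset.sum_div]
    refine Finset.sum_congr rfl fun ω _ => ?_
    simp only [sampleWeight]
    split_ifs <;> simp
  rw [h₁, le_div_iff₀ hc]
  refine le_trans (le_of_eq ?_) (Finset.sum_le_sum fun e _ => key e)
  rw [Finset.sum_const, Finset.card_univ, nsmul_eq_mul, mul_comm]

/-- Renaming the points beforehand does not change the probability that an edge is missing. -/
theorem weightOf_missing_comp (g : Equiv.Perm V) (w : V → V → ℕ) (a b : V) :
    weightOf (sampleWeight (n := n) A) (Missing A D (fun u v => w (g u) (g v)) a b)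
      = weightOf (sampleWeight A) (Missing A D w (g a) (g b)) := by
  classical
  unfold weightOf
  -- Precomposing a renaming with the inverse of `g` is a bijection of the renamings and preserves
  -- the uniform distribution.
  refine Fintype.sum_equiv ((Equiv.equivCongr g (Equiv.refl (Fin n))).prodCongr
    (Equiv.refl A.Seed)) _ _ ?_
  rintro ⟨e, ω⟩
  refine if_congr ?_ rfl rfl
  have h₁ : relabel e (fun u v => w (g u) (g v))
      = relabel (Equiv.equivCongr g (Equiv.refl (Fin n)) e) w := by
    funext u v
    simp [relabel, Equiv.equivCongr]
  simp [Missing, h₁, Equiv.equivCongr]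

end probability

section strandProbability

variable {Z E : Type} [Fintype Z] [Fintype E] [DecidableEq Z] [DecidableEq E] {m n : ℕ}
  {A : MPCAlgorithm} {D : Fin A.machines → List (Fin n × Fin n)}

/-- A correct output misses some edge of the cycle, and rotations of the cycle make all `m` edges
equally likely to be missed. So each is missing with probability at least `(1 - 1/n)/m`, and `n ≥
2`. -/
theorem weightOf_missing_cycle {ε : ℝ} (hn : 2 ≤ n) (hm : 3 ≤ m) (hA : A.SolvesMST n ε)
    (hD : ∑ i, (D i : Multiset (Fin n × Fin n)) = (vertexPairs n).val)
    (hDS : ∀ i, 3 * (D i).length ≤ A.space) (e₀ : (Z × Fin m) ⊕ E ≃ Fin n) (y : Z)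
    (j₀ : Fin m) (hj₀ : j₀.val + 1 < m) :
    1 / (2 * m : ℝ) ≤ weightOf (sampleWeight A) (Missing A D (relWeight (strandAdj (E := E) m y))
      (.inl (y, j₀)) (.inl (y, ⟨j₀.val + 1, hj₀⟩))) := by
  classical
  have : NeZero m := ⟨by omega⟩
  set w := relWeight (strandAdj (E := E) m y) with hw
  have hsucc : (⟨j₀.val + 1, hj₀⟩ : Fin m) = j₀ + 1 := by
    apply Fin.ext
    rw [Fin.val_add, Fin.val_one', Nat.mod_eq_of_lt (show 1 < m by omega),
      Nat.mod_eq_of_lt hj₀]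
  rw [hsucc]
  -- rotation of the cycle
  let rot : Fin m → Equiv.Perm ((Z × Fin m) ⊕ E) := fun i =>
    Equiv.sumCongr (Equiv.prodCongrRight fun z =>
      if z = y then Equiv.addRight i else Equiv.refl _) (Equiv.refl _)
  have hrot : ∀ i u v, w (rot i u) (rot i v) = w u v := by
    intro i u v
    have h₁ : strandAdj m y (rot i u) (rot i v) ↔ strandAdj m y u v := by
      rcases u with ⟨z, j⟩ | u <;> rcases v with ⟨z', j'⟩ | v
      · by_cases hzz : z = z'
        · subst hzz
          by_cases hz : z = y
          · subst hz
            have hcyc : ∀ a b : Fin m, strandAdj (E := E) m z (.inl (z, a)) (.inl (z, b)) ↔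
                (SimpleGraph.cycleGraph m).Adj a b := by
              intro a b
              simp only [strandAdj, true_and]
              constructor
              · rintro (h | h | h)
                · exact SimpleGraph.pathGraph_le_cycleGraph
                    (SimpleGraph.pathGraph_adj.2 (Or.inl h))
                · exact SimpleGraph.pathGraph_le_cycleGraph
                    (SimpleGraph.pathGraph_adj.2 (Or.inr h))
                · exact h
              · exact fun h => Or.inr (Or.inr h)
            have h2 : ∀ a : Fin m, rot i (.inl (z, a)) = .inl (z, a + i) := by
              intro a; simp [rot]
            rw [h2, h2, hcyc, hcyc, SimpleGraph.cycleGraph_adj', SimpleGraph.cycleGraph_adj',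
              add_sub_add_right_eq_sub, add_sub_add_right_eq_sub]
          · simp [rot, strandAdj, hz]
        · simp [rot, strandAdj, hzz]
      · simp [rot, strandAdj]
      · simp [rot, strandAdj]
      · simp [rot, strandAdj]
    exact relWeight_congr (EmbeddingLike.apply_eq_iff_eq _) h₁
  have hall : ∀ j : Fin m, weightOf (sampleWeight A) (Missing A D w
      (.inl (y, j)) (.inl (y, j + 1))) = weightOf (sampleWeight A) (Missing A D w
      (.inl (y, j₀)) (.inl (y, j₀ + 1))) := by
    intro j
    have h := weightOf_missing_comp (A := A) (D := D) (rot (j - j₀)) w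
      (.inl (y, j₀)) (.inl (y, j₀ + 1))
    simp only [hrot] at h
    rw [h]
    congr 2
    · simp [rot]
    · simp only [rot, Equiv.sumCongr_apply, Sum.map_inl, Equiv.prodCongrRight_apply, if_true,
        Equiv.coe_addRight]
      congr 2
      abel
  have hsum : ∑ j : Fin m, weightOf (sampleWeight A) (Missing A D w
      (.inl (y, j)) (.inl (y, j + 1))) = m * weightOf (sampleWeight A) (Missing A D w
      (.inl (y, j₀)) (.inl (y, j₀ + 1))) := by
    rw [Finset.sum_congr rfl fun j _ => hall j, Finset.sum_const, Finset.card_univ,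
      Fintype.card_fin, nsmul_eq_mul]
  have hgood := le_weightOf_outputGood (by omega) hA hD hDS e₀
    (strandAdj_symm (E := E) (m := m) y)
  have hle : weightOf (sampleWeight A) (OutputGood A D w ε) ≤ ∑ j : Fin m,
      weightOf (sampleWeight A) (Missing A D w (.inl (y, j)) (.inl (y, j + 1))) := by
    rw [sum_weightOf, weightOf]
    refine Finset.sum_le_sum fun x _ => ?_
    split_ifs with hx
    · refine le_mul_of_one_le_right (sampleWeight_nonneg x) ?_
      obtain ⟨T, hT, hTm⟩ := hx.exists_tree
      obtain ⟨j, hj⟩ := exists_not_adj_of_isAcyclic hm hT.1.isAcyclic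
        (f := fun j => x.1 (.inl (y, j))) fun a b h => by simpa using h
      have hne : (Sum.inl (y, j) : (Z × Fin m) ⊕ E) ≠ .inl (y, j + 1) := by
        simp only [ne_eq, Sum.inl.injEq, Prod.mk.injEq, true_and]
        intro h
        have h1 : (1 : Fin m) = 0 := by
          have := congrArg (· - j) h
          simpa using this.symm
        have h2 := congrArg Fin.val h1
        rw [Fin.val_one', Nat.mod_eq_of_lt (by omega)] at h2
        simp at h2
      have : 0 < (Finset.univ.filter fun j : Fin m =>
          Missing A D w (.inl (y, j)) (.inl (y, j + 1)) x).card :=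
        Finset.card_pos.2 ⟨j, Finset.mem_filter.2 ⟨Finset.mem_univ _, (hTm _ _ hne).2 hj⟩⟩
      exact_mod_cast this
    · exact mul_nonneg (sampleWeight_nonneg x) (Nat.cast_nonneg _)
  have hm0 : (0 : ℝ) < m := by exact_mod_cast (show 0 < m by omega)
  have hn0 : (2 : ℝ) ≤ n := by exact_mod_cast hn
  have h1n : 1 / (n : ℝ) ≤ 1 / 2 := one_div_le_one_div_of_le (by norm_num) hn0
  rw [hsum] at hle
  rw [div_le_iff₀ (by positivity)]
  linarith

/-- Swapping strands shows that all strands other than `y` miss the edge equally often, so the left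
side is the expected number of such misses. It is at most `2εn + 1` for correct outputs; failures
have probability at most `1/n` and contribute at most `n` misses, which adds 1. -/
theorem weightOf_missing_path {ε : ℝ} (hn : 0 < n) (hε : 0 ≤ ε) (hA : A.SolvesMST n ε)
    (hD : ∑ i, (D i : Multiset (Fin n × Fin n)) = (vertexPairs n).val)
    (hDS : ∀ i, 3 * (D i).length ≤ A.space) (e₀ : (Z × Fin m) ⊕ E ≃ Fin n) (x₀ y : Z)
    (hxy : x₀ ≠ y) (j₀ : Fin m) (hj₀ : j₀.val + 1 < m) :
    (Fintype.card Z - 1) * weightOf (sampleWeight A) (Missing A D (relWeight (strandAdj (E := E) m y))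
      (.inl (x₀, j₀)) (.inl (x₀, ⟨j₀.val + 1, hj₀⟩))) ≤ 2 * ε * n + 2 := by
  classical
  set w := relWeight (strandAdj (E := E) m y) with hw
  let swp : Z → Equiv.Perm ((Z × Fin m) ⊕ E) := fun z =>
    Equiv.sumCongr (Equiv.prodCongr (Equiv.swap x₀ z) (Equiv.refl _)) (Equiv.refl _)
  have hswp : ∀ z, z ≠ y → ∀ u v, w (swp z u) (swp z v) = w u v := by
    intro z hz u v
    have hy : ∀ t, Equiv.swap x₀ z t = y ↔ t = y := by
      intro t
      rw [Equiv.swap_apply_eq_iff, Equiv.swap_apply_of_ne_of_ne hxy.symm hz.symm]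
    have h₁ : strandAdj m y (swp z u) (swp z v) ↔ strandAdj m y u v := by
      rcases u with ⟨z, j⟩ | u <;> rcases v with ⟨z', j'⟩ | v <;> simp [swp, strandAdj, hy]
    exact relWeight_congr (EmbeddingLike.apply_eq_iff_eq _) h₁
  have hall : ∀ z ∈ Finset.univ.filter (fun z => z ≠ y), weightOf (sampleWeight A) (Missing A D w
      (.inl (z, j₀)) (.inl (z, ⟨j₀.val + 1, hj₀⟩))) = weightOf (sampleWeight A) (Missing A D w
      (.inl (x₀, j₀)) (.inl (x₀, ⟨j₀.val + 1, hj₀⟩))) := by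
    intro z hz
    have h := weightOf_missing_comp (A := A) (D := D) (swp z) w
      (.inl (x₀, j₀)) (.inl (x₀, ⟨j₀.val + 1, hj₀⟩))
    simp only [hswp z (Finset.mem_filter.1 hz).2] at h
    rw [h]
    simp [swp]
  have hcard : ((Finset.univ.filter fun z => z ≠ y).card : ℝ) = Fintype.card Z - 1 := by
    rw [Finset.filter_ne', Finset.card_erase_of_mem (Finset.mem_univ _), Finset.card_univ,
      Nat.cast_pred (Fintype.card_pos_iff.2 ⟨y⟩)]
  have hsum := sum_weightOf (sampleWeight A) (Finset.univ.filter fun z => z ≠ y)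
    fun z => Missing A D w (.inl (z, j₀)) (.inl (z, ⟨j₀.val + 1, hj₀⟩))
  rw [Finset.sum_congr rfl hall, Finset.sum_const, nsmul_eq_mul, hcard] at hsum
  rw [hsum]
  have hgood := le_weightOf_outputGood hn hA hD hDS e₀
    (strandAdj_symm (E := E) (m := m) y)
  have htot := sum_sampleWeight (A := A) e₀
  have hn0 : (0 : ℝ) < n := by exact_mod_cast hn
  have hZn : (Fintype.card Z : ℝ) ≤ n := by
    have h1 := Fintype.card_congr e₀
    have h2 : Fintype.card Z ≤ n := by
      simp only [Fintype.card_sum, Fintype.card_prod, Fintype.card_fin] at h1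
      have := Nat.le_mul_of_pos_right (Fintype.card Z) (show 0 < m by omega)
      omega
    exact_mod_cast h2
  have hpoint : ∀ x : ((Z × Fin m) ⊕ E ≃ Fin n) × A.Seed, sampleWeight A x *
      (((Finset.univ.filter fun z => z ≠ y).filter fun z => Missing A D w (.inl (z, j₀))
        (.inl (z, ⟨j₀.val + 1, hj₀⟩)) x).card : ℝ) ≤
      (2 * ε * n + 1) * sampleWeight A x + n * (sampleWeight A x -
        if OutputGood A D w ε x then sampleWeight A x else 0) := by
    intro x
    have h0 := sampleWeight_nonneg (A := A) x
    split_ifs with hx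
    · obtain ⟨T, hT, hTm⟩ := hx.exists_tree
      have h1 := card_missing_le x.1 y hε hT j₀ hj₀
      rw [sub_self, mul_zero, add_zero, mul_comm]
      refine mul_le_mul_of_nonneg_right (le_trans (le_of_eq ?_) h1) h0
      rw [Finset.filter_filter]
      congr 2
      ext z
      simp only [Finset.mem_filter, Finset.mem_univ, true_and, and_congr_right_iff]
      intro _
      exact hTm _ _ (by simp [Fin.ext_iff])
    · have h1 : (((Finset.univ.filter fun z => z ≠ y).filter fun z => Missing A D w (.inl (z, j₀))
        (.inl (z, ⟨j₀.val + 1, hj₀⟩)) x).card : ℝ) ≤ n := by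
        refine le_trans ?_ hZn
        exact_mod_cast Finset.card_le_univ _
      have h2 := mul_le_mul_of_nonneg_left h1 h0
      have h3 : 0 ≤ (2 * ε * n + 1) * sampleWeight A x := by positivity
      rw [sub_zero]
      linarith
  refine (Finset.sum_le_sum fun x _ => hpoint x).trans ?_
  rw [Finset.sum_add_distrib, ← Finset.mul_sum, ← Finset.mul_sum, Finset.sum_sub_distrib, htot]
  have h1 : 1 - weightOf (sampleWeight A) (OutputGood A D w ε) ≤ 1 / n := by linarith
  have h2 : (n : ℝ) * (1 - weightOf (sampleWeight A) (OutputGood A D w ε)) ≤ 1 := by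
    refine (mul_le_mul_of_nonneg_left h1 hn0.le).trans_eq ?_
    field_simp
  rw [weightOf] at h2
  linarith

end strandProbability

/-! ### The mirrored layered graph of a product of permutations -/

section layers

variable {Z : Type} (k d : ℕ) (σ π : Equiv.Perm Z)

/-- The permutations to be composed: `k` times `σ`, then `d` times `π`. -/
def layerPerm (i : ℕ) : Equiv.Perm Z := if i < k then σ else if i < k + d then π else 1

/-- The composition of the first `i` permutations. -/
def partialProduct : ℕ → Equiv.Perm Z
  | 0 => 1
  | i + 1 => layerPerm k d σ π i * partialProduct i

/-- Padding with identities makes the number of layers independent of the digit `d`. -/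
theorem partialProduct_two_mul (hd : d ≤ k) : partialProduct k d σ π (2 * k) = π ^ d * σ ^ k := by
  have h₁ : ∀ i ≤ k, partialProduct k d σ π i = σ ^ i := by
    intro i
    induction i with
    | zero => intro _; rfl
    | succ i ih =>
      intro hi
      rw [partialProduct, ih (by omega), layerPerm, if_pos (by omega), pow_succ']
  have h₂ : ∀ i ≤ d, partialProduct k d σ π (k + i) = π ^ i * σ ^ k := by
    intro i
    induction i with
    | zero => intro _; simpa using h₁ k le_rfl
    | succ i ih =>
      intro hi
      rw [← add_assoc, partialProduct, ih (by omega), layerPerm, if_neg (by omega), if_pos (by omega),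
        pow_succ', mul_assoc]
  have h₃ : ∀ i, partialProduct k d σ π (k + d + i) = π ^ d * σ ^ k := by
    intro i
    induction i with
    | zero => exact h₂ d le_rfl
    | succ i ih =>
      rw [← add_assoc, partialProduct, ih, layerPerm, if_neg (by omega), if_neg (by omega), one_mul]
  rw [← h₃ (k - d)]
  congr 1
  omega

/-- The distance of a position from the middle of a strand. -/
def layerOf (k j : ℕ) : ℕ := if j ≤ 2 * k then 2 * k - j else j - (2 * k + 1)

variable {E : Type}

/-- Straightens the layered graph into strands. -/
def straighten : Equiv.Perm ((Z × Fin (4 * k + 2)) ⊕ E) :=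
  Equiv.sumCongr (Equiv.prodCongrLeft fun j => (partialProduct k d σ π (layerOf k j))⁻¹) (Equiv.refl E)

/-- Adjacency in the layered graph, in which strand `x` is a cycle if the composed permutation
maps `x` to `y`, and a path otherwise. -/
def layeredAdj (y : Z) (a b : (Z × Fin (4 * k + 2)) ⊕ E) : Prop :=
  strandAdj (4 * k + 2) ((partialProduct k d σ π (2 * k))⁻¹ y)
    (straighten k d σ π a) (straighten k d σ π b)

theorem layeredAdj_symm (y : Z) (a b : (Z × Fin (4 * k + 2)) ⊕ E)
    (h : layeredAdj k d σ π y a b) : layeredAdj k d σ π y b a :=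
  strandAdj_symm _ _ _ h

/-- Between neighbouring layers the inverse partial products cancel down to a single factor, so
adjacency is local although strands are defined by whole products. The closing edge joins two points
of layer `2k`, where both sides carry the same product and only `z = y` remains. -/
theorem layeredAdj_iff (y z z' : Z) (j j' : Fin (4 * k + 2)) :
    layeredAdj (E := E) k d σ π y (.inl (z, j)) (.inl (z', j')) ↔
      ((j.val + 1 = j'.val ∨ j'.val + 1 = j.val) ∧
        ((layerOf k j' = layerOf k j + 1 ∧ layerPerm k d σ π (layerOf k j) z = z') ∨
        (layerOf k j = layerOf k j' + 1 ∧ layerPerm k d σ π (layerOf k j') z' = z) ∨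
        (layerOf k j = layerOf k j' ∧ z = z'))) ∨
      (¬ (j.val + 1 = j'.val ∨ j'.val + 1 = j.val) ∧
        (SimpleGraph.cycleGraph (4 * k + 2)).Adj j j' ∧ z = z' ∧ z = y) := by
  have hstr : ∀ (z : Z) (j : Fin (4 * k + 2)), straighten (E := E) k d σ π (.inl (z, j))
      = .inl ((partialProduct k d σ π (layerOf k j))⁻¹ z, j) := fun _ _ => rfl
  simp only [layeredAdj, hstr, strandAdj]
  by_cases hc : j.val + 1 = j'.val ∨ j'.val + 1 = j.val
  · have h₁ : (j.val + 1 = j'.val ∨ j'.val + 1 = j.val ∨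
        (partialProduct k d σ π (layerOf k j))⁻¹ z = (partialProduct k d σ π (2 * k))⁻¹ y ∧
          (SimpleGraph.cycleGraph (4 * k + 2)).Adj j j') := by tauto
    simp only [h₁, hc, and_true, true_and, not_true_eq_false, false_and, or_false]
    have hlay : layerOf k j' = layerOf k j + 1 ∨ layerOf k j = layerOf k j' + 1 ∨
        layerOf k j = layerOf k j' := by
      simp only [layerOf]; split_ifs <;> omega
    rcases hlay with h | h | h
    · have e1 : ¬ layerOf k j = layerOf k j' + 1 := by omega
      have e2 : ¬ layerOf k j = layerOf k j' := by omega
      simp only [e1, e2, false_and, or_false]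
      simp only [h, true_and, partialProduct, mul_inv_rev, Equiv.Perm.mul_apply,
        EmbeddingLike.apply_eq_iff_eq]
      rw [Equiv.Perm.eq_inv_iff_eq]
    · have e1 : ¬ layerOf k j' = layerOf k j + 1 := by omega
      have e2 : ¬ layerOf k j = layerOf k j' := by omega
      simp only [e1, e2, false_and, or_false, false_or]
      simp only [h, true_and, partialProduct, mul_inv_rev, Equiv.Perm.mul_apply,
        EmbeddingLike.apply_eq_iff_eq]
      rw [Equiv.Perm.inv_eq_iff_eq, eq_comm]
    · have e1 : ¬ layerOf k j' = layerOf k j + 1 := by omega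
      have e2 : ¬ layerOf k j = layerOf k j' + 1 := by omega
      simp only [e1, e2, false_and, false_or]
      simp only [h, true_and, EmbeddingLike.apply_eq_iff_eq]
  · have h₁ : ¬ (j.val + 1 = j'.val) := fun h => hc (Or.inl h)
    have h₂ : ¬ (j'.val + 1 = j.val) := fun h => hc (Or.inr h)
    simp only [h₁, h₂, or_self, false_and, false_or, not_false_eq_true, true_and]
    by_cases hadj : (SimpleGraph.cycleGraph (4 * k + 2)).Adj j j'
    · have hl : layerOf k j = 2 * k ∧ layerOf k j' = 2 * k := by
        rcases cycleGraph_adj_ends hadj h₁ h₂ with h | h <;> simp only [layerOf, h] <;>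
          constructor <;> split_ifs <;> omega
      simp only [hl.1, hl.2, hadj, EmbeddingLike.apply_eq_iff_eq, and_true, true_and]
    · simp [hadj]

end layers

/-! ### Each weight depends on one entry of the permutations -/

section locality

variable {Δ Q E : Type}

/-- A permutation, extended by the identity. -/
def padPerm (Q : Type) {Δ : Type} (ρ : Equiv.Perm Δ) : Equiv.Perm (Δ ⊕ Q) :=
  Equiv.sumCongr ρ (Equiv.refl Q)

open scoped Classical in
/-- The entry of the permutations on which the weight of a pair of points depends. -/
noncomputable def depEntry [Nonempty Δ] (k : ℕ) (a b : ((Δ ⊕ Q) × Fin (4 * k + 2)) ⊕ E) : Δ × Δ :=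
  match a, b with
  | .inl (.inl z, j), .inl (.inl z', j') =>
    if layerOf k j < layerOf k j' then (z, z') else (z', z)
  | _, _ => Classical.arbitrary _

theorem layerPerm_congr {k d : ℕ} {σ π σ' π' : Equiv.Perm Δ} {i : ℕ} {a b : Δ}
    (hσ : σ a = b ↔ σ' a = b) (hπ : π a = b ↔ π' a = b) :
    layerPerm k d (padPerm Q σ) (padPerm Q π) i (.inl a) = .inl b ↔
      layerPerm k d (padPerm Q σ') (padPerm Q π') i (.inl a) = .inl b := by
  unfold layerPerm
  split_ifs <;> simp [padPerm, hσ, hπ]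

theorem layerPerm_padPerm_inr {k d : ℕ} {σ π : Equiv.Perm Δ} {i : ℕ} {q : Q} :
    layerPerm k d (padPerm Q σ) (padPerm Q π) i (.inr q) = .inr q := by
  unfold layerPerm
  split_ifs <;> simp [padPerm]

theorem layerPerm_padPerm_ne {k d : ℕ} {σ π : Equiv.Perm Δ} {i : ℕ} {a : Δ} {q : Q} :
    layerPerm k d (padPerm Q σ) (padPerm Q π) i (.inl a) ≠ .inr q := by
  unfold layerPerm
  split_ifs <;> simp [padPerm]

variable [Nonempty Δ]

/-- Each clause of `layeredAdj_iff` uses at most one entry of one factor, from the inner to the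
outer layer, and the padding strands use none. This makes a weight computable from the two bits
stored for a single entry. -/
theorem layeredAdj_congr {k d : ℕ} {σ π σ' π' : Equiv.Perm Δ} (y : Δ ⊕ Q)
    (a b : ((Δ ⊕ Q) × Fin (4 * k + 2)) ⊕ E)
    (hσ : σ (depEntry k a b).1 = (depEntry k a b).2 ↔ σ' (depEntry k a b).1 = (depEntry k a b).2)
    (hπ : π (depEntry k a b).1 = (depEntry k a b).2 ↔ π' (depEntry k a b).1 = (depEntry k a b).2) :
    layeredAdj k d (padPerm Q σ) (padPerm Q π) y a b ↔
      layeredAdj k d (padPerm Q σ') (padPerm Q π') y a b := by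
  rcases a with ⟨z, j⟩ | a
  swap
  · exact Iff.rfl
  rcases b with ⟨z', j'⟩ | b
  swap
  · exact Iff.rfl
  rw [layeredAdj_iff, layeredAdj_iff]
  refine or_congr (and_congr_right fun _ => or_congr (and_congr_right fun h => ?_)
    (or_congr (and_congr_right fun h => ?_) Iff.rfl)) Iff.rfl
  · rcases z with z | q <;> rcases z' with z' | q'
    · simp only [depEntry, show layerOf k j < layerOf k j' by omega, if_true] at hσ hπ
      exact layerPerm_congr hσ hπ
    · simp [layerPerm_padPerm_ne]
    · simp [layerPerm_padPerm_inr]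
    · simp [layerPerm_padPerm_inr]
  · rcases z with z | q <;> rcases z' with z' | q'
    · simp only [depEntry, show ¬ layerOf k j < layerOf k j' by omega, if_false] at hσ hπ
      exact layerPerm_congr hσ hπ
    · simp [layerPerm_padPerm_inr]
    · simp [layerPerm_padPerm_ne]
    · simp [layerPerm_padPerm_inr]

open scoped Classical in
/-- The matrix of a permutation. -/
noncomputable def permBit (ρ : Equiv.Perm Δ) (h : Δ × Δ) : ℕ := if ρ h.1 = h.2 then 1 else 0

omit [Nonempty Δ] in
theorem permBit_eq_iff {ρ ρ' : Equiv.Perm Δ} {h : Δ × Δ} :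
    permBit ρ h = permBit ρ' h ↔ (ρ h.1 = h.2 ↔ ρ' h.1 = h.2) := by
  unfold permBit
  split_ifs with h1 h2 h2 <;> simp [h1, h2]

/-- The `(1, 2)`-metric of the layered graph. -/
noncomputable def layeredWeight (k d : ℕ) (σ π : Equiv.Perm Δ) (y : Δ) :
    ((Δ ⊕ Q) × Fin (4 * k + 2)) ⊕ E → ((Δ ⊕ Q) × Fin (4 * k + 2)) ⊕ E → ℕ :=
  relWeight (layeredAdj k d (padPerm Q σ) (padPerm Q π) (.inl y))

open scoped Classical in
/-- The weight of a pair of points as a function of the entries of the two permutations. -/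
noncomputable def entryWeight (k d : ℕ) (y : Δ) (a b : ((Δ ⊕ Q) × Fin (4 * k + 2)) ⊕ E)
    (p s : ℕ) : ℕ :=
  if h : ∃ ρ : Equiv.Perm Δ × Equiv.Perm Δ,
      permBit ρ.2 (depEntry k a b) = p ∧ permBit ρ.1 (depEntry k a b) = s
    then layeredWeight k d h.choose.1 h.choose.2 y a b else 0

theorem entryWeight_le (k d : ℕ) (y : Δ) (a b : ((Δ ⊕ Q) × Fin (4 * k + 2)) ⊕ E) (p s : ℕ) :
    entryWeight k d y a b p s ≤ 2 := by
  unfold entryWeight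
  split_ifs
  exacts [relWeight_le _ _ _, Nat.zero_le _]

/-- By `layeredAdj_congr` it does not matter which permutations with the given two bits
`entryWeight` picks. -/
theorem entryWeight_eq (k d : ℕ) (σ π : Equiv.Perm Δ) (y : Δ)
    (a b : ((Δ ⊕ Q) × Fin (4 * k + 2)) ⊕ E) :
    entryWeight k d y a b (permBit π (depEntry k a b)) (permBit σ (depEntry k a b))
      = layeredWeight k d σ π y a b := by
  have h : ∃ ρ : Equiv.Perm Δ × Equiv.Perm Δ, permBit ρ.2 (depEntry k a b)
      = permBit π (depEntry k a b) ∧ permBit ρ.1 (depEntry k a b)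
      = permBit σ (depEntry k a b) := ⟨(σ, π), rfl, rfl⟩
  rw [entryWeight, dif_pos h]
  refine relWeight_congr Iff.rfl (layeredAdj_congr _ _ _ ?_ ?_)
  · exact permBit_eq_iff.1 h.choose_spec.2
  · exact permBit_eq_iff.1 h.choose_spec.1

end locality

/-! ### Derandomization by a fixed table -/

section table

variable {Δ Q E : Type} [Fintype Δ] [Fintype Q] [Fintype E] [DecidableEq Δ] [DecidableEq Q]
  [DecidableEq E] {n : ℕ} {A : MPCAlgorithm} {D : Fin A.machines → List (Fin n × Fin n)}

open scoped Classical in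
/-- There is a table of renamings and seeds with which the composition of permutations can be
read off from approximate minimum spanning trees of layered metrics. -/
theorem exists_table {κ : Type} [Fintype κ] {ε : ℝ} {k : ℕ} (hk : 0 < k) (hn : 2 ≤ n)
    (hε : 0 ≤ ε) (hA : A.SolvesMST n ε)
    (hD : ∑ i, (D i : Multiset (Fin n × Fin n)) = (vertexPairs n).val)
    (hDS : ∀ i, 3 * (D i).length ≤ A.space)
    (e₀ : ((Δ ⊕ Q) × Fin (4 * k + 2)) ⊕ E ≃ Fin n)
    (hZ : 32 * (4 * k + 2 : ℕ) * (2 * ε * n + 2) ≤ (Fintype.card (Δ ⊕ Q) : ℝ) - 1)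
    (hκ : ((Fintype.card (Equiv.Perm Δ)) ^ 2 * k * Fintype.card Δ ^ 2 : ℝ)
      < Real.exp (1 / (8 * (4 * k + 2 : ℕ)) * Fintype.card κ / 2)) :
    ∃ tab : κ → (((Δ ⊕ Q) × Fin (4 * k + 2)) ⊕ E ≃ Fin n) × A.Seed,
      ∀ (d : Fin k) (σ π : Equiv.Perm Δ) (x y : Δ),
        1 / (8 * (4 * k + 2 : ℕ)) * (Fintype.card κ : ℝ) ≤ (Finset.univ.filter fun r =>
          Missing A D (layeredWeight k d σ π y) (.inl (.inl x, ⟨2 * k, by omega⟩))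
            (.inl (.inl x, ⟨2 * k + 1, by omega⟩)) (tab r)).card ↔
        (π ^ d.val * σ ^ k) x = y := by
  have hm : (0 : ℝ) < (4 * k + 2 : ℕ) := by positivity
  -- `straighten` carries the layered metric to straight strands and fixes the two middle points
  -- over `x`, which lie in layer `0`.
  have hprob : ∀ (d : Fin k) (σ π : Equiv.Perm Δ) (x y : Δ), weightOf (sampleWeight A)
      (Missing A D (layeredWeight (Q := Q) (E := E) k d σ π y) (.inl (.inl x, ⟨2 * k, by omega⟩))
        (.inl (.inl x, ⟨2 * k + 1, by omega⟩))) = weightOf (sampleWeight A)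
      (Missing A D (relWeight (strandAdj (E := E) (4 * k + 2)
        (.inl ((π ^ d.val * σ ^ k)⁻¹ y) : Δ ⊕ Q)))
        (.inl (.inl x, ⟨2 * k, by omega⟩)) (.inl (.inl x, ⟨2 * k + 1, by omega⟩))) := by
    intro d σ π x y
    have h := weightOf_missing_comp (A := A) (D := D)
      (straighten (E := E) k d (padPerm Q σ) (padPerm Q π))
      (relWeight (strandAdj (E := E) (4 * k + 2) (.inl ((π ^ d.val * σ ^ k)⁻¹ y) : Δ ⊕ Q)))
      (.inl (.inl x, ⟨2 * k, by omega⟩)) (.inl (.inl x, ⟨2 * k + 1, by omega⟩))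
    have h₁ : ∀ (z : Δ ⊕ Q) (j : Fin (4 * k + 2)), straighten (E := E) k d (padPerm Q σ)
        (padPerm Q π) (.inl (z, j)) = .inl ((partialProduct k d (padPerm Q σ) (padPerm Q π)
          (layerOf k j))⁻¹ z, j) := fun _ _ => rfl
    rw [h₁, h₁] at h
    have h₂ : layerOf k (2 * k) = 0 := by simp [layerOf]
    have h₃ : layerOf k (2 * k + 1) = 0 := by simp [layerOf]
    simp only [h₂, h₃, partialProduct, inv_one, Equiv.Perm.one_apply] at h
    rw [← h]
    congr 2
    funext u v
    refine relWeight_congr (EmbeddingLike.apply_eq_iff_eq _).symm ?_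
    have h₄ : (partialProduct k d (padPerm Q σ) (padPerm Q π) (2 * k))⁻¹ (.inl y)
        = .inl ((π ^ d.val * σ ^ k)⁻¹ y) := by
      rw [partialProduct_two_mul k d _ _ d.isLt.le]
      have h₅ : ∀ (ρ : Equiv.Perm Δ) (i : ℕ), padPerm Q ρ ^ i = padPerm Q (ρ ^ i) := by
        intro ρ i
        induction i with
        | zero => ext (a | a) <;> simp [padPerm]
        | succ i ih => rw [pow_succ, ih, pow_succ]; ext (a | a) <;> simp [padPerm]
      rw [h₅, h₅, Equiv.Perm.inv_eq_iff_eq]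
      simp [padPerm]
    rw [layeredAdj, h₄]
  -- With `m = 4k + 2` and `s = 1/(8m)`, the bound `1/(2m)` for cycles is `4s`, and the bound
  -- `1/(32m)` that `hZ` gives for paths is `s/4`.
  refine (exists_separating_sample (κ := κ)
    (J := Fin k × Equiv.Perm Δ × Equiv.Perm Δ × Δ × Δ)
    (s := 1 / (8 * (4 * k + 2 : ℕ)))
    (sampleWeight_nonneg (A := A) (V := ((Δ ⊕ Q) × Fin (4 * k + 2)) ⊕ E)) (sum_sampleWeight e₀)
    (fun j => Missing A D (layeredWeight k j.1 j.2.1 j.2.2.1 j.2.2.2.2)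
      (.inl (.inl j.2.2.2.1, ⟨2 * k, by omega⟩)) (.inl (.inl j.2.2.2.1, ⟨2 * k + 1, by omega⟩)))
    (fun j => (j.2.2.1 ^ j.1.val * j.2.1 ^ k) j.2.2.2.1 = j.2.2.2.2) ?_ ?_ ?_).imp
    fun tab htab d σ π x y => htab (d, σ, π, x, y)
  · rintro ⟨d, σ, π, x, y⟩ hxy
    simp only at hxy ⊢
    rw [hprob, ← hxy, ← Equiv.Perm.mul_apply, inv_mul_cancel, Equiv.Perm.one_apply]
    refine le_trans (le_of_eq ?_) (weightOf_missing_cycle hn (by omega) hA hD hDS e₀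
      (.inl x) ⟨2 * k, by omega⟩ (by simp only; omega))
    field_simp
    norm_num
  · rintro ⟨d, σ, π, x, y⟩ hxy
    simp only at hxy ⊢
    rw [hprob]
    have hne : (Sum.inl x : Δ ⊕ Q) ≠ .inl ((π ^ d.val * σ ^ k)⁻¹ y) := by
      intro h
      have h' := Sum.inl.inj h
      rw [Equiv.Perm.eq_inv_iff_eq] at h'
      exact hxy h'
    have h := weightOf_missing_path (by omega) hε hA hD hDS e₀ _ _ hne
      ⟨2 * k, by omega⟩ (by simp only; omega)
    simp only at h
    set P := weightOf (sampleWeight A) (Missing A D (relWeight (strandAdj (E := E) (4 * k + 2)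
        (.inl ((π ^ d.val * σ ^ k)⁻¹ y) : Δ ⊕ Q)))
        (.inl (.inl x, ⟨2 * k, by omega⟩)) (.inl (.inl x, ⟨2 * k + 1, by omega⟩))) with hP
    have hP0 : 0 ≤ P := Finset.sum_nonneg fun ω _ => by
      split_ifs
      exacts [sampleWeight_nonneg _, le_rfl]
    have h1 := mul_le_mul_of_nonneg_right hZ hP0
    have hpos : (0 : ℝ) < 2 * ε * n + 2 := by positivity
    have h2 : (2 * ε * n + 2) * (32 * (4 * k + 2 : ℕ) * P) ≤ (2 * ε * n + 2) * 1 := by linarith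
    have h3 := le_of_mul_le_mul_left h2 hpos
    rw [div_div, le_div_iff₀ (by positivity)]
    linarith
  · refine lt_of_le_of_lt (le_of_eq ?_) hκ
    simp only [Fintype.card_prod, Fintype.card_fin]
    push_cast
    ring

end table

/-! ### Powers of a permutation by Horner's scheme -/

section powers

variable {Δ Q E : Type} [Fintype Δ] [Fintype Q] [Fintype E] [DecidableEq Δ] [DecidableEq Q]
  [DecidableEq E] [Nonempty Δ] {n k b d : ℕ} (A : MPCAlgorithm)
  (D : Fin A.machines → List (Fin n × Fin n))
  (place : Fin A.machines → Fin d → Fin b)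
  (slot : (Δ × Δ) × (Fin n × Fin n) → Fin d → Fin b)
  (tab : (Fin d → Fin b) → (((Δ ⊕ Q) × Fin (4 * k + 2)) ⊕ E ≃ Fin n) × A.Seed)

/-- From the matrices of `π` and `σ`, compute the matrix of `π ^ i * σ ^ k`. -/
noncomputable def powerProg (i : ℕ) :
    List (NetStep ((Δ × Δ) × (Fin d → Fin b) × (Fin d → Fin b))) :=
  phaseProg A place (fun r => (tab r).2) D slot
    (fun r e => depEntry k ((tab r).1.symm e.1) ((tab r).1.symm e.2))
    (fun h r e => entryWeight k i h.2 ((tab r).1.symm e.1) ((tab r).1.symm e.2))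
    (fun h r => edgeObs ((tab r).1 (.inl (.inl h.1, ⟨2 * k, by omega⟩)))
      ((tab r).1 (.inl (.inl h.1, ⟨2 * k + 1, by omega⟩))))
    (1 / (8 * (4 * k + 2 : ℕ)) * (Fintype.card (Fin d → Fin b) : ℝ))

/-- From the matrix of `π`, with base-`k` digits given, compute the matrix of a power. -/
noncomputable def digitsProg :
    List (Fin k) → List (NetStep ((Δ × Δ) × (Fin d → Fin b) × (Fin d → Fin b)))
  | [] => []
  | i :: l => digitsProg l ++ powerProg A D place slot tab i

omit [Fintype Q] [Fintype E] [DecidableEq Δ] [DecidableEq Q] [DecidableEq E] in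
theorem digitsProg_length (l : List (Fin k)) :
    (digitsProg A D place slot tab l).length = l.length * (A.rounds + 4 * d + 4) := by
  induction l with
  | nil => simp [digitsProg]
  | cons i l ih =>
    rw [digitsProg, List.length_append, ih, powerProg, phaseProg_length, List.length_cons]
    ring

/-- The parameters for which the composition of permutations works. -/
structure PowerSetup (S W : ℕ) (ε : ℝ) : Prop where
  place_inj : Function.Injective place
  slot_inj : Function.Injective slot
  sum_eq : ∑ i, (D i : Multiset (Fin n × Fin n)) = (vertexPairs n).val
  records_le : ∀ i, 3 * (D i).length ≤ A.space
  space_lt : A.space + 1 ≤ S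
  two_le : 2 ≤ S
  le_word : n ≤ W
  word_le : A.wordBound ≤ W
  base_le : b ≤ S
  pow_lt : b ^ d < W
  three_le : 3 ≤ W
  solves : A.SolvesMST n ε
  table : open scoped Classical in
    ∀ (i : Fin k) (σ π : Equiv.Perm Δ) (x y : Δ),
      1 / (8 * (4 * k + 2 : ℕ)) * (Fintype.card (Fin d → Fin b) : ℝ) ≤
        (Finset.univ.filter fun r =>
          Missing A D (layeredWeight k i σ π y) (.inl (.inl x, ⟨2 * k, by omega⟩))
            (.inl (.inl x, ⟨2 * k + 1, by omega⟩)) (tab r)).card ↔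
        (π ^ i.val * σ ^ k) x = y

variable {A D place slot tab}

omit [Fintype Δ] [Nonempty Δ] in
theorem permBit_le (ρ : Equiv.Perm Δ) (h : Δ × Δ) : permBit ρ h ≤ 1 := by
  unfold permBit; split_ifs <;> simp

omit [Fintype Q] [Fintype E] [DecidableEq Q] [DecidableEq E] in
-- On the stored bits, `entryWeight` reproduces the layered metrics, so the count of `trace_phase`
-- is the one that the table compares with the threshold.
theorem PowerSetup.trace_power {S W : ℕ} {ε : ℝ} (hs : PowerSetup A D place slot tab S W ε)
    (σ π : Equiv.Perm Δ) (i : Fin k) :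
    Trace S W (powerProg A D place slot tab i)
      (quiet (twoWords (fun u => permBit π u.1) fun u => permBit σ u.1))
      (quiet (twoWords (fun u => permBit π u.1) fun u => permBit (π ^ i.val * σ ^ k) u.1)) := by
  classical
  have hW := hs.three_le
  have hbit : ∀ (ρ : Equiv.Perm Δ) h, permBit ρ h < W := fun ρ h =>
    (permBit_le ρ h).trans_lt (by omega)
  have hw : ∀ (h : Δ × Δ) (r : Fin d → Fin b), copyWeight
      (fun r e => depEntry k ((tab r).1.symm e.1) ((tab r).1.symm e.2))
      (fun h r e => entryWeight k i.val h.2 ((tab r).1.symm e.1) ((tab r).1.symm e.2))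
      (permBit π) (permBit σ) h r = relabel (tab r).1 (layeredWeight k i σ π h.2) := by
    intro h r
    funext u v
    exact entryWeight_eq k i.val σ π h.2 _ _
  have h := trace_phase (A := A) (place := place) (seed := fun r => (tab r).2) (D := D)
    (slot := slot) (dep := fun r e => depEntry k ((tab r).1.symm e.1) ((tab r).1.symm e.2))
    (val := fun h r e => entryWeight k i.val h.2 ((tab r).1.symm e.1) ((tab r).1.symm e.2))
    (obs := fun h r => edgeObs ((tab r).1 (.inl (.inl h.1, ⟨2 * k, by omega⟩)))
      ((tab r).1 (.inl (.inl h.1, ⟨2 * k + 1, by omega⟩))))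
    (θ := 1 / (8 * (4 * k + 2 : ℕ)) * (Fintype.card (Fin d → Fin b) : ℝ))
    hs.place_inj hs.sum_eq hs.slot_inj
    (fun i => (Nat.succ_le_succ (hs.records_le i)).trans hs.space_lt) hs.two_le hs.le_word
    hs.space_lt hs.word_le hs.base_le hs.pow_lt (by omega) (hbit π) (hbit σ)
    (fun h r e p s => (entryWeight_le _ _ _ _ _ _ _).trans_lt (by omega))
    (fun h r l => by unfold edgeObs; split_ifs <;> simp)
    (fun h r => by
      rw [hw]
      refine ((hs.solves _ (isOneTwoMetric_relabel _ (layeredAdj_symm k i.val _ _ _))).2 D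
        ⟨hs.sum_eq, fun i => ?_⟩).1 _
      simpa [List.length_flatMap, weightWords, mul_comm] using hs.records_le i)
  simp only [hw] at h
  refine (congrArg (fun v => Trace S W _ _ (quiet (twoWords _ v))) (funext fun u => ?_)).mp h
  have key := hs.table i σ π u.1.1 u.1.2
  have hmiss : ∀ r, Missing A D (layeredWeight k i.val σ π u.1.2)
      (.inl (.inl u.1.1, ⟨2 * k, by omega⟩)) (.inl (.inl u.1.1, ⟨2 * k + 1, by omega⟩)) (tab r) ↔ _ :=
    fun r => Iff.rfl
  by_cases h1 : (π ^ i.val * σ ^ k) u.1.1 = u.1.2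
  · rw [permBit, if_pos h1]
    refine if_pos ((key.2 h1).trans_eq (congrArg (fun s : Finset _ => (s.card : ℝ)) ?_))
    ext r
    simp only [Finset.mem_filter, Finset.mem_univ, true_and]
    exact hmiss r
  · rw [permBit, if_neg h1]
    refine if_neg fun h2 => h1 (key.1 (h2.trans_eq (congrArg (fun s : Finset _ => (s.card : ℝ)) ?_)))
    ext r
    simp only [Finset.mem_filter, Finset.mem_univ, true_and]
    exact (hmiss r).symm

omit [Fintype Q] [Fintype E] [DecidableEq Q] [DecidableEq E] in
-- The recursion `ofDigits k (i :: l) = i + k * ofDigits k l`, started at the identity.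
theorem PowerSetup.trace_digits {S W : ℕ} {ε : ℝ} (hs : PowerSetup A D place slot tab S W ε)
    (π : Equiv.Perm Δ) (l : List (Fin k)) :
    Trace S W (digitsProg A D place slot tab l)
      (quiet (twoWords (fun u => permBit π u.1) fun u => permBit 1 u.1))
      (quiet (twoWords (fun u => permBit π u.1) fun u =>
        permBit (π ^ Nat.ofDigits k (l.map Fin.val)) u.1)) := by
  induction l with
  | nil =>
    simp only [List.map_nil, Nat.ofDigits_nil, pow_zero]
    exact rfl
  | cons i l ih =>
    refine ih.append ?_
    have := hs.trace_power (π ^ Nat.ofDigits k (l.map Fin.val)) π i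
    rwa [← pow_mul, ← pow_add, mul_comm _ k] at this

theorem exists_digits {k : ℕ} (hk : 2 ≤ k) (N : ℕ) :
    ∃ l : List (Fin k), Nat.ofDigits k (l.map Fin.val) = N ∧ l.length ≤ Nat.log k N + 1 := by
  have h : ∀ x ∈ Nat.digits k N, x < k := fun x hx => Nat.digits_lt_base (by omega) hx
  obtain ⟨l, hl⟩ : ∃ l : List (Fin k), l.map Fin.val = Nat.digits k N :=
    ⟨(Nat.digits k N).pmap (fun x hx => ⟨x, hx⟩) h, by simp [List.map_pmap]⟩
  refine ⟨l, by rw [hl, Nat.ofDigits_digits], ?_⟩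
  have : l.length = (Nat.digits k N).length := by rw [← hl, List.length_map]
  rw [this]
  rcases Nat.eq_zero_or_pos N with rfl | hN
  · simp
  · rw [Nat.length_digits k N (by omega) hN.ne']

end powers

/-! ### Walking along a 2-regular graph -/

section darts

variable {V : Type} (nb : V → Bool → V)

open scoped Classical in
/-- The dart that follows the dart `x` when walking straight on; the dart `(v, s)` leads from `v`
to its neighbour `nb v s`. -/
noncomputable def nextDart (x : V × Bool) : V × Bool :=
  (nb x.1 x.2, decide (nb (nb x.1 x.2) false = x.1))

/-- Each vertex has two distinct neighbours, and the relation is symmetric. -/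
structure IsTwoRegular : Prop where
  ne : ∀ v, nb v false ≠ nb v true
  symm : ∀ v s, ∃ s', nb (nb v s) s' = v

variable {nb}

theorem IsTwoRegular.inj (h : IsTwoRegular nb) {v : V} {s s' : Bool} (he : nb v s = nb v s') :
    s = s' := by
  cases s <;> cases s'
  · rfl
  · exact absurd he (h.ne v)
  · exact absurd he.symm (h.ne v)
  · rfl

theorem IsTwoRegular.back (h : IsTwoRegular nb) (x : V × Bool) :
    nb (nextDart nb x).1 (!(nextDart nb x).2) = x.1 := by
  obtain ⟨s', hs'⟩ := h.symm x.1 x.2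
  simp only [nextDart]
  by_cases h' : nb (nb x.1 x.2) false = x.1
  · simp [h']
  · cases s'
    · exact absurd hs' h'
    · simpa [h'] using hs'

/-- Each of the two conditions concerns the neighbours of one vertex, so the machine of that vertex
can check it alone. -/
theorem IsTwoRegular.nextDart_eq_iff (h : IsTwoRegular nb) (x y : V × Bool) :
    nextDart nb x = y ↔ nb x.1 x.2 = y.1 ∧ nb y.1 (!y.2) = x.1 := by
  constructor
  · rintro rfl
    exact ⟨rfl, h.back x⟩
  · rintro ⟨h₁, h₂⟩
    refine Prod.ext h₁ ?_
    have h₃ := h.back x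
    have h₄ : (nextDart nb x).1 = y.1 := h₁
    rw [h₄, ← h₂] at h₃
    simpa using h.inj h₃

theorem IsTwoRegular.nextDart_injective (h : IsTwoRegular nb) :
    Function.Injective (nextDart nb) := by
  intro x x' hx
  obtain ⟨h₁, h₂⟩ := (h.nextDart_eq_iff x _).1 hx
  obtain ⟨h₃, h₄⟩ := (h.nextDart_eq_iff x' _).1 rfl
  have h₅ : x.1 = x'.1 := h₂.symm.trans h₄
  refine Prod.ext h₅ (h.inj (v := x.1) ?_)
  rw [h₁, h₅, h₃]

/-- The permutation of the darts that walks one step further. -/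
noncomputable def IsTwoRegular.perm [Finite V] (h : IsTwoRegular nb) : Equiv.Perm (V × Bool) :=
  Equiv.ofBijective (nextDart nb) (Finite.injective_iff_bijective.1 h.nextDart_injective)

variable {G : SimpleGraph V}

/-- The vertex `v` lies on a cycle of length `m`, which is a component of the graph. -/
def OnCycle (G : SimpleGraph V) (m : ℕ) (v : V) : Prop :=
  ∃ g : ZMod m → V, Function.Injective g ∧ g 0 = v ∧
    ∀ i w, G.Adj (g i) w ↔ w = g (i + 1) ∨ w = g (i - 1)

theorem two_ne_zero_zmod {m : ℕ} (hm : 3 ≤ m) : (2 : ZMod m) ≠ 0 := by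
  intro h
  have : ((2 : ℕ) : ZMod m) = 0 := by exact_mod_cast h
  have := Nat.le_of_dvd (by norm_num) ((ZMod.natCast_eq_zero_iff _ _).1 this)
  omega

/-- The walk keeps its initial direction `e = ±1`, so after `t` steps it is at `g (t * e)`, about to
move to `g ((t + 1) * e)`. The directions differ because `m ≥ 3`. -/
theorem IsTwoRegular.perm_pow_eq_iff [Finite V] (h : IsTwoRegular nb)
    (hG : ∀ v w, G.Adj v w ↔ ∃ s, nb v s = w) {m : ℕ} (hm : 3 ≤ m) (x : V × Bool)
    (hx : OnCycle G m x.1) (t : ℕ) : (h.perm ^ t) x = x ↔ m ∣ t := by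
  obtain ⟨g, hg, hg₀, hadj⟩ := hx
  obtain ⟨e, he, hne⟩ : ∃ e : ZMod m, (e = 1 ∨ e = -1) ∧ nb x.1 x.2 = g e := by
    have h₁ := (hadj 0 (nb x.1 x.2)).1 (by rw [hg₀]; exact (hG _ _).2 ⟨_, rfl⟩)
    rcases h₁ with h₁ | h₁
    · exact ⟨1, Or.inl rfl, by rw [h₁, zero_add]⟩
    · exact ⟨-1, Or.inr rfl, by rw [h₁, zero_sub]⟩
  have h2 : e + e ≠ 0 := by
    have := two_ne_zero_zmod hm
    rcases he with rfl | rfl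
    · rwa [one_add_one_eq_two]
    · intro h0
      apply this
      linear_combination -h0
  have key : ∀ t : ℕ, ((h.perm ^ t) x).1 = g (t * e) ∧
      nb ((h.perm ^ t) x).1 ((h.perm ^ t) x).2 = g ((t + 1) * e) := by
    intro t
    induction t with
    | zero => simpa [hg₀] using hne
    | succ t ih =>
      rw [pow_succ', Equiv.Perm.mul_apply]
      generalize (h.perm ^ t) x = z at ih
      obtain ⟨ih₁, ih₂⟩ := ih
      have h₁ : (h.perm z).1 = g ((t + 1) * e) := ih₂
      have h₂ : nb (h.perm z).1 (!(h.perm z).2) = g (t * e) := (h.back z).trans ih₁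
      have h₃ : G.Adj (h.perm z).1 (g ((t + 1 + 1) * e)) := by
        rw [h₁, hadj]
        rcases he with rfl | rfl
        · left; congr 1; ring
        · right; congr 1; ring
      obtain ⟨s, hs⟩ := (hG _ _).1 h₃
      -- The other choice of `s` would lead back, giving `g ((t + 2) * e) = g (t * e)` and hence `2e
      -- = 0`.
      have h₄ : s = (h.perm z).2 := by
        by_contra hc
        have h₅ : s = !(h.perm z).2 := by
          revert hc
          cases s <;> cases (h.perm z).2 <;> simp
        rw [h₅, h₂] at hs
        apply h2
        have := hg hs
        linear_combination -this
      push_cast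
      exact ⟨h₁, by rw [← h₄]; exact hs⟩
  have hiff : (h.perm ^ t) x = x ↔ (t : ZMod m) * e = 0 := by
    obtain ⟨h₁, h₂⟩ := key t
    constructor
    · intro h₃
      rw [h₃, ← hg₀] at h₁
      exact (hg h₁).symm
    · intro h₃
      rw [h₃, hg₀] at h₁
      rw [h₁, add_mul, h₃, one_mul, zero_add, ← hne] at h₂
      exact Prod.ext h₁ (h.inj h₂)
  rw [hiff, ← ZMod.natCast_eq_zero_iff]
  rcases he with rfl | rfl <;> simp

end darts

/-! ### The two kinds of input consist of cycles -/

section cycles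

theorem onCycle_cycleGraph {m : ℕ} (hm : 3 ≤ m) (v : Fin m) :
    OnCycle (SimpleGraph.cycleGraph m) m v := by
  obtain ⟨m, rfl⟩ : ∃ k, m = k + 3 := ⟨m - 3, by omega⟩
  have key : ∀ i w : Fin (m + 3), (SimpleGraph.cycleGraph (m + 3)).Adj (v + i) w ↔
      w = v + (i + 1) ∨ w = v + (i - 1) := by
    intro i w
    rw [SimpleGraph.cycleGraph_adj, or_comm]
    refine or_congr ?_ ?_
    · rw [sub_eq_iff_eq_add]
      constructor
      · rintro rfl; abel
      · rintro rfl; abel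
    · constructor
      · intro h
        rw [← add_sub_assoc, ← h]; abel
      · rintro rfl; abel
  -- `ZMod (m + 3)` is `Fin (m + 3)` by definition.
  exact ⟨fun i : Fin (m + 3) => v + i, add_right_injective v, add_zero v, fun i w => key i w⟩

theorem OnCycle.map {V W : Type} {G : SimpleGraph V} {H : SimpleGraph W} (φ : G ≃g H) {m : ℕ}
    {v : V} (h : OnCycle H m (φ v)) : OnCycle G m v := by
  obtain ⟨g, hg, hg₀, hadj⟩ := h
  refine ⟨fun i => φ.symm (g i), φ.symm.injective.comp hg, by simp [hg₀], fun i w => ?_⟩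
  rw [← φ.map_adj_iff]
  have : ∀ x, w = φ.symm x ↔ φ w = x := fun x =>
    ⟨by rintro rfl; simp, by rintro rfl; simp⟩
  simp [hadj, this]

theorem onCycle_sum {V W : Type} {G : SimpleGraph V} {H : SimpleGraph W} {m : ℕ}
    (hG : ∀ v, OnCycle G m v) (hH : ∀ v, OnCycle H m v) (x : V ⊕ W) : OnCycle (G ⊕g H) m x := by
  rcases x with v | v
  · obtain ⟨g, hg, hg₀, hadj⟩ := hG v
    refine ⟨fun i => .inl (g i), Sum.inl_injective.comp hg, congrArg _ hg₀, fun i w => ?_⟩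
    cases w <;> simp [hadj]
  · obtain ⟨g, hg, hg₀, hadj⟩ := hH v
    refine ⟨fun i => .inr (g i), Sum.inr_injective.comp hg, congrArg _ hg₀, fun i w => ?_⟩
    cases w <;> simp [hadj]

theorem IsOneCycle.onCycle {N : ℕ} (hN : 2 ≤ N) {G : SimpleGraph (Fin (2 * N))}
    (h : IsOneCycle N G) (v : Fin (2 * N)) : OnCycle G (2 * N) v :=
  h.elim fun φ => OnCycle.map φ (onCycle_cycleGraph (by omega) _)

theorem IsTwoCycles.onCycle {N : ℕ} (hN : 3 ≤ N) {G : SimpleGraph (Fin (2 * N))}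
    (h : IsTwoCycles N G) (v : Fin (2 * N)) : OnCycle G N v :=
  h.elim fun φ => OnCycle.map φ (onCycle_sum (onCycle_cycleGraph hN) (onCycle_cycleGraph hN) _)

open scoped Classical in
theorem OnCycle.card_eq_two {V : Type} [Fintype V] {G : SimpleGraph V} {m : ℕ} (hm : 3 ≤ m) {v : V}
    (h : OnCycle G m v) : (Finset.univ.filter (G.Adj v)).card = 2 := by
  obtain ⟨g, hg, rfl, hadj⟩ := h
  have : Finset.univ.filter (G.Adj (g 0)) = {g (0 + 1), g (0 - 1)} := by
    ext w
    simp only [Finset.mem_filter, Finset.mem_univ, true_and, hadj, Finset.mem_insert,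
      Finset.mem_singleton]
  rw [this]
  refine Finset.card_pair fun h => ?_
  have := hg h
  exact two_ne_zero_zmod hm (by linear_combination this)

end cycles

/-! ### The neighbours of a vertex, ordered by their number -/

section slots

variable {M : ℕ}

/-- The least and the greatest element of a set (and `v` if the set is empty). -/
noncomputable def slotOf (v : Fin M) (T : Finset (Fin M)) (s : Bool) : Fin M :=
  if h : T.Nonempty then if s then T.max' h else T.min' h else v

theorem exists_slotOf {v : Fin M} {T : Finset (Fin M)} (hT : T.card = 2) (w : Fin M) :
    w ∈ T ↔ ∃ s, slotOf v T s = w := by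
  have hne : T.Nonempty := Finset.card_pos.1 (by omega)
  have hlt := Finset.min'_lt_max'_of_card T (by omega : 1 < T.card)
  have hsub : ({T.min' hne, T.max' hne} : Finset (Fin M)) ⊆ T := by
    intro x hx
    rcases Finset.mem_insert.1 hx with rfl | hx
    · exact Finset.min'_mem _ _
    · rw [Finset.mem_singleton.1 hx]; exact Finset.max'_mem _ _
  have heq := Finset.eq_of_subset_of_card_le hsub (by rw [hT, Finset.card_pair hlt.ne])
  have : w ∈ T ↔ w = T.min' hne ∨ w = T.max' hne := by
    conv_lhs => rw [← heq]
    simp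
  simp [this, slotOf, hne, eq_comm]

theorem slotOf_ne {v : Fin M} {T : Finset (Fin M)} (hT : T.card = 2) :
    slotOf v T false ≠ slotOf v T true := by
  have hne : T.Nonempty := Finset.card_pos.1 (by omega)
  simpa [slotOf, hne] using (Finset.min'_lt_max'_of_card T (by omega : 1 < T.card)).ne

open scoped Classical in
/-- The two neighbours of a vertex. -/
noncomputable def nbrOf (G : SimpleGraph (Fin M)) (v : Fin M) : Bool → Fin M :=
  slotOf v (Finset.univ.filter (G.Adj v))

open scoped Classical in
theorem adj_iff_nbrOf {G : SimpleGraph (Fin M)}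
    (hG : ∀ v, (Finset.univ.filter (G.Adj v)).card = 2) (v w : Fin M) :
    G.Adj v w ↔ ∃ s, nbrOf G v s = w := by
  rw [nbrOf, ← exists_slotOf (hG v)]
  simp

open scoped Classical in
theorem isTwoRegular_nbrOf {G : SimpleGraph (Fin M)}
    (hG : ∀ v, (Finset.univ.filter (G.Adj v)).card = 2) : IsTwoRegular (nbrOf G) where
  ne v := slotOf_ne (hG v)
  symm _ s := (adj_iff_nbrOf hG _ _).1 ((adj_iff_nbrOf hG _ _).2 ⟨s, rfl⟩).symm

end slots

/-! ### Computing the matrix of the next-dart permutation -/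

section initialization

variable {M b d : ℕ} (c₀ : Fin d → Fin b)

/-- The machine that looks after a vertex. -/
def vertexMachine (v : Fin M) :
    ((Fin M × Bool) × (Fin M × Bool)) × (Fin d → Fin b) × (Fin d → Fin b) :=
  (((v, false), (v, false)), c₀, c₀)

/-- The other ends of the listed edges at `v`. -/
def otherEnds (v : Fin M) (L : List (Fin M × Fin M)) : List ℕ :=
  L.flatMap fun e => if e.1 = v then [e.2.val] else if e.2 = v then [e.1.val] else []

open scoped Classical in
/-- The machines of the vertices learn the neighbours. -/
noncomputable def gatherProg :
    List (NetStep (((Fin M × Bool) × (Fin M × Bool)) × (Fin d → Fin b) × (Fin d → Fin b))) :=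
  exchangeProg
    (fun _ m u => if u = vertexMachine c₀ u.1.1.1 then otherEnds u.1.1.1
      ((preimage? (fun E : List (Fin M × Fin M) => E.flatMap pairWords) m).getD []) else [])
    fun u _ inb => if u = vertexMachine c₀ u.1.1.1 then
      [(slotOf u.1.1.1 (Finset.univ.filter fun x : Fin M => ∃ w, x.val ∈ inb w) false).val,
        (slotOf u.1.1.1 (Finset.univ.filter fun x : Fin M => ∃ w, x.val ∈ inb w) true).val] else []

/-- The neighbours of a vertex, in the memory of its machine. -/
noncomputable def nbrMemory (nb : Fin M → Bool → Fin M)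
    (u : ((Fin M × Bool) × (Fin M × Bool)) × (Fin d → Fin b) × (Fin d → Fin b)) : List ℕ :=
  open scoped Classical in
  if u = vertexMachine c₀ u.1.1.1 then [(nb u.1.1.1 false).val, (nb u.1.1.1 true).val] else []

open scoped Classical in
/-- The machines of the vertices announce the entries of the matrix of the next-dart
permutation. -/
noncomputable def announceProg :
    List (NetStep (((Fin M × Bool) × (Fin M × Bool)) × (Fin d → Fin b) × (Fin d → Fin b))) :=
  exchangeProg
    (fun u m u' => if u = vertexMachine c₀ u.1.1.1 then
      (if u'.2 = (c₀, c₀) ∧ u'.1.1.1 = u.1.1.1 ∧ m.getD u'.1.1.2.toNat M = u'.1.2.1.val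
        then [1] else []) ++
      (if u'.2 = (c₀, c₀) ∧ u'.1.2.1 = u.1.1.1 ∧ m.getD (!u'.1.2.2).toNat M = u'.1.1.1.val
        then [1] else []) else [])
    fun _ _ inb => [0, if ∑ w, (inb w).length = 2 then 1 else 0]

variable {c₀}

theorem vertexMachine_key (v : Fin M) : (vertexMachine c₀ v).1.1.1 = v := rfl

open scoped Classical in
theorem sum_vertexMachine
    (f : ((Fin M × Bool) × (Fin M × Bool)) × (Fin d → Fin b) × (Fin d → Fin b) → ℕ) :
    (∑ u, if u = vertexMachine c₀ u.1.1.1 then f u else 0) = ∑ v, f (vertexMachine c₀ v) := by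
  rw [← Finset.sum_filter]
  symm
  refine Finset.sum_bij (fun v _ => vertexMachine c₀ v) ?_ ?_ ?_ ?_
  · intro v _; simp [vertexMachine_key]
  · intro v _ v' _ h
    have := congrArg (fun u => u.1.1.1) h
    simpa [vertexMachine_key] using this
  · intro u hu
    exact ⟨u.1.1.1, Finset.mem_univ _, (Finset.mem_filter.1 hu).2.symm⟩
  · intro v _; rfl

theorem mem_otherEnds {v : Fin M} {L : List (Fin M × Fin M)} {x : Fin M} :
    x.val ∈ otherEnds v L ↔ ∃ e ∈ L, (e.1 = v ∧ e.2 = x) ∨ (e.1 ≠ v ∧ e.2 = v ∧ e.1 = x) := by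
  simp only [otherEnds, List.mem_flatMap]
  refine exists_congr fun e => and_congr_right fun _ => ?_
  split_ifs with h₁ h₂
  · simp [h₁, Fin.ext_iff, eq_comm]
  · simp [h₁, h₂, Fin.ext_iff, eq_comm]
  · simp [h₁, h₂]

theorem lt_of_mem_otherEnds {v : Fin M} {L : List (Fin M × Fin M)} {x : ℕ}
    (hx : x ∈ otherEnds v L) : x < M := by
  simp only [otherEnds, List.mem_flatMap] at hx
  obtain ⟨e, -, he⟩ := hx
  split_ifs at he
  · rw [List.mem_singleton.1 he]; exact e.2.isLt
  · rw [List.mem_singleton.1 he]; exact e.1.isLt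
  · simp at he

theorem length_otherEnds (v : Fin M) (L : List (Fin M × Fin M)) :
    (otherEnds v L).length = ((L : Multiset (Fin M × Fin M)).map fun e =>
      if e.1 = v then 1 else if e.2 = v then 1 else 0).sum := by
  rw [Multiset.map_coe, Multiset.sum_coe]
  simp only [otherEnds, List.length_flatMap]
  congr 2
  funext e
  split_ifs <;> rfl

theorem sum_length_otherEnds_le (L : List (Fin M × Fin M)) :
    ∑ v, (otherEnds v L).length ≤ (L.flatMap pairWords).length := by
  induction L with
  | nil => simp [otherEnds]
  | cons e L ih =>
    have h : ∀ v, (otherEnds v (e :: L)).length =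
        (if e.1 = v then 1 else if e.2 = v then 1 else 0) + (otherEnds v L).length := by
      intro v
      simp only [otherEnds, List.flatMap_cons, List.length_append]
      congr 1
      split_ifs <;> rfl
    simp only [h, Finset.sum_add_distrib, List.flatMap_cons, List.length_append]
    refine Nat.add_le_add ?_ ih
    calc ∑ v, (if e.1 = v then 1 else if e.2 = v then 1 else 0)
        ≤ ∑ v, ((if e.1 = v then 1 else 0) + if e.2 = v then 1 else 0) :=
          Finset.sum_le_sum fun v _ => by split_ifs <;> omega
      _ = (pairWords e).length := by simp [Finset.sum_add_distrib, pairWords]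

open scoped Classical in
-- Each edge is listed once, so different records at `v` name different neighbours.
theorem sum_received_otherEnds_le {I : Type} [Fintype I] {G : SimpleGraph (Fin M)}
    {D : I → List (Fin M × Fin M)} (hD : ∑ i, (D i : Multiset (Fin M × Fin M)) = (edgeRecords G).val)
    (v : Fin M) : ∑ i, (otherEnds v (D i)).length ≤ (Finset.univ.filter (G.Adj v)).card := by
  simp only [length_otherEnds]
  have : ∑ i, ((D i : Multiset (Fin M × Fin M)).map fun e =>
      if e.1 = v then 1 else if e.2 = v then 1 else 0).sum = ((edgeRecords G).val.map fun e =>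
      if e.1 = v then 1 else if e.2 = v then 1 else 0).sum := by
    rw [← hD]
    exact (map_sum ((Multiset.sumAddMonoidHom (M := ℕ)).comp (Multiset.mapAddMonoidHom
      fun e : Fin M × Fin M => if e.1 = v then 1 else if e.2 = v then 1 else 0))
      (fun i => (D i : Multiset (Fin M × Fin M))) Finset.univ).symm
  rw [this]
  change ∑ e ∈ edgeRecords G, (if e.1 = v then 1 else if e.2 = v then 1 else 0) ≤ _
  have h : ∀ e : Fin M × Fin M, (if e.1 = v then 1 else if e.2 = v then 1 else 0) =
      if e.1 = v ∨ e.2 = v then 1 else 0 := by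
    intro e; split_ifs <;> simp_all
  simp only [h]
  rw [← Finset.card_filter]
  refine Finset.card_le_card_of_injOn (fun e => if e.1 = v then e.2 else e.1) ?_ ?_
  · intro e he
    have he := Finset.mem_filter.1 (Finset.mem_coe.1 he)
    have hadj := (mem_edgeRecords.1 he.1).2
    simp only [Finset.coe_filter, Finset.mem_univ, true_and, Set.mem_ofPred_eq]
    split_ifs with h₁
    · exact h₁ ▸ hadj
    · have h₂ := he.2.resolve_left h₁
      exact h₂ ▸ hadj.symm
  · intro e he e' he' heq
    have he := Finset.mem_filter.1 (Finset.mem_coe.1 he)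
    have he' := Finset.mem_filter.1 (Finset.mem_coe.1 he')
    have hlt := (mem_edgeRecords.1 he.1).1
    have hlt' := (mem_edgeRecords.1 he'.1).1
    obtain ⟨a, c⟩ := e
    obtain ⟨a', c'⟩ := e'
    simp only at *
    split_ifs at heq with h₁ h₂ h₂
    · subst h₁ h₂ heq; rfl
    · subst h₁ heq
      have := he'.2.resolve_left h₂
      subst this
      exact absurd hlt (lt_asymm hlt')
    · subst h₂ heq
      have := he.2.resolve_left h₁
      subst this
      exact absurd hlt (lt_asymm hlt')
    · have h₃ := he.2.resolve_left h₁
      have h₄ := he'.2.resolve_left h₂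
      subst h₃ heq h₄; rfl

variable {G : SimpleGraph (Fin M)} {S W : ℕ}

open scoped Classical in
-- However the edges are placed, a vertex machine receives at most two words, and a holder sends at
-- most one word per word that it stores.
theorem trace_gather (hG : ∀ v, (Finset.univ.filter (G.Adj v)).card = 2)
    {D : ((Fin M × Bool) × (Fin M × Bool)) × (Fin d → Fin b) × (Fin d → Fin b) →
      List (Fin M × Fin M)}
    (hD : ∑ u, (D u : Multiset (Fin M × Fin M)) = (edgeRecords G).val)
    (hDS : ∀ u, ((D u).flatMap pairWords).length ≤ S) (hS : 2 ≤ S) (hW : M ≤ W) :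
    Trace S W (gatherProg c₀) (quiet fun u => (D u).flatMap pairWords)
      (quiet (nbrMemory c₀ (nbrOf G))) := by
  have hdec : ∀ u, (preimage? (fun E : List (Fin M × Fin M) => E.flatMap pairWords)
      ((D u).flatMap pairWords)).getD [] = D u := fun u => by
    rw [preimage?_apply flatMap_pairWords_injective (D u)]; rfl
  refine trace_exchange (bounded_quiet hDS fun u x hx => ?_) (fun u => ?_) (fun u => ?_)
    (fun u v x hx => ?_) (bounded_quiet (fun u => ?_) fun u x hx => ?_) fun u => ?_
  · obtain ⟨e, -, he⟩ := List.mem_flatMap.1 hx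
    simp only [pairWords, List.mem_cons, List.not_mem_nil, or_false] at he
    rcases he with rfl | rfl
    · exact e.1.isLt.trans_le hW
    · exact e.2.isLt.trans_le hW
  · simp only [hdec]
    split_ifs with h
    · exact (sum_received_otherEnds_le hD _).trans ((hG _).trans_le hS)
    · simp
  · simp only [hdec, apply_ite List.length, List.length_nil]
    rw [sum_vertexMachine fun v => (otherEnds v.1.1.1 (D u)).length]
    exact (sum_length_otherEnds_le (D u)).trans (hDS u)
  · split_ifs at hx
    · exact (lt_of_mem_otherEnds hx).trans_le hW
    · simp at hx
  · unfold nbrMemory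
    split_ifs <;> simp [hS]
  · unfold nbrMemory at hx
    split_ifs at hx
    · simp only [List.mem_cons, List.not_mem_nil, or_false] at hx
      rcases hx with rfl | rfl <;> exact (Fin.isLt _).trans_le hW
    · simp at hx
  · unfold nbrMemory
    simp only [hdec]
    split_ifs with h
    · have : (Finset.univ.filter fun x : Fin M => ∃ w, x.val ∈ otherEnds u.1.1.1 (D w)) =
          Finset.univ.filter (G.Adj u.1.1.1) := by
        refine Finset.filter_congr fun x _ => ?_
        have hmem : ∀ e, (∃ w, e ∈ D w) ↔ e ∈ edgeRecords G := by
          intro e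
          rw [← Finset.mem_val, ← hD, Multiset.mem_sum]
          simp
        simp only [mem_otherEnds]
        rw [exists_comm]
        simp only [exists_and_right, hmem, mem_edgeRecords]
        constructor
        · rintro ⟨e, ⟨-, h₁⟩, ⟨h₂, h₃⟩ | ⟨-, h₂, h₃⟩⟩
          · rw [← h₂, ← h₃]; exact h₁
          · rw [← h₂, ← h₃]; exact h₁.symm
        · intro hadj
          rcases lt_or_gt_of_ne hadj.ne with hlt | hlt
          · exact ⟨(u.1.1.1, x), ⟨hlt, hadj⟩, Or.inl ⟨rfl, rfl⟩⟩
          · exact ⟨(x, u.1.1.1), ⟨hlt, hadj.symm⟩, Or.inr ⟨hlt.ne, rfl, rfl⟩⟩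
      rw [this]; rfl
    · rfl

open scoped Classical in
-- For the entry `(x, y)`, the machines of the two vertices each send one word if their half of
-- `nextDart_eq_iff` holds; two words mean that the entry is 1. A vertex addresses at most four
-- entries in each role, whence `8 ≤ S`.
theorem trace_announce {nb : Fin M → Bool → Fin M} (h : IsTwoRegular nb) (hS : 8 ≤ S)
    (hM : M ≤ W) (hW : 2 ≤ W) :
    Trace S W (announceProg c₀) (quiet (nbrMemory c₀ nb)) (quiet (twoWords (fun _ => 0)
      fun u => if u.2 = (c₀, c₀) then permBit h.perm u.1 else 0)) := by
  have hget : ∀ (v : Fin M) (s : Bool), [(nb v false).val, (nb v true).val].getD s.toNat M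
      = (nb v s).val := by
    intro v s; cases s <;> rfl
  have hbit : ∀ u : ((Fin M × Bool) × (Fin M × Bool)) × (Fin d → Fin b) × (Fin d → Fin b),
      (if u.2 = (c₀, c₀) then permBit h.perm u.1 else 0) ≤ 1 := by
    intro u; split_ifs
    · exact permBit_le _ _
    · simp
  have hlen : ∀ (p : Prop) [Decidable p], (if p then [1] else [] : List ℕ).length =
      if p then 1 else 0 := by
    intro p _; split_ifs <;> rfl
  have hrecv : ∀ u' : ((Fin M × Bool) × (Fin M × Bool)) × (Fin d → Fin b) × (Fin d → Fin b),
      ∑ u, (if u = vertexMachine c₀ u.1.1.1 then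
        (if u'.2 = (c₀, c₀) ∧ u'.1.1.1 = u.1.1.1 ∧
            (nbrMemory c₀ nb u).getD u'.1.1.2.toNat M = u'.1.2.1.val then [1] else []) ++
        (if u'.2 = (c₀, c₀) ∧ u'.1.2.1 = u.1.1.1 ∧
            (nbrMemory c₀ nb u).getD (!u'.1.2.2).toNat M = u'.1.1.1.val then [1] else [])
        else [] : List ℕ).length =
      (if u'.2 = (c₀, c₀) ∧ nb u'.1.1.1 u'.1.1.2 = u'.1.2.1 then 1 else 0) +
        if u'.2 = (c₀, c₀) ∧ nb u'.1.2.1 (!u'.1.2.2) = u'.1.1.1 then 1 else 0 := by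
    intro u'
    simp only [apply_ite List.length, List.length_append, List.length_nil]
    rw [sum_vertexMachine]
    simp only [nbrMemory, vertexMachine_key, if_true, hget, Fin.val_inj, Finset.sum_add_distrib]
    congr 1
    · rw [Finset.sum_eq_single u'.1.1.1]
      · simp
      · intro v _ hv
        exact if_neg fun hc => hv hc.2.1.symm
      · simp
    · rw [Finset.sum_eq_single u'.1.2.1]
      · simp
      · intro v _ hv
        exact if_neg fun hc => hv hc.2.1.symm
      · simp
  refine trace_exchange (bounded_quiet (fun u => ?_) fun u x hx => ?_) (fun u => ?_) (fun u => ?_)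
    (fun u v x hx => ?_) (bounded_twoWords (by omega) (fun u => by omega) fun u =>
      (hbit u).trans_lt (by omega)) fun u => ?_
  · unfold nbrMemory
    split_ifs
    · simp only [List.length_cons, List.length_nil]; omega
    · simp
  · unfold nbrMemory at hx
    split_ifs at hx
    · simp only [List.mem_cons, List.not_mem_nil, or_false] at hx
      rcases hx with rfl | rfl <;> exact (Fin.isLt _).trans_le hM
    · simp at hx
  · rw [hrecv]
    split_ifs <;> omega
  · by_cases hu : u = vertexMachine c₀ u.1.1.1
    · simp only [if_pos hu, List.length_append, hlen, nbrMemory, hget, Fin.val_inj,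
        Finset.sum_add_distrib]
      rw [← Finset.card_filter, ← Finset.card_filter]
      have h₁ : ∀ f : Bool × Bool →
          ((Fin M × Bool) × (Fin M × Bool)) × (Fin d → Fin b) × (Fin d → Fin b),
          (Finset.univ.image f).card ≤ 4 := fun f => Finset.card_image_le.trans (by simp)
      refine (Nat.add_le_add ((Finset.card_le_card ?_).trans
        (h₁ fun s => (((u.1.1.1, s.1), (nb u.1.1.1 s.1, s.2)), c₀, c₀)))
        ((Finset.card_le_card ?_).trans
        (h₁ fun s => (((nb u.1.1.1 (!s.2), s.1), (u.1.1.1, s.2)), c₀, c₀)))).trans hS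
      · rintro ⟨⟨⟨a, s⟩, c, s'⟩, e⟩ he
        obtain ⟨rfl, rfl, hc⟩ := (Finset.mem_filter.1 he).2
        obtain rfl : nb u.1.1.1 s = c := hc
        exact Finset.mem_image.2 ⟨(s, s'), Finset.mem_univ _, rfl⟩
      · rintro ⟨⟨⟨a, s⟩, c, s'⟩, e⟩ he
        obtain ⟨rfl, rfl, ha⟩ := (Finset.mem_filter.1 he).2
        obtain rfl : nb u.1.1.1 (!s') = a := ha
        exact Finset.mem_image.2 ⟨(s, s'), Finset.mem_univ _, rfl⟩
    · simp [if_neg hu]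
  · have : x = 1 := by
      split_ifs at hx <;> simp at hx <;> exact hx
    omega
  · simp only [hrecv, twoWords]
    have hp := h.nextDart_eq_iff u.1.1 u.1.2
    have hq : h.perm u.1.1 = u.1.2 ↔ nextDart nb u.1.1 = u.1.2 := Iff.rfl
    simp only [permBit, hq, hp]
    by_cases h₁ : u.2 = (c₀, c₀) <;> by_cases h₂ : nb u.1.1.1 u.1.1.2 = u.1.2.1 <;>
      by_cases h₃ : nb u.1.2.1 (!u.1.2.2) = u.1.1.1 <;> simp [h₁, h₂, h₃]

/-- From the records of the edges, compute the matrices of the next-dart permutation and of the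
identity. -/
noncomputable def initProg (c₀ : Fin d → Fin b) :
    List (NetStep (((Fin M × Bool) × (Fin M × Bool)) × (Fin d → Fin b) × (Fin d → Fin b))) :=
  gatherProg c₀ ++ (announceProg c₀ ++
    (allReduceProg (splitMiddle ((Fin M × Bool) × (Fin M × Bool)) (Fin d → Fin b)) d ++
    (allReduceProg (splitLast ((Fin M × Bool) × (Fin M × Bool)) (Fin d → Fin b)) d ++
    localProg fun u m => [m.getD 1 0, permBit 1 u.1])))

theorem initProg_length : (initProg (M := M) c₀).length = 4 * d + 5 := by
  simp only [initProg, List.length_append, allReduceProg_length, gatherProg, announceProg,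
    exchangeProg, localProg, List.length_cons, List.length_nil]
  ring

open scoped Classical in
-- Only the machines with both coordinates `c₀` carry a nonzero word, so summing over the
-- coordinates broadcasts it. The last step moves it to the first word and adds the entry of the
-- identity, which needs no communication.
theorem trace_init (hG : ∀ v, (Finset.univ.filter (G.Adj v)).card = 2)
    {D : ((Fin M × Bool) × (Fin M × Bool)) × (Fin d → Fin b) × (Fin d → Fin b) →
      List (Fin M × Fin M)}
    (hD : ∑ u, (D u : Multiset (Fin M × Fin M)) = (edgeRecords G).val)
    (hDS : ∀ u, ((D u).flatMap pairWords).length ≤ S) (hS : 8 ≤ S) (hM : M ≤ W) (hW : 2 ≤ W)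
    (hb : b ≤ S) :
    Trace S W (initProg c₀) (quiet fun u => (D u).flatMap pairWords)
      (quiet (twoWords (fun u => permBit (isTwoRegular_nbrOf hG).perm u.1)
        fun u => permBit 1 u.1)) := by
  have hbit : ∀ (ρ : Equiv.Perm (Fin M × Bool)) h, permBit ρ h < W := fun ρ h =>
    (permBit_le ρ h).trans_lt (by omega)
  refine (trace_gather hG hD hDS (by omega) hM).append
    ((trace_announce (isTwoRegular_nbrOf hG) hS hM hW).append ?_)
  set π := (isTwoRegular_nbrOf hG).perm
  have h₁ := trace_allReduce (S := S) (W := W)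
    (splitMiddle ((Fin M × Bool) × (Fin M × Bool)) (Fin d → Fin b)) (p := fun _ => 0)
    (v := fun u => if u.2 = (c₀, c₀) then permBit π u.1 else 0) (by omega) hb (fun _ => by omega)
  have e₁ : ∀ u, ∑ c, (fun u : ((Fin M × Bool) × (Fin M × Bool)) × (Fin d → Fin b) ×
      (Fin d → Fin b) => if u.2 = (c₀, c₀) then permBit π u.1 else 0)
      ((splitMiddle _ (Fin d → Fin b)).symm ((splitMiddle _ (Fin d → Fin b) u).1, c)) =
      if u.2.2 = c₀ then permBit π u.1 else 0 := by
    intro u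
    by_cases hu : u.2.2 = c₀ <;> simp [splitMiddle, hu, Prod.ext_iff]
  simp only [e₁] at h₁
  have h₂ := trace_allReduce (S := S) (W := W)
    (splitLast ((Fin M × Bool) × (Fin M × Bool)) (Fin d → Fin b)) (p := fun _ => 0)
    (v := fun u => if u.2.2 = c₀ then permBit π u.1 else 0) (by omega) hb (fun _ => by omega)
  have e₂ : ∀ u, ∑ c, (fun u : ((Fin M × Bool) × (Fin M × Bool)) × (Fin d → Fin b) ×
      (Fin d → Fin b) => if u.2.2 = c₀ then permBit π u.1 else 0)
      ((splitLast _ (Fin d → Fin b)).symm ((splitLast _ (Fin d → Fin b) u).1, c)) =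
      permBit π u.1 := by
    intro u
    exact (Finset.sum_eq_single c₀ (fun c _ hc => if_neg hc)
      fun h => absurd (Finset.mem_univ _) h).trans (if_pos rfl)
  simp only [e₂] at h₂
  refine (h₁ fun u => ?_).append ((h₂ fun u => hbit π _).append
    (trace_local (bounded_twoWords (by omega) (fun u => hbit π _) fun u => hbit 1 _) fun u => rfl))
  split_ifs
  · exact hbit π _
  · omega

end initialization

/-! ### Solving the 1-vs-2-cycle problem -/

section reduction

open scoped Classical in
theorem sum_filter_toList {α β : Type} [Fintype β] (s : Finset α) (f : α → β) :
    ∑ u, (((s.filter fun a => f a = u).toList : List α) : Multiset α) = s.val := by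
  ext a
  simp only [Finset.coe_toList, Multiset.count_sum', Finset.filter_val, Multiset.count_filter]
  rw [Finset.sum_ite_eq]
  simp

theorem exists_equiv_apply_eq_zero {U : Type} [Fintype U] (u₀ : U) :
    ∃ e : U ≃ Fin (Fintype.card U), (e u₀).val = 0 := by
  classical
  have hpos : 0 < Fintype.card U := Fintype.card_pos_iff.2 ⟨u₀⟩
  refine ⟨(Fintype.equivFin U).trans (Equiv.swap (Fintype.equivFin U u₀) ⟨0, hpos⟩), ?_⟩
  simp

open scoped Classical in
-- Each edge goes to the machine of its smaller end, which gets at most two records, that is, four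
-- words.
theorem exists_placement {M b d S : ℕ} (c₀ : Fin d → Fin b) {G : SimpleGraph (Fin M)}
    (hG : ∀ v, (Finset.univ.filter (G.Adj v)).card = 2) (hS : 4 ≤ S) :
    ∃ D : ((Fin M × Bool) × (Fin M × Bool)) × (Fin d → Fin b) × (Fin d → Fin b) →
      List (Fin M × Fin M), ∑ u, (D u : Multiset (Fin M × Fin M)) = (edgeRecords G).val ∧
      ∀ u, ((D u).flatMap pairWords).length ≤ S := by
  refine ⟨_, sum_filter_toList (edgeRecords G) fun e => vertexMachine c₀ e.1, fun u => ?_⟩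
  have h : ((edgeRecords G).filter fun e => vertexMachine c₀ e.1 = u).card ≤ 2 := by
    rw [← hG u.1.1.1]
    refine Finset.card_le_card_of_injOn Prod.snd (fun e he => ?_) fun e he e' he' heq => ?_
    · obtain ⟨h₁, rfl⟩ := Finset.mem_filter.1 (Finset.mem_coe.1 he)
      exact Finset.mem_coe.2 (Finset.mem_filter.2 ⟨Finset.mem_univ _, (mem_edgeRecords.1 h₁).2⟩)
    · obtain ⟨-, h₁⟩ := Finset.mem_filter.1 (Finset.mem_coe.1 he)
      obtain ⟨-, h₂⟩ := Finset.mem_filter.1 (Finset.mem_coe.1 he')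
      exact Prod.ext (congrArg (fun u => u.1.1.1) (h₁.trans h₂.symm)) heq
  have h₂ : ∀ l : List (Fin M × Fin M), (l.flatMap pairWords).length = 2 * l.length := by
    intro l; simp [List.length_flatMap, pairWords, mul_comm]
  rw [h₂, Finset.length_toList]
  refine (Nat.mul_le_mul_left 2 ((le_of_eq ?_).trans h)).trans hS
  congr!

variable {Q E : Type} {N n k b d S W : ℕ} {ε : ℝ} {A : MPCAlgorithm}
  {D : Fin A.machines → List (Fin n × Fin n)} {place : Fin A.machines → Fin d → Fin b}
  {slot : ((Fin (2 * N) × Bool) × (Fin (2 * N) × Bool)) × (Fin n × Fin n) → Fin d → Fin b}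
  {tab : (Fin d → Fin b) →
    ((((Fin (2 * N) × Bool) ⊕ Q) × Fin (4 * k + 2)) ⊕ E ≃ Fin n) × A.Seed}

/-- Deciding the 1-vs-2-cycle problem by repeated squaring of the next-dart permutation. -/
theorem PowerSetup.exists_algorithm [Nonempty (Fin (2 * N) × Bool)]
    (hs : PowerSetup A D place slot tab S W ε) (hN : 3 ≤ N) (hk : 2 ≤ k) (c₀ : Fin d → Fin b)
    (hS : 8 ≤ S) (hW : 2 * N ≤ W) :
    ∃ B : MPCAlgorithm, B.machines = (4 * N) ^ 2 * (b ^ d) ^ 2 ∧ B.space = S ∧ B.wordBound = W ∧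
      B.exchanges ≤ 4 * d + 5 + (Nat.log k N + 1) * (A.rounds + 4 * d + 4) ∧
      B.SolvesOneVsTwoCycle N := by
  classical
  obtain ⟨l, hl, hlen⟩ := exists_digits hk N
  let x₀ : Fin (2 * N) × Bool := (⟨0, by omega⟩, false)
  obtain ⟨e, he⟩ := exists_equiv_apply_eq_zero
    (U := ((Fin (2 * N) × Bool) × (Fin (2 * N) × Bool)) × (Fin d → Fin b) × (Fin d → Fin b))
    ((x₀, x₀), c₀, c₀)
  have hW3 := hs.three_le
  -- The entry `(x₀, x₀)` of `π ^ N` is 1 iff the cycle length `m` divides `N`; the output is its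
  -- complement, 1 for `m = 2 * N` and 0 for `m = N`.
  have main : ∀ (G : SimpleGraph (Fin (2 * N))) (m : ℕ) (ans : List ℕ), 3 ≤ m →
      (∀ v, OnCycle G m v) → ans = [if m ∣ N then 0 else 1] →
      (compileNet e S W (initProg c₀ ++ digitsProg A D place slot tab l)
        (fun u w => if u = ((x₀, x₀), c₀, c₀) then [1 - w.getD 1 0] else [])).SucceedsWHP N
        (edgeRecords G).val pairWords fun o => ∃ i, i.val = 0 ∧ o i = ans := by
    intro G m ans hm hcyc hans
    have hG : ∀ v, (Finset.univ.filter (G.Adj v)).card = 2 := fun v => (hcyc v).card_eq_two hm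
    refine compileNet_succeeds e S W _ _ N (edgeRecords G).val pairWords ((x₀, x₀), c₀, c₀) he ans
      (exists_placement c₀ hG (by omega)) ?_ ?_
    · intro a _ x hx
      simp only [pairWords, List.mem_cons, List.not_mem_nil, or_false] at hx
      rcases hx with rfl | rfl <;> exact (Fin.isLt _).trans_le hW
    · intro D' hD' hDS'
      refine ⟨_, (trace_init hG hD' hDS' hS hW (by omega) hs.base_le).append
        (hs.trace_digits _ l), fun u => ?_, ?_⟩
      · split_ifs
        · simp only [List.length_cons, List.length_nil, List.mem_singleton, forall_eq]
          omega
        · simp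
      · rw [if_pos rfl, hl, hans]
        have := (isTwoRegular_nbrOf hG).perm_pow_eq_iff (adj_iff_nbrOf hG) hm x₀ (hcyc _) N
        simp only [twoWords, List.getD_cons_succ, List.getD_cons_zero, permBit, this]
        split_ifs <;> rfl
  refine ⟨compileNet e S W (initProg c₀ ++ digitsProg A D place slot tab l)
    (fun u w => if u = ((x₀, x₀), c₀, c₀) then [1 - w.getD 1 0] else []),
    ?_, rfl, rfl, ?_, fun G => ⟨fun h => ?_, fun h => ?_⟩⟩
  rotate_left 2
  · exact main G (2 * N) [1] (by omega) (fun v => h.onCycle (by omega) v) (by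
      rw [if_neg]
      intro hd
      have := Nat.le_of_dvd (by omega) hd
      omega)
  · exact main G N [0] hN (fun v => h.onCycle hN v) (by rw [if_pos dvd_rfl])
  · change Fintype.card _ = _
    simp only [Fintype.card_prod, Fintype.card_fin, Fintype.card_bool, Fintype.card_pi,
      Finset.prod_const, Finset.card_univ]
    ring
  · change (initProg c₀ ++ digitsProg A D place slot tab l).length ≤ _
    rw [List.length_append, initProg_length, digitsProg_length]
    gcongr

end reduction

/-! ### The reduction under numerical hypotheses -/

section parameters

/-- A record takes three words for every metric, so a placement that fits one metric fits all of
them. -/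
theorem MPCAlgorithm.SolvesMST.exists_records {A : MPCAlgorithm} {n : ℕ} {ε : ℝ}
    (hA : A.SolvesMST n ε) : ∃ D : Fin A.machines → List (Fin n × Fin n),
      ∑ i, (D i : Multiset (Fin n × Fin n)) = (vertexPairs n).val ∧
      ∀ i, 3 * (D i).length ≤ A.space := by
  have hw : IsOneTwoMetric fun u v : Fin n => if u = v then 0 else 1 := by
    refine ⟨⟨fun u v => by simp, fun u v => by simp [eq_comm], fun u v x => ?_⟩,
      fun u v h => by simp [h]⟩
    by_cases h₁ : u = v <;> by_cases h₂ : v = x <;> simp_all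
    split_ifs <;> omega
  obtain ⟨D, hD, hDS⟩ := (hA _ hw).1
  refine ⟨D, hD, fun i => ?_⟩
  simpa [List.length_flatMap, weightWords, mul_comm] using hDS i

/-- Positive local space is needed to bound the number of machines by the total space. -/
theorem one_le_space {A : MPCAlgorithm} {n : ℕ} (hn : 2 ≤ n)
    {D : Fin A.machines → List (Fin n × Fin n)}
    (hD : ∑ i, (D i : Multiset (Fin n × Fin n)) = (vertexPairs n).val)
    (hDS : ∀ i, 3 * (D i).length ≤ A.space) : 1 ≤ A.space := by
  have h : ((⟨0, by omega⟩, ⟨1, by omega⟩) : Fin n × Fin n) ∈ (vertexPairs n).val := by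
    simp [vertexPairs]
  rw [← hD, Multiset.mem_sum] at h
  obtain ⟨i, -, hi⟩ := h
  have := List.length_pos_of_mem (Multiset.mem_coe.1 hi)
  have := hDS i
  omega

/-- The reduction, for parameters with the necessary numerical relations. -/
theorem exists_cycle_algorithm {A : MPCAlgorithm} {n N k b d q r S W : ℕ} {ε : ℝ}
    (hA : A.SolvesMST n ε) (hn : 2 ≤ n) (hε : 0 ≤ ε) (hN : 3 ≤ N) (hk : 2 ≤ k)
    (hcard : (4 * N + q) * (4 * k + 2) + r = n)
    (hZ : 32 * (4 * k + 2 : ℕ) * (2 * ε * n + 2) ≤ ((4 * N + q : ℕ) : ℝ) - 1)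
    (hκ : 32 * (N : ℝ) ^ 2 + k + 8 * N < 1 / (8 * (4 * k + 2 : ℕ)) * (b ^ d : ℕ) / 2)
    (hplace : A.machines ≤ b ^ d) (hslot : (4 * N) ^ 2 * n ^ 2 ≤ b ^ d)
    (hspace : A.space + 1 ≤ S) (hS : 8 ≤ S) (hnW : n ≤ W) (hAW : A.wordBound ≤ W) (hb : b ≤ S)
    (hbW : b ^ d < W) (hNW : 2 * N ≤ W) (hW : 3 ≤ W) :
    ∃ B : MPCAlgorithm, B.machines = (4 * N) ^ 2 * (b ^ d) ^ 2 ∧ B.space = S ∧ B.wordBound = W ∧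
      B.exchanges ≤ 4 * d + 5 + (Nat.log k N + 1) * (A.rounds + 4 * d + 4) ∧
      B.SolvesOneVsTwoCycle N := by
  classical
  obtain ⟨D, hD, hDS⟩ := hA.exists_records
  have : Nonempty (Fin (2 * N) × Bool) := ⟨⟨0, by omega⟩, false⟩
  obtain ⟨place, hplace'⟩ : ∃ f : Fin A.machines → Fin d → Fin b, Function.Injective f := by
    obtain ⟨f⟩ := Function.Embedding.nonempty_of_card_le
      (α := Fin A.machines) (β := Fin d → Fin b) (by simpa using hplace)
    exact ⟨f, f.injective⟩
  obtain ⟨slot, hslot'⟩ : ∃ f : ((Fin (2 * N) × Bool) × (Fin (2 * N) × Bool)) × (Fin n × Fin n) →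
      Fin d → Fin b, Function.Injective f := by
    obtain ⟨f⟩ := Function.Embedding.nonempty_of_card_le
      (α := ((Fin (2 * N) × Bool) × (Fin (2 * N) × Bool)) × (Fin n × Fin n))
      (β := Fin d → Fin b) (by
        simp only [Fintype.card_prod, Fintype.card_fin, Fintype.card_bool, Fintype.card_pi,
          Finset.prod_const, Finset.card_univ]
        refine le_of_eq_of_le ?_ hslot
        ring)
    exact ⟨f, f.injective⟩
  have c₀ : Fin d → Fin b := slot ((this.some, this.some), (⟨0, by omega⟩, ⟨0, by omega⟩))
  have hΔ : Fintype.card (Fin (2 * N) × Bool) = 4 * N := by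
    simp only [Fintype.card_prod, Fintype.card_fin, Fintype.card_bool]; ring
  have hC : Fintype.card (Fin d → Fin b) = b ^ d := by simp
  let e₀ : ((((Fin (2 * N) × Bool) ⊕ Fin q) × Fin (4 * k + 2)) ⊕ Fin r) ≃ Fin n :=
    Fintype.equivOfCardEq (by
      rw [Fintype.card_sum, Fintype.card_prod, Fintype.card_sum, hΔ]
      simpa using hcard)
  obtain ⟨tab, htab⟩ := exists_table (κ := Fin d → Fin b) (k := k) (by omega) hn hε hA hD hDS e₀
    (by rw [Fintype.card_sum, hΔ, Fintype.card_fin]; exact hZ)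
    (by
      rw [hC, hΔ, Fintype.card_perm, hΔ]
      refine lt_of_le_of_lt ?_ (Real.exp_lt_exp.2 hκ)
      -- From `(4N)! ≤ (4N) ^ (4N)` and `4N ≤ exp (4N)`. The pairs of permutations thus contribute
      -- `32 N²` to the exponent in `hκ`.
      have h₁ : ((4 * N).factorial : ℝ) ≤ Real.exp (16 * (N : ℝ) ^ 2) := by
        have h₂ : ((4 * N).factorial : ℝ) ≤ ((4 * N : ℕ) : ℝ) ^ (4 * N) := by
          exact_mod_cast Nat.factorial_le_pow _
        refine h₂.trans ((pow_le_pow_left₀ (by positivity)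
          ((le_add_of_nonneg_right zero_le_one).trans (Real.add_one_le_exp _)) _).trans_eq ?_)
        rw [← Real.exp_nat_mul]
        push_cast
        ring_nf
      have h₂ : (k : ℝ) ≤ Real.exp k :=
        (le_add_of_nonneg_right zero_le_one).trans (Real.add_one_le_exp _)
      have h₃ : ((4 * N : ℕ) : ℝ) ≤ Real.exp (4 * N : ℕ) :=
        (le_add_of_nonneg_right zero_le_one).trans (Real.add_one_le_exp _)
      calc ((4 * N).factorial : ℝ) ^ 2 * k * ((4 * N : ℕ) : ℝ) ^ 2
          ≤ Real.exp (16 * (N : ℝ) ^ 2) ^ 2 * Real.exp k * Real.exp (4 * N : ℕ) ^ 2 := by gcongr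
        _ = Real.exp (32 * (N : ℝ) ^ 2 + k + 8 * N) := by
          rw [← Real.exp_nat_mul, ← Real.exp_nat_mul, ← Real.exp_add, ← Real.exp_add]
          push_cast
          ring_nf)
  have hs : PowerSetup A D place slot tab S W ε :=
    { place_inj := hplace'
      slot_inj := hslot'
      sum_eq := hD
      records_le := hDS
      space_lt := hspace
      two_le := by omega
      le_word := hnW
      word_le := hAW
      base_le := hb
      pow_lt := hbW
      three_le := hW
      solves := hA
      table := by convert htab }
  exact hs.exists_algorithm hN hk c₀ hS hNW

end parameters

/-! ### Choice of the radix and asymptotic estimates -/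

section asymptotics

/-- The radix is `⌊(1/ε) ^ γ⌋`. If `y = (1/ε) ^ (γ/2) ≥ 2`, then `⌊y²⌋ ≥ y`, which gives the
logarithmic bound. Also `k² ≤ (1/ε) ^ (1/2)`, and `1/ε ≥ 10 ^ 8` makes this at most `(1/ε) / 10 ^
4`. -/
theorem exists_radix {γ : ℝ} (hγ : 0 < γ) (hγ' : γ ≤ 1 / 16) :
    ∃ ε₀ : ℝ, 0 < ε₀ ∧ ε₀ < 1 ∧ ∀ ε : ℝ, 0 < ε → ε ≤ ε₀ → ∃ k : ℕ, 2 ≤ k ∧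
      (k : ℝ) ≤ (1 / ε) ^ γ ∧ (k : ℝ) ^ 2 * ε ≤ 1 / 4620 ∧
      γ / 2 * Real.log (1 / ε) ≤ Real.log k := by
  refine ⟨min (1 / 10 ^ 8) ((2 : ℝ) ^ (-(2 / γ))), by positivity,
    (min_le_left _ _).trans_lt (by norm_num), fun ε hε hle => ?_⟩
  have h₁ : ε ≤ 1 / 10 ^ 8 := hle.trans (min_le_left _ _)
  have h₂ : ε ≤ (2 : ℝ) ^ (-(2 / γ)) := hle.trans (min_le_right _ _)
  set x := 1 / ε with hx
  have hx₀ : 0 < x := by positivity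
  have hx₁ : (10 : ℝ) ^ 8 ≤ x := by
    rw [hx, le_div_iff₀ hε]
    linarith
  have hx₂ : (2 : ℝ) ^ (2 / γ) ≤ x := by
    rw [hx, le_div_iff₀ hε]
    have := mul_le_mul_of_nonneg_left h₂ (by positivity : (0 : ℝ) ≤ (2 : ℝ) ^ (2 / γ))
    rwa [← Real.rpow_add two_pos, add_neg_cancel, Real.rpow_zero] at this
  set y := x ^ (γ / 2) with hy
  have hy₂ : 2 ≤ y := by
    have := Real.rpow_le_rpow (by positivity) hx₂ (by positivity : 0 ≤ γ / 2)
    rw [← Real.rpow_mul two_pos.le, show 2 / γ * (γ / 2) = 1 by field_simp, Real.rpow_one] at this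
    exact this
  have hyx : x ^ γ = y ^ 2 := by
    rw [hy, ← Real.rpow_natCast, ← Real.rpow_mul hx₀.le]
    norm_num
  have hk₁ : ((⌊x ^ γ⌋₊ : ℕ) : ℝ) ≤ x ^ γ := Nat.floor_le (by positivity)
  have hk₂ : y ≤ (⌊x ^ γ⌋₊ : ℕ) := by
    have := (Nat.lt_floor_add_one (x ^ γ)).le
    nlinarith
  refine ⟨⌊x ^ γ⌋₊, by exact_mod_cast hy₂.trans hk₂, hk₁, ?_, ?_⟩
  · have h₃ : ((⌊x ^ γ⌋₊ : ℕ) : ℝ) ^ 2 ≤ x ^ (1 / 2 : ℝ) := by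
      refine (pow_le_pow_left₀ (by positivity) hk₁ 2).trans ?_
      rw [← Real.rpow_natCast, ← Real.rpow_mul hx₀.le]
      refine Real.rpow_le_rpow_of_exponent_le (by linarith) ?_
      push_cast
      linarith
    have h₄ : x ^ (1 / 2 : ℝ) * (10 : ℝ) ^ 4 ≤ x := by
      rw [← Real.sqrt_eq_rpow]
      have : (10 : ℝ) ^ 4 ≤ √x := Real.le_sqrt_of_sq_le (by norm_num; linarith)
      nlinarith [Real.mul_self_sqrt hx₀.le, Real.sqrt_nonneg x]
    have h₅ : x * ε = 1 := by rw [hx]; field_simp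
    nlinarith
  · rw [← Real.log_rpow hx₀]
    exact Real.log_le_log (by positivity) hk₂

/-- A block count for layered graphs on `n` vertices. -/
theorem exists_block_count {n N k : ℕ} {ε : ℝ} (hk : 2 ≤ k) (hε : 1 ≤ ε * n)
    (hkε : (k : ℝ) ^ 2 * ε ≤ 1 / 4620) (hN : 4 * N * (4 * k + 2) ≤ n) :
    ∃ q r : ℕ, (4 * N + q) * (4 * k + 2) + r = n ∧
      32 * (4 * k + 2 : ℕ) * (2 * ε * n + 2) ≤ ((4 * N + q : ℕ) : ℝ) - 1 := by
  have h₁ : 4 * N ≤ n / (4 * k + 2) := (Nat.le_div_iff_mul_le (by omega)).2 hN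
  refine ⟨n / (4 * k + 2) - 4 * N, n % (4 * k + 2), ?_, ?_⟩
  · rw [Nat.add_sub_cancel' h₁, mul_comm, Nat.div_add_mod]
  · rw [Nat.add_sub_cancel' h₁]
    have h₂ : (n : ℝ) ≤ ((n / (4 * k + 2) : ℕ) + 1) * (4 * k + 2 : ℕ) := by
      exact_mod_cast (Nat.lt_mul_of_div_lt (Nat.lt_succ_self _) (by omega)).le
    generalize n / (4 * k + 2) = z at *
    have hk' : (2 : ℝ) ≤ k := by exact_mod_cast hk
    have hm : (0 : ℝ) < (4 * k + 2 : ℕ) := by positivity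
    have hm' : ((4 * k + 2 : ℕ) : ℝ) ≤ 6 * k := by push_cast; linarith
    generalize ((4 * k + 2 : ℕ) : ℝ) = m at *
    -- From `m ≤ 6k` and `1 ≤ εn`, the left side is at most `(32 * 36 * 4 + 12) k² εn`; this is the
    -- source of 4620.
    have h₃ : (32 * m * (2 * ε * n + 2) + 2) * m ≤ (z + 1) * m := by
      refine le_trans ?_ h₂
      have e₁ : m ^ 2 ≤ 36 * (k : ℝ) ^ 2 := by nlinarith
      have e₂ : (k : ℝ) ≤ (k : ℝ) ^ 2 * (ε * n) := by nlinarith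
      have e₃ : (k : ℝ) ^ 2 * (ε * n) ≤ 1 / 4620 * n := by
        rw [← mul_assoc]
        exact mul_le_mul_of_nonneg_right hkε (Nat.cast_nonneg n)
      calc (32 * m * (2 * ε * n + 2) + 2) * m = 32 * m ^ 2 * (2 * (ε * n) + 2) + 2 * m := by ring
        _ ≤ 32 * (36 * (k : ℝ) ^ 2) * (2 * (ε * n) + 2 * (ε * n)) + 2 * (6 * k) := by gcongr; linarith
        _ ≤ 4608 * ((k : ℝ) ^ 2 * (ε * n)) + 12 * ((k : ℝ) ^ 2 * (ε * n)) := by linarith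
        _ ≤ n := by linarith
    have := le_of_mul_le_mul_right h₃ hm
    linarith

theorem eventually_add_le_rpow {a b : ℝ} (ha : 0 ≤ a) (hab : a < b) (c : ℝ) :
    ∀ᶠ n : ℕ in atTop, (n : ℝ) ^ a + c ≤ (n : ℝ) ^ b := by
  have h₁ := (tendsto_rpow_atTop (sub_pos.2 hab)).comp (tendsto_natCast_atTop_atTop (R := ℝ))
  filter_upwards [h₁.eventually_ge_atTop (1 + |c|), eventually_ge_atTop 1] with n hn hn'
  have hn'' : (1 : ℝ) ≤ n := by exact_mod_cast hn'
  have h₂ : (1 : ℝ) ≤ (n : ℝ) ^ a := Real.one_le_rpow hn'' ha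
  have h₃ : (n : ℝ) ^ b = (n : ℝ) ^ a * (n : ℝ) ^ (b - a) := by
    rw [← Real.rpow_add (by linarith)]
    congr 1; ring
  rw [h₃]
  have := le_abs_self c
  have := abs_nonneg c
  simp only [Function.comp] at hn
  nlinarith

/-- The resources are monotone in the exponent of the space. -/
theorem MPCAlgorithm.HasResources.mono {A : MPCAlgorithm} {δ δ' : ℝ} {C n : ℕ}
    (h : A.HasResources δ C n) (hδ : δ ≤ δ') (hn : 1 ≤ n) : A.HasResources δ' C n :=
  ⟨h.1.trans (Real.rpow_le_rpow_of_exponent_le (by exact_mod_cast hn) hδ), h.2⟩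

end asymptotics

section reduction

/-- Since `k ≤ N`, the number of phases is at most `2 log N / log k`, and `log k` is at least `γ/2 *
log (1/ε)`. -/
theorem rounds_mul_log_le {N k d R R' : ℕ} {γ ε : ℝ} (hγ₀ : 0 < γ) (hk₂ : 2 ≤ k) (hkN : k ≤ N)
    (hε : 0 < ε) (hε' : ε ≤ 1) (hklog : γ / 2 * Real.log (1 / ε) ≤ Real.log k) (hR : 1 ≤ R)
    (hR' : R' ≤ 4 * d + 6 + (Nat.log k N + 1) * (R + 4 * d + 4)) :
    (R' : ℝ) * Real.log (1 / ε) ≤ (8 * d + 11) * (4 / γ) * R * Real.log N := by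
  have hlogk : 0 < Real.log k := Real.log_pos (by exact_mod_cast (by omega : 1 < k))
  have hkpos : (0 : ℝ) < k := by exact_mod_cast (by omega : 0 < k)
  have h₁ : (Nat.log k N : ℝ) * Real.log k ≤ Real.log N := by
    rw [← Real.log_pow]
    refine Real.log_le_log (by positivity) ?_
    exact_mod_cast Nat.pow_log_le_self k (by omega)
  have h₂ : Real.log k ≤ Real.log N := Real.log_le_log hkpos (by exact_mod_cast hkN)
  have h₃ : ((Nat.log k N : ℝ) + 1) * Real.log (1 / ε) ≤ 4 / γ * Real.log N := by
    have h₄ : Real.log (1 / ε) ≤ 2 / γ * Real.log k := by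
      rw [div_mul_eq_mul_div, le_div_iff₀ hγ₀]
      linarith
    calc ((Nat.log k N : ℝ) + 1) * Real.log (1 / ε)
        ≤ ((Nat.log k N : ℝ) + 1) * (2 / γ * Real.log k) := by gcongr
      _ = 2 / γ * (Nat.log k N * Real.log k + Real.log k) := by ring
      _ ≤ 2 / γ * (Real.log N + Real.log N) := by gcongr
      _ = 4 / γ * Real.log N := by ring
  have h₅ : R' ≤ (8 * d + 11) * R * (Nat.log k N + 1) := by
    have h₆ : R + 4 * d + 4 ≤ (4 * d + 5) * R := by nlinarith
    have h₇ : 1 ≤ R * (Nat.log k N + 1) := Nat.mul_pos hR (Nat.succ_pos _)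
    calc R' ≤ (4 * d + 6) * 1 + (Nat.log k N + 1) * (R + 4 * d + 4) := by omega
      _ ≤ (4 * d + 6) * (R * (Nat.log k N + 1)) + (Nat.log k N + 1) * ((4 * d + 5) * R) :=
        Nat.add_le_add (Nat.mul_le_mul_left _ h₇) (Nat.mul_le_mul_left _ h₆)
      _ = (8 * d + 11) * R * (Nat.log k N + 1) := by ring
  have h₆ : (R' : ℝ) ≤ (8 * d + 11) * R * ((Nat.log k N : ℝ) + 1) := by
    exact_mod_cast h₅
  have hL : 0 ≤ Real.log (1 / ε) := Real.log_nonneg (by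
    rw [le_div_iff₀ hε]; linarith)
  calc (R' : ℝ) * Real.log (1 / ε)
      ≤ (8 * d + 11) * R * ((Nat.log k N : ℝ) + 1) * Real.log (1 / ε) := by gcongr
    _ = (8 * d + 11) * R * (((Nat.log k N : ℝ) + 1) * Real.log (1 / ε)) := by ring
    _ ≤ (8 * d + 11) * R * (4 / γ * Real.log N) := by gcongr
    _ = (8 * d + 11) * (4 / γ) * R * Real.log N := by ring

theorem copies_bound {n N k c : ℕ} (hnR : (256 : ℝ) ≤ n) (hkn : k ≤ n) (hNn : N ≤ n)
    (hc : n ^ 6 ≤ c) :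
    32 * (N : ℝ) ^ 2 + k + 8 * N < 1 / (8 * (4 * k + 2 : ℕ)) * (c : ℕ) / 2 := by
  have hNn' : (N : ℝ) ≤ n := by exact_mod_cast hNn
  have h₁ : (N : ℝ) ^ 2 ≤ (n : ℝ) ^ 2 := by gcongr
  have h₂ : (k : ℝ) ≤ n := by exact_mod_cast hkn
  have h₃ : (n : ℝ) ^ 6 ≤ (c : ℕ) := by exact_mod_cast hc
  have h₄ : ((4 * k + 2 : ℕ) : ℝ) ≤ 5 * n := by push_cast; linarith
  have h₅ : 32 * (N : ℝ) ^ 2 + k + 8 * N ≤ 33 * (n : ℝ) ^ 2 := by nlinarith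
  have h₆ : (0 : ℝ) < (4 * k + 2 : ℕ) := by positivity
  refine h₅.trans_lt ?_
  rw [show 1 / (8 * ((4 * k + 2 : ℕ) : ℝ)) * (c : ℕ) / 2 =
    (c : ℕ) / (16 * ((4 * k + 2 : ℕ) : ℝ)) by field_simp; ring, lt_div_iff₀ (by positivity)]
  refine lt_of_lt_of_le ?_ h₃
  calc 33 * (n : ℝ) ^ 2 * (16 * ((4 * k + 2 : ℕ) : ℝ)) ≤ 33 * (n : ℝ) ^ 2 * (16 * (5 * n)) := by
        gcongr
    _ = 2640 * (n : ℝ) ^ 3 := by ring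
    _ < 256 ^ 3 * (n : ℝ) ^ 3 := by
      have : (0 : ℝ) < (n : ℝ) ^ 3 := by positivity
      nlinarith
    _ ≤ (n : ℝ) ^ 3 * (n : ℝ) ^ 3 := by gcongr
    _ = (n : ℝ) ^ 6 := by ring

theorem total_space_le {S N : ℕ} (hSN : S ≤ N) (hN : 16 ≤ N) (d : ℕ) :
    (4 * N) ^ 2 * (S ^ d) ^ 2 * S ≤ N ^ (2 * d + 4) ∧ S ^ d + 1 ≤ N ^ (2 * d + 4) := by
  constructor
  · calc (4 * N) ^ 2 * (S ^ d) ^ 2 * S ≤ (4 * N) ^ 2 * (N ^ d) ^ 2 * N := by gcongr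
      _ = 16 * N ^ (2 * d + 3) := by ring
      _ ≤ N * N ^ (2 * d + 3) := by gcongr
      _ = N ^ (2 * d + 4) := by ring
  · calc S ^ d + 1 ≤ N ^ d + N ^ d := Nat.add_le_add (Nat.pow_le_pow_left hSN _)
          (Nat.one_le_pow _ _ (by omega))
      _ ≤ N * N ^ d := by
        have : 0 < N ^ d := Nat.pow_pos (by omega)
        nlinarith
      _ = N ^ (d + 1) := by ring
      _ ≤ N ^ (2 * d + 4) := Nat.pow_le_pow_right (by omega) (by omega)

theorem layers_le {n N k : ℕ} {γ η : ℝ} (hn1 : (1 : ℝ) ≤ n) (hk₂ : 2 ≤ k)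
    (hkn : (k : ℝ) ≤ (n : ℝ) ^ γ) (hN₂ : (N : ℝ) ≤ (n : ℝ) ^ (1 - η)) (hγη : 2 * γ ≤ η)
    (hn₂ : 24 ≤ (n : ℝ) ^ γ) : 4 * N * (4 * k + 2) ≤ n := by
  have hpow : ∀ a c : ℝ, a ≤ c → (n : ℝ) ^ a ≤ (n : ℝ) ^ c := fun a c h =>
    Real.rpow_le_rpow_of_exponent_le hn1 h
  have h₁ : (k : ℝ) * N ≤ (n : ℝ) ^ (1 - γ) := by
    refine (mul_le_mul hkn hN₂ (by positivity) (by positivity)).trans ?_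
    rw [← Real.rpow_add (by linarith)]
    exact hpow _ _ (by linarith)
  have h₂ : (n : ℝ) ^ (1 - γ) * (n : ℝ) ^ γ = n := by
    rw [← Real.rpow_add (by linarith), sub_add_cancel, Real.rpow_one]
  have h₃ : (n : ℝ) ^ (1 - γ) * 24 ≤ n := by
    conv_rhs => rw [← h₂]
    exact mul_le_mul_of_nonneg_left (by linarith) (by positivity)
  have h₄ : (4 * N * (4 * k + 2) : ℝ) ≤ n := by
    have : (2 : ℝ) ≤ k := by exact_mod_cast hk₂
    nlinarith
  exact_mod_cast h₄

/-- From an algorithm for approximate minimum spanning trees on `n` points, an algorithm for the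
1-vs-2-cycle problem on cycles of length `N`, where `N` is slightly smaller than `n`. -/
theorem exists_reduction (δ : ℝ) (C : ℕ) (hδ : 1 / 2 ≤ δ) (hδ' : δ < 1) :
    ∃ (δ' : ℝ) (C' : ℕ) (η ε₀ K : ℝ), δ' < 1 ∧ 0 < η ∧ η ≤ 1 / 8 ∧ 0 < ε₀ ∧ ε₀ < 1 ∧ 0 < K ∧
      ∀ᶠ n : ℕ in atTop, ∀ ε : ℝ, 1 / (n : ℝ) ≤ ε → ε ≤ ε₀ → ∀ N : ℕ,
        (n : ℝ) ^ (1 - 2 * η) ≤ N → (N : ℝ) ≤ (n : ℝ) ^ (1 - η) → ∀ A : MPCAlgorithm,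
        A.HasResources δ C n → A.SolvesMST n ε →
        ∃ B : MPCAlgorithm, B.HasResources δ' C' N ∧ B.SolvesOneVsTwoCycle N ∧
          (B.rounds : ℝ) * Real.log (1 / ε) ≤ K * A.rounds * Real.log N := by
  -- With these values `(1 - 2η) δ' = (1 + 3δ)/4`, which exceeds `δ`; so already for `N = n ^ (1 -
  -- 2η)` the space `N ^ δ'` has room for `n ^ δ` and a constant.
  obtain ⟨η, hη⟩ : ∃ x, x = (1 - δ) / 4 := ⟨_, rfl⟩
  obtain ⟨δ', hδ'_def⟩ : ∃ x, x = (1 + 3 * δ) / (2 * (1 + δ)) := ⟨_, rfl⟩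
  obtain ⟨γ, hγ⟩ : ∃ x, x = η / 2 := ⟨_, rfl⟩
  have hη₀ : 0 < η := by rw [hη]; linarith
  have hη₁ : η ≤ 1 / 8 := by rw [hη]; linarith
  have hδ₁ : δ' < 1 := by rw [hδ'_def, div_lt_one (by linarith)]; linarith
  have hδ₀ : 0 < δ' := by rw [hδ'_def]; positivity
  have hρ : (1 - 2 * η) * δ' = (1 + 3 * δ) / 4 := by
    rw [hη, hδ'_def]; field_simp; ring
  have hγ₀ : 0 < γ := by linarith
  obtain ⟨ε₀, hε₀, hε₁, hradix⟩ := exists_radix (γ := γ) (by linarith) (by linarith)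
  -- As `δ ≥ 1/2`, the space satisfies `S² ≥ n`. Hence `S ^ d ≥ n ^ (C + 6)`, enough for the `n ^ C`
  -- machines and for the slots and samples, which need `n ^ 6`.
  obtain ⟨d, hd⟩ : ∃ x, x = 2 * (C + 6) := ⟨_, rfl⟩
  refine ⟨δ', 2 * d + 4, η, ε₀, (8 * d + 11) * (4 / γ), hδ₁, hη₀, hη₁, hε₀, hε₁, by positivity, ?_⟩
  -- The constant 9 is 8 words of reserve plus 1 for the floor in `S`; with `n ^ 0 = 1`, the
  -- constant 23 gives `24 ≤ n ^ γ`.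
  filter_upwards [eventually_add_le_rpow (a := δ) (b := (1 + 3 * δ) / 4) (by linarith)
    (by linarith) 9, eventually_add_le_rpow le_rfl hγ₀ 23, eventually_ge_atTop 256]
    with n hn₁ hn₂ hn₃ ε hεn hε N hN₁ hN₂ A hres hA
  have hnR : (256 : ℝ) ≤ n := by exact_mod_cast hn₃
  have hn1 : (1 : ℝ) ≤ n := by linarith
  have hεpos : 0 < ε := lt_of_lt_of_le (by positivity) hεn
  have hεn' : 1 ≤ ε * n := by rwa [div_le_iff₀ (by linarith)] at hεn
  obtain ⟨k, hk₂, hkx, hkε, hklog⟩ := hradix ε hεpos hε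
  have hxn : 1 / ε ≤ n := by rw [div_le_iff₀ hεpos]; linarith
  have hkn : (k : ℝ) ≤ (n : ℝ) ^ γ := hkx.trans (Real.rpow_le_rpow (by positivity) hxn hγ₀.le)
  have hpow : ∀ a c : ℝ, a ≤ c → (n : ℝ) ^ a ≤ (n : ℝ) ^ c := fun a c h =>
    Real.rpow_le_rpow_of_exponent_le hn1 h
  have hkN : (k : ℝ) ≤ N := hkn.trans ((hpow _ _ (by linarith)).trans hN₁)
  have hsqrt : (16 : ℝ) ≤ (n : ℝ) ^ (1 / 2 : ℝ) := by
    rw [← Real.sqrt_eq_rpow]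
    exact Real.le_sqrt_of_sq_le (by norm_num; linarith)
  have hN16 : (16 : ℝ) ≤ N := hsqrt.trans ((hpow _ _ (by linarith)).trans hN₁)
  have hN16' : 16 ≤ N := by exact_mod_cast hN16
  have hNn : (N : ℝ) ≤ n := hN₂.trans ((hpow _ 1 (by linarith)).trans_eq (Real.rpow_one _))
  have hNn' : N ≤ n := by exact_mod_cast hNn
  have hkn' : k ≤ n := (by exact_mod_cast hkN : k ≤ N).trans hNn'
  rw [Real.rpow_zero] at hn₂
  have hlayers := layers_le hn1 hk₂ hkn hN₂ (by linarith) (by linarith)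
  obtain ⟨q, r, hqr, hZ⟩ := exists_block_count hk₂ hεn' hkε hlayers
  obtain ⟨S, hS⟩ : ∃ x, x = ⌊(N : ℝ) ^ δ'⌋₊ := ⟨_, rfl⟩
  have hSle : (S : ℝ) ≤ (N : ℝ) ^ δ' := by
    rw [hS]; exact Nat.floor_le (by positivity)
  have hSge : (n : ℝ) ^ δ + 8 ≤ S := by
    have h₁ : (n : ℝ) ^ ((1 + 3 * δ) / 4) ≤ (N : ℝ) ^ δ' := by
      rw [← hρ, Real.rpow_mul (by positivity)]
      exact Real.rpow_le_rpow (by positivity) hN₁ hδ₀.le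
    have := (Nat.lt_floor_add_one ((N : ℝ) ^ δ')).le
    rw [← hS] at this
    linarith
  have hspace : A.space + 8 ≤ S := by
    have := hres.1
    have h₁ : ((A.space + 8 : ℕ) : ℝ) ≤ S := by push_cast; linarith
    exact_mod_cast h₁
  have hSN : S ≤ N := by
    have : (N : ℝ) ^ δ' ≤ N := (Real.rpow_le_rpow_of_exponent_le (by linarith) hδ₁.le).trans_eq
      (Real.rpow_one _)
    exact_mod_cast hSle.trans this
  have hSn : n ≤ S ^ 2 := by
    have h₁ : (n : ℝ) ^ (1 / 2 : ℝ) ≤ S := (hpow _ _ hδ).trans (by linarith)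
    have h₂ : (n : ℝ) ≤ (S : ℝ) ^ 2 := by
      rw [← Real.sqrt_eq_rpow] at h₁
      exact (Real.sqrt_le_left (by positivity)).1 h₁
    exact_mod_cast h₂
  have hSd : n ^ (C + 6) ≤ S ^ d := by
    rw [hd, pow_mul]
    exact Nat.pow_le_pow_left hSn _
  have hnpos : 0 < n := by omega
  have hn6 : n ^ 6 ≤ S ^ d := (Nat.pow_le_pow_right hnpos (by omega)).trans hSd
  have hnC : n ^ C ≤ S ^ d := (Nat.pow_le_pow_right hnpos (by omega)).trans hSd
  have hnle : n ≤ S ^ d := (Nat.le_self_pow (by norm_num) n).trans hn6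
  obtain ⟨D, hD, hDS⟩ := hA.exists_records
  have hspace1 := one_le_space (by omega) hD hDS
  obtain ⟨B, hBm, hBs, hBw, hBx, hB⟩ := exists_cycle_algorithm (N := N) (k := k) (b := S) (d := d)
    (S := S) (W := S ^ d + 1) hA (by omega) hεpos.le (by omega) hk₂ hqr hZ (copies_bound hnR (by exact_mod_cast hkN.trans hNn) hNn' hn6)
    ((Nat.le_mul_of_pos_right _ hspace1).trans (hres.2.1.trans hnC))
    (by
      refine le_trans ?_ hn6
      calc (4 * N) ^ 2 * n ^ 2 ≤ (4 * n) ^ 2 * n ^ 2 := by gcongr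
        _ = 16 * n ^ 4 := by ring
        _ ≤ n ^ 2 * n ^ 4 := by gcongr; nlinarith
        _ = n ^ 6 := by ring)
    (by omega) (by omega) (by omega) (hres.2.2.trans (by omega)) le_rfl (by omega)
    (by
      have : n ^ 2 ≤ S ^ d := (Nat.pow_le_pow_right hnpos (by norm_num)).trans hn6
      nlinarith) (by omega)
  refine ⟨B, ⟨by rw [hBs]; exact hSle, ?_, ?_⟩, hB, ?_⟩
  · rw [hBm, hBs]
    exact (total_space_le hSN hN16' d).1
  · rw [hBw]
    exact (total_space_le hSN hN16' d).2
  · exact rounds_mul_log_le hγ₀ hk₂ (by exact_mod_cast hkN) hεpos (hε.trans hε₁.le) hklog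
      (Nat.le_add_left 1 _) (by
        have : B.rounds = B.exchanges + 1 := rfl
        omega)

end reduction

/-! ### The theorem -/

/-- The gap between the exponents `1 - 2η` and `1 - η` absorbs rounding, whether `n` is chosen from
`N` or `N` from `n`. -/
theorem eventually_rpow_le_half_rpow {η : ℝ} (hη : 0 < η) (hη' : η ≤ 1 / 8) :
    ∀ᶠ n : ℕ in atTop, (n : ℝ) ^ (1 - 2 * η) ≤ ((n : ℝ) - 1) ^ (1 - η) ∧
      (n : ℝ) ^ (1 - 2 * η) ≤ (n : ℝ) ^ (1 - η) - 1 := by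
  filter_upwards [eventually_add_le_rpow le_rfl hη 1,
    eventually_add_le_rpow (a := 1 - 2 * η) (b := 1 - η) (by linarith) (by linarith) 1,
    eventually_ge_atTop 2] with n hn hn' hn₂
  have hnR : (2 : ℝ) ≤ n := by exact_mod_cast hn₂
  refine ⟨?_, by linarith⟩
  rw [Real.rpow_zero] at hn
  have h₁ : ((n : ℝ) / 2) ^ (1 - η) ≤ ((n : ℝ) - 1) ^ (1 - η) :=
    Real.rpow_le_rpow (by positivity) (by linarith) (by linarith)
  refine le_trans ?_ h₁
  rw [Real.div_rpow (by positivity) zero_le_two, le_div_iff₀ (by positivity)]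
  have h₂ : (2 : ℝ) ^ (1 - η) ≤ 2 := (Real.rpow_le_rpow_of_exponent_le one_le_two
    (by linarith : 1 - η ≤ 1)).trans_eq (Real.rpow_one _)
  have h₃ : (n : ℝ) ^ (1 - η) = (n : ℝ) ^ (1 - 2 * η) * (n : ℝ) ^ η := by
    rw [← Real.rpow_add (by linarith)]
    congr 1; ring
  rw [h₃]
  exact mul_le_mul_of_nonneg_left (by linarith) (by positivity)

theorem theorem2 :
    (OneVsTwoCycleConjecture →
      ∀ (δ : ℝ) (C : ℕ), δ < 1 →
        ∀ ε : ℕ → ℝ, (∀ᶠ n : ℕ in atTop, 1 / (n : ℝ) ≤ ε n ∧ ε n ≤ 1) →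
          ¬ ∃ A : ℕ → MPCAlgorithm,
            (∀ᶠ n in atTop, (A n).HasResources δ C n ∧ (A n).SolvesMST n (ε n)) ∧
            (fun n => ((A n).rounds : ℝ)) =o[atTop] fun n : ℕ => Real.log (1 / ε n)) ∧
    (OneVsTwoCycleConjectureOmega →
      ∀ (δ : ℝ) (C : ℕ), δ < 1 →
        ∃ c : ℝ, 0 < c ∧ ∀ᶠ n : ℕ in atTop,
          ∀ ε : ℝ, 1 / (n : ℝ) ≤ ε → ε ≤ 1 → ∀ A : MPCAlgorithm,
            A.HasResources δ C n → A.SolvesMST n ε →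
              c * Real.log (1 / ε) ≤ A.rounds) := by
  constructor
  · rintro hconj δ C hδ ε hε ⟨A, hA, ho⟩
    obtain ⟨δ', C', η, ε₀, K, hδ', hη₀, hη₁, hε₀, hε₁, hK, hred⟩ :=
      exists_reduction (max δ (1 / 2)) C (le_max_right _ _) (max_lt hδ (by norm_num))
    have hL₀ : 0 < Real.log (1 / ε₀) := Real.log_pos (by rw [lt_div_iff₀ hε₀]; linarith)
    -- Here `N` is given and the number of points must be a function of it; rounding up ensures `N ≤
    -- n ^ (1 - η)`.
    let size : ℕ → ℕ := fun N => ⌈(N : ℝ) ^ (1 / (1 - η))⌉₊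
    have hsize : Tendsto size atTop atTop :=
      tendsto_nat_ceil_atTop.comp ((tendsto_rpow_atTop (by
        have : 0 < 1 - η := by linarith
        positivity)).comp tendsto_natCast_atTop_atTop)
    -- There is at least one round, so a round count in `o(log (1/ε))` forces `log (1/ε)` to
    -- infinity.
    have hsmall : ∀ᶠ n in atTop, ε n ≤ ε₀ := by
      filter_upwards [hε, ho.bound (c := 1 / Real.log (1 / ε₀)) (by positivity),
        eventually_ge_atTop 1] with n hn hn' hn₁
      have hpos : 0 < ε n := lt_of_lt_of_le (by
        have : (0 : ℝ) < n := by exact_mod_cast hn₁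
        positivity) hn.1
      have hlog : 0 ≤ Real.log (1 / ε n) := Real.log_nonneg (by
        rw [le_div_iff₀ hpos]; linarith)
      rw [Real.norm_of_nonneg (Nat.cast_nonneg _), Real.norm_of_nonneg hlog] at hn'
      have hR : (1 : ℝ) ≤ (A n).rounds := by exact_mod_cast Nat.le_add_left 1 (A n).exchanges
      have h₁ : Real.log (1 / ε₀) ≤ Real.log (1 / ε n) := by
        have := hR.trans hn'
        rwa [one_div_mul_eq_div, le_div_iff₀ hL₀, one_mul] at this
      have h₂ := (Real.log_le_log_iff (by positivity) (by positivity)).1 h₁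
      exact (one_div_le_one_div hε₀ hpos).1 h₂
    have hex : ∀ᶠ N : ℕ in atTop, ∃ B : MPCAlgorithm, B.HasResources δ' C' N ∧
        B.SolvesOneVsTwoCycle N ∧ (B.rounds : ℝ) * Real.log (1 / ε (size N)) ≤
          K * (A (size N)).rounds * Real.log N := by
      filter_upwards [hsize.eventually hred, hsize.eventually hε, hsize.eventually hA,
        hsize.eventually hsmall, hsize.eventually (eventually_rpow_le_half_rpow hη₀ hη₁),
        hsize.eventually (eventually_ge_atTop 1)] with N h₁ h₂ h₃ h₄ h₅ h₆
      have hsz : (N : ℝ) = ((N : ℝ) ^ (1 / (1 - η))) ^ (1 - η) := by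
        rw [← Real.rpow_mul (Nat.cast_nonneg N), one_div_mul_cancel (by linarith), Real.rpow_one]
      have h₇ : ((size N : ℕ) : ℝ) - 1 ≤ (N : ℝ) ^ (1 / (1 - η)) := by
        have := (Nat.ceil_lt_add_one (by positivity : 0 ≤ (N : ℝ) ^ (1 / (1 - η)))).le
        linarith
      have h₈ : (1 : ℝ) ≤ size N := by exact_mod_cast h₆
      refine h₁ (ε (size N)) h₂.1 h₄ N ?_ ?_ (A (size N)) (h₃.1.mono (le_max_left _ _) h₆) h₃.2
      · refine h₅.1.trans ?_
        rw [hsz]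
        exact Real.rpow_le_rpow (by linarith) h₇ (by linarith)
      · conv_lhs => rw [hsz]
        exact Real.rpow_le_rpow (by positivity) (Nat.le_ceil _) (by linarith)
    classical
    -- The default `A 0` is used for only finitely many `N`.
    refine hconj δ' C' hδ' ⟨fun N => if h : ∃ B : MPCAlgorithm, B.HasResources δ' C' N ∧
        B.SolvesOneVsTwoCycle N ∧ (B.rounds : ℝ) * Real.log (1 / ε (size N)) ≤
          K * (A (size N)).rounds * Real.log N then h.choose else A 0, ?_, ?_⟩
    · filter_upwards [hex] with N hN
      rw [dif_pos hN]
      exact ⟨hN.choose_spec.1, hN.choose_spec.2.1⟩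
    · refine IsLittleO.of_bound fun c hc => ?_
      filter_upwards [hex, hsize.eventually (ho.bound (c := c / K) (by positivity)),
        hsize.eventually hsmall, hsize.eventually hε, hsize.eventually (eventually_ge_atTop 1)]
        with N hN h₁ h₂ h₃ h₄
      rw [dif_pos hN]
      obtain ⟨-, -, h₅⟩ := hN.choose_spec
      generalize hN.choose = B at h₅
      have hpos : 0 < ε (size N) := lt_of_lt_of_le (by
        have : (0 : ℝ) < size N := by exact_mod_cast h₄
        positivity) h₃.1
      have hL : 0 < Real.log (1 / ε (size N)) :=
        hL₀.trans_le (Real.log_le_log (by positivity) (one_div_le_one_div_of_le hpos h₂))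
      have hN₀ : 0 ≤ Real.log N := Real.log_natCast_nonneg N
      rw [Real.norm_of_nonneg (Nat.cast_nonneg _), Real.norm_of_nonneg hL.le] at h₁
      rw [Real.norm_of_nonneg (Nat.cast_nonneg _), Real.norm_of_nonneg hN₀]
      refine le_of_mul_le_mul_right (h₅.trans ?_) hL
      calc K * (A (size N)).rounds * Real.log N
          ≤ K * (c / K * Real.log (1 / ε (size N))) * Real.log N := by gcongr
        _ = c * Real.log N * Real.log (1 / ε (size N)) := by field_simp
  · intro hconj δ C hδ
    obtain ⟨δ', C', η, ε₀, K, hδ', hη₀, hη₁, hε₀, hε₁, hK, hred⟩ :=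
      exists_reduction (max δ (1 / 2)) C (le_max_right _ _) (max_lt hδ (by norm_num))
    have hL₀ : 0 < Real.log (1 / ε₀) := Real.log_pos (by rw [lt_div_iff₀ hε₀]; linarith)
    obtain ⟨c, hc, hcyc⟩ := hconj δ' C' hδ'
    have hsize : Tendsto (fun n : ℕ => ⌊(n : ℝ) ^ (1 - η)⌋₊) atTop atTop :=
      tendsto_nat_floor_atTop.comp ((tendsto_rpow_atTop (by linarith)).comp
        tendsto_natCast_atTop_atTop)
    -- The value `c / K` comes from the reduction for `ε ≤ ε₀`; for larger `ε` the other value makes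
    -- the bound at most 1, and every algorithm has a round.
    refine ⟨min (c / K) (1 / Real.log (1 / ε₀)), by positivity, ?_⟩
    filter_upwards [hred, hsize.eventually hcyc, hsize.eventually (eventually_ge_atTop 2),
      eventually_rpow_le_half_rpow hη₀ hη₁, eventually_ge_atTop 1]
      with n h₁ h₂ h₃ h₄ h₅ ε hε hε' A hres hA
    have hpos : 0 < ε := lt_of_lt_of_le (by
      have : (0 : ℝ) < n := by exact_mod_cast h₅
      positivity) hε
    have hL : 0 ≤ Real.log (1 / ε) := Real.log_nonneg (by rw [le_div_iff₀ hpos]; linarith)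
    rcases le_or_gt ε ε₀ with hle | hgt
    · obtain ⟨B, hB, hB', hBr⟩ := h₁ ε hε hle ⌊(n : ℝ) ^ (1 - η)⌋₊
        (h₄.2.trans (by
          have := (Nat.lt_floor_add_one ((n : ℝ) ^ (1 - η))).le
          linarith)) (Nat.floor_le (by positivity)) A (hres.mono (le_max_left _ _) h₅) hA
      have hlog : 0 < Real.log (⌊(n : ℝ) ^ (1 - η)⌋₊ : ℕ) :=
        Real.log_pos (by exact_mod_cast h₃)
      refine (mul_le_mul_of_nonneg_right (min_le_left _ _) hL).trans ?_
      have h₆ := mul_le_mul_of_nonneg_right (h₂ B hB hB') hL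
      have h₇ : c * Real.log (1 / ε) ≤ K * A.rounds := by
        refine le_of_mul_le_mul_right (le_trans (le_of_eq ?_) (h₆.trans hBr)) hlog
        ring
      rw [div_mul_eq_mul_div, div_le_iff₀ hK]
      linarith
    · refine (mul_le_mul_of_nonneg_right (min_le_right _ _) hL).trans ?_
      have hR : (1 : ℝ) ≤ A.rounds := by exact_mod_cast Nat.le_add_left 1 A.exchanges
      refine le_trans ?_ hR
      rw [one_div_mul_eq_div, div_le_one hL₀]
      exact Real.log_le_log (by positivity) (one_div_le_one_div_of_le hε₀ hgt.le)
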